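/- Consider, for a drift $u:[0,1]\times\mathbb R^2\to\mathbb R^2$ with $u\in L^1([0,1],C^0(\mathbb R^2))$ ($C^0$ carrying the supremum norm), a path $W\in C^0([0,1],\mathbb R^2)$ and $y\in\mathbb R^2$, the equation $$dX_t=u(t,X_t)\,dt+dW_t,\qquad X_0=y. \tag{1}$$ *Definitions.* For $T\in(0,1]$ and a deterministic $W\in C^0([0,T],\mathbb R^2)$, a Carathéodory solution of (1) on $[0,T]$ is an $X\in C^0([0,T],\mathbb R^2)$ with $X_t=y+\int_0^t u(s,X_s)\,ds+W_t-W_0$ for all $t\in[0,T]$. For a probability measure $\mathbb W$ on $C^0([0,1],\mathbb R^2)$, a weak solution of (1) with driving noise $\mathbb W$ is a probability measure $\mathbb X(dX,dW)$ on $C^0([0,1],\mathbb R^2)^2$ such that (i) its $W$-marginal is $\mathbb W$; (ii) for every $t\in[0,1]$, under $\mathbb X$, $X|_{[0,t]}$ and $W$ are conditionally independent given $W|_{[0,t]}$; (iii) $\mathbb X$-almost surely, $X$ is a Carathéodory solution of (1) on $[0,1]$ for the path $W$. Pathwise nonuniqueness on $[0,\varepsilon]$ means that there is a probability measure $\mathbb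 Y(dX^1,dX^2,dW)$ such that the laws of $(X^1,W)$ and of $(X^2,W)$ under $\mathbb Y$ are weak solutions and $\mathbb Y(X^1|_{[0,\varepsilon]}\neq X^2|_{[0,\varepsilon]})>0$. The norm $\|\cdot\|_{C^\alpha}$ is the usual Hölder norm (the supremum norm if $\alpha=0$; the supremum norm plus the $\alpha$-Hölder seminorm if $\alpha\in(0,1)$). A fractional Brownian motion on $\mathbb R^2$ with Hurst parameter $H$ is a continuous centered Gaussian process $(W_t)_{t\in[0,1]}$ with $\mathbb E[W_{t,i}W_{s,j}]=\frac12\delta_{ij}(t^{2H}+s^{2H}-|t-s|^{2H})$. **Statement.** For every $\alpha\in[0,1/2)$ there is a random velocity field $u:[0,1]\times\mathbb R^2\to\mathbb R^2$, with $u\in L^1([0,1],C^0(\mathbb R^2))$ surely, such that surely $\|u(t,\cdot)\|_{C^\alpha(\mathbb R^2)}\le 2$ for all $t\in[0,1]$, and such that for every $H\in(1/2,1)$ with $\alpha<1-\frac1{2H}$, if $W$ is a fractional Brownian motion on $\mathbb R^2$ with Hurst parameter $H$, independent of $u$ and with law $\mathbb W$, then the following hold for every deterministic $y\in\mathbb R^2$.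 1. For almost every $u$, the SDE (1) with driving noise $\mathbb W$ exhibits pathwise nonuniqueness on $[0,\varepsilon]$ for every $\varepsilon\in(0,1]$. 2. For almost every $u$, there is a weak solution $\mathbb X$ of (1) with driving noise $\mathbb W$ such that for every $\varepsilon\in(0,1]$ the conditional law under $\mathbb X$ of $X|_{[0,\varepsilon]}$ given $W$ is, for $\mathbb W$-almost every $W$, supported on more than one path (its support has at least two elements). Moreover, for almost every pair $(u,W)$, the equation (1) has more than one Carathéodory solution on $[0,\varepsilon]$ for every $\varepsilon\in(0,1]$. -/

import Mathlib

open MeasureTheory ProbabilityTheory Set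
open scoped ENNReal NNReal BoundedContinuousFunction

noncomputable section

/-- `ℝ^d` with the Euclidean norm. -/
abbrev Eucl (d : ℕ) : Type := EuclideanSpace ℝ (Fin d)

/-- The path space `C⁰([0,T], ℝ^d)` with the topology of uniform convergence. -/
abbrev PathSpace (d : ℕ) (T : ℝ) : Type := C(Icc (0 : ℝ) T, Eucl d)

instance (d : ℕ) (T : ℝ) : MeasurableSpace (PathSpace d T) := borel _

instance (d : ℕ) (T : ℝ) : BorelSpace (PathSpace d T) := ⟨rfl⟩

/-- The restriction `γ ↦ γ|_[0,t]` from `C⁰([0,T], ℝ^d)` to `C⁰([0,t], ℝ^d)`, for `t ≤ T`. -/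
def restrictPath {d : ℕ} {t T : ℝ} (h : t ≤ T) (γ : PathSpace d T) : PathSpace d t :=
  γ.comp ⟨inclusion (Icc_subset_Icc_right h), continuous_inclusion _⟩

lemma measurable_restrictPath {d : ℕ} {t T : ℝ} (h : t ≤ T) :
    Measurable (restrictPath (d := d) h) :=
  (ContinuousMap.continuous_precomp _).measurable

/-- A (deterministic) velocity field: a function of time with values in the space `C⁰(ℝ^d)` of
bounded continuous vector fields on `ℝ^d`, which carries the supremum norm. -/
abbrev VelocityField (d : ℕ) : Type := ℝ → (Eucl d →ᵇ Eucl d)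

/-- The usual norm of `C^α(ℝ^d)` for `α ∈ [0,1)`, possibly infinite: the supremum norm if `α = 0`,
and the supremum norm plus the Hölder seminorm of exponent `α` if `α > 0`. -/
def holderNorm {d : ℕ} (α : ℝ) (f : Eucl d → Eucl d) : ℝ≥0∞ :=
  if α = 0 then ⨆ x, ‖f x‖ₑ else (⨆ x, ‖f x‖ₑ) + eHolderNorm α.toNNReal f

/-- `X` is a Carathéodory solution on `[0,T]` of `dX_t = u(t,X_t) dt + dW_t`, `X_0 = y`, for the
deterministic drift `u` and the deterministic path `W`. -/
def IsCaratheodorySolution {d : ℕ} {T : ℝ} (hT : 0 ≤ T) (u : VelocityField d) (y : Eucl d)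
    (W X : PathSpace d T) : Prop :=
  ∀ t : Icc (0 : ℝ) T,
    X t = y + (∫ s in (0 : ℝ)..t, u s (X (projIcc 0 T hT s))) + W t - W ⟨0, le_rfl, hT⟩

/-- The sigma-algebra generated by `W|_[0,t]` on the space of pairs `(X, W)`. -/
abbrev noisePast (d : ℕ) {t T : ℝ} (h : t ≤ T) : MeasurableSpace (PathSpace d T × PathSpace d T) :=
  MeasurableSpace.comap (fun p => restrictPath h p.2) inferInstance

lemma noisePast_le (d : ℕ) {t T : ℝ} (h : t ≤ T) :
    noisePast d h ≤ (inferInstance : MeasurableSpace (PathSpace d T × PathSpace d T)) :=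
  ((measurable_restrictPath h).comp measurable_snd).comap_le

/-- `𝕏`, a law of pairs `(X, W)`, is a weak solution on `[0,T]` of the SDE
`dX_t = u(t,X_t) dt + dW_t`, `X_0 = y`, with driving noise of law `𝕎`. (If `𝕎` is a probability
measure, the first condition makes `𝕏` one.) -/
structure IsWeakSolution {d : ℕ} {T : ℝ} (hT : 0 ≤ T) (u : VelocityField d) (y : Eucl d)
    (𝕎 : Measure (PathSpace d T)) (𝕏 : Measure (PathSpace d T × PathSpace d T))
    [IsFiniteMeasure 𝕏] : Prop where
  /-- the noise marginal is `𝕎` -/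
  noise_marginal : 𝕏.map Prod.snd = 𝕎
  /-- for every `t`, `X|_[0,t]` and `W` are conditionally independent given `W|_[0,t]` -/
  nonanticipating : ∀ (t : ℝ) (_ : 0 ≤ t) (ht : t ≤ T),
    CondIndepFun (noisePast d ht) (noisePast_le d ht) (fun p => restrictPath ht p.1) Prod.snd 𝕏
  /-- the equation holds almost surely -/
  solves : ∀ᵐ p ∂𝕏, IsCaratheodorySolution hT u y p.2 p.1

/-- Pathwise nonuniqueness on `[0,ε]` for the SDE on `[0,T]`: there is a law `𝕐` of triples
`(X¹, X², W)` such that `(X¹, W)` and `(X², W)` are both weak solutions and it is not almost sure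
that `X¹|_[0,ε] = X²|_[0,ε]`. -/
def PathwiseNonuniqueOn {d : ℕ} {T : ℝ} (hT : 0 ≤ T) (u : VelocityField d) (y : Eucl d)
    (𝕎 : Measure (PathSpace d T)) {ε : ℝ} (hε : ε ≤ T) : Prop :=
  ∃ (𝕐 : Measure (PathSpace d T × PathSpace d T × PathSpace d T)) (_ : IsProbabilityMeasure 𝕐),
    IsWeakSolution hT u y 𝕎 (𝕐.map fun p => (p.1, p.2.2)) ∧
    IsWeakSolution hT u y 𝕎 (𝕐.map fun p => p.2) ∧
    ¬ ∀ᵐ p ∂𝕐, restrictPath hε p.1 = restrictPath hε p.2.1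

/-- Under the law `𝕏` of `(X, W)`, the conditional law of `X|_[0,ε]` given `W`. -/
def condLawGivenNoise {d : ℕ} {T : ℝ} (𝕏 : Measure (PathSpace d T × PathSpace d T))
    [IsFiniteMeasure 𝕏] {ε : ℝ} (hε : ε ≤ T) : Kernel (PathSpace d T) (PathSpace d ε) :=
  condDistrib (fun p => restrictPath hε p.1) Prod.snd 𝕏

/-- `𝕎` is the path measure on `C⁰([0,T], ℝ^d)` of `d`-dimensional fractional Brownian motion with
Hurst parameter `H`. -/
structure IsFBM {d : ℕ} {T : ℝ} (H : ℝ) (𝕎 : Measure (PathSpace d T)) : Prop where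
  gaussian : IsGaussianProcess (fun (t : Icc (0 : ℝ) T) (w : PathSpace d T) => w t) 𝕎
  centered : ∀ (t : Icc (0 : ℝ) T) (i : Fin d), ∫ w, w t i ∂𝕎 = 0
  covariance : ∀ (s t : Icc (0 : ℝ) T) (i j : Fin d),
    ∫ w, w t i * w s j ∂𝕎 =
      if i = j then
        1 / 2 * ((t : ℝ) ^ (2 * H) + (s : ℝ) ^ (2 * H) - |(t : ℝ) - (s : ℝ)| ^ (2 * H))
      else 0

end

/-! ### Averaging of a periodic function along `s ↦ ψ + K cos s` -/

/-! On the time stage (2^{-(k+1)}, 2^{-k}] the field is one sinusoidal shear of frequency λ_k =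
2^(k^4), the direction alternating between the two coordinates, so that infinitely many ever finer
shears accumulate at time 0. Write X = θ + (W - W_0). During stage k only one coordinate of θ moves,
and the shear reads the other one. Hence the stage displaces θ by Re(β_k exp(iλ_k θ')), where θ' is
the coordinate being read and β_k is the integral over the stage of b(s) exp(iλ_k (W_s - W_0)'). For
a fixed noise path the flow of θ is thus an explicit composition of shears with complex amplitudes
β_k (`approxPos_pow`).

Spreading: start at time 2^{-(n+1)} at y plus a perturbation of size about 1/λ_n, chosen so that the
phase read by shear n is uniform. If |β_{k+1}| λ_k is large, shear k+1 turns a uniform phase v into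
a phase ψ + K cos v of shear k with K large, and a periodic function averaged along such a curve
nearly has its own mean (`norm_integral_comp_cos_sub_le`). Meanwhile everything after shear k varies
slowly in the position, because λ_{k+1}/λ_k grows faster than the accumulated Lipschitz losses. So
replacing the start at stage n by a start at stage n+1 changes the mean of the phase factor of shear
m by a geometrically small amount (`norm_meanPhase_succ_sub_le`), and this mean stays at most 1/2 in
modulus, uniformly in n (`norm_meanPhase_le`). The perturbation disappears as n → ∞, the spread does
not.

Passing to the limit: θ is 1-Lipschitz in time, so the joint laws of (X, W) are tight. All of them
have the same W-marginal, so convergence holds against functions that are merely measurable in W;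
this keeps both nonanticipation and the bound on the conditional mean phase
(`exists_isWeakSolution_of_approx`, `exists_isWeakSolution_spread`). The conditional law given W is
then no Dirac mass on any initial interval. Two copies of X, conditionally independent given W, give
pathwise nonuniqueness (`CondSpread.pathwiseNonuniqueOn`), and the same construction with W replaced
by a single path gives several Carathéodory solutions (`nontrivial_solutions_of_shearsMix`).

Size of β_k: the amplitude b is λ_k^(-α), up to polynomial factors in k, times independent truncated
Gaussians on N equal cells of stage k. If the phase λ_k W oscillates little within a cell on
average, β_k is a Gaussian combination whose coefficients have square sum of order (stage
length)²/N. For fractional Brownian motion the mean oscillation is at most λ_k N^(-H), and the size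
required of β_k allows N to be λ_k^(2(1-α)) up to lower order in the exponent. The oscillation is
small exactly because 2H(1-α) > 1, which is the condition α < 1 - 1/(2H)
(`eventually_shearFreq_mul_rpow_le`). Gaussian small-ball and tail bounds
(`gaussField_not_ampInRange_le`) and Borel–Cantelli then give mixing for almost every pair
(`ae_shearsMix_randAmp`). -/

lemma half_le_sin {x : ℝ} (h0 : 0 ≤ x) (h1 : x ≤ 1) : x / 2 ≤ Real.sin x := by
  have hpi := Real.pi_gt_three
  have := Real.mul_le_sin h0 (by linarith)
  have h2 : (1 / 2 : ℝ) ≤ 2 / Real.pi := by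
    rw [div_le_div_iff₀ (by norm_num) Real.pi_pos]
    linarith [Real.pi_lt_four]
  nlinarith

/-- Vanishing mean makes the primitive periodic, so it suffices to bound it over one period. -/
lemma norm_primitive_le_of_periodic {h : ℝ → ℂ} (hc : Continuous h)
    (hp : Function.Periodic h (2 * Real.pi)) (hb : ∀ x, ‖h x‖ ≤ 2)
    (h0 : ∫ s in (0 : ℝ)..2 * Real.pi, h s = 0) (x : ℝ) :
    ‖∫ s in (0 : ℝ)..x, h s‖ ≤ 4 * Real.pi := by
  have hper : Function.Periodic (fun x => ∫ s in (0 : ℝ)..x, h s) (2 * Real.pi) := by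
    intro x
    have h1 := hp.intervalIntegral_add_eq x 0
    have h2 := intervalIntegral.integral_add_adjacent_intervals (hc.intervalIntegrable 0 x)
      (hc.intervalIntegrable x (x + 2 * Real.pi)) (μ := volume)
    simp only [zero_add] at h1
    rw [h1, h0, add_zero] at h2
    exact h2.symm
  obtain ⟨y, hy, hxy⟩ := hper.exists_mem_Ico₀ Real.two_pi_pos x
  rw [show ∫ s in (0 : ℝ)..x, h s = ∫ s in (0 : ℝ)..y, h s from hxy]
  have := intervalIntegral.norm_integral_le_of_norm_le_const (a := 0) (b := y) (f := h) (C := 2)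
    (fun x _ => hb x)
  rw [sub_zero, abs_of_nonneg hy.1] at this
  linarith [hy.2]

/-- Nonstationary phase: away from the critical points 0 and π of the cosine, the integrand is -1/(K
sin s) times the derivative of G(ψ + K cos s), with G the bounded primitive of h. One integration by
parts gains the factor 1/K. -/
lemma norm_integral_comp_cos_inner_le {h : ℝ → ℂ} (hc : Continuous h)
    (hp : Function.Periodic h (2 * Real.pi)) (hb : ∀ x, ‖h x‖ ≤ 2)
    (h0 : ∫ s in (0 : ℝ)..2 * Real.pi, h s = 0) {K δ : ℝ} (hK : 0 < K) (hδ : 0 < δ) (hδ1 : δ ≤ 1)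
    (ψ : ℝ) :
    ‖∫ s in δ..Real.pi - δ, h (ψ + K * Real.cos s)‖ ≤ 260 / (K * δ ^ 2) := by
  have hpi := Real.pi_gt_three
  set G : ℝ → ℂ := fun x => ∫ s in (0 : ℝ)..x, h s with hG
  have hGd : ∀ x, HasDerivAt G (h x) x := fun x =>
    intervalIntegral.integral_hasDerivAt_right (hc.intervalIntegrable _ _)
      hc.aestronglyMeasurable.stronglyMeasurableAtFilter hc.continuousAt
  have hGb : ∀ x, ‖G x‖ ≤ 4 * Real.pi := norm_primitive_le_of_periodic hc hp hb h0
  have hGc : Continuous G := continuous_iff_continuousAt.2 fun x => (hGd x).continuousAt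
  have hGs : Continuous fun s => G (ψ + K * Real.cos s) := hGc.comp (by fun_prop)
  set σ := Real.sin δ with hσ
  have hσ2 : δ / 2 ≤ σ := half_le_sin hδ.le hδ1
  have hσ0 : 0 < σ := by linarith
  have hle : δ ≤ Real.pi - δ := by linarith
  have hsin : ∀ s ∈ Icc δ (Real.pi - δ), σ ≤ Real.sin s := by
    intro s hs
    rcases le_total s (Real.pi / 2) with h | h
    · exact Real.sin_le_sin_of_le_of_le_pi_div_two (by linarith) h hs.1
    · rw [← Real.sin_pi_sub s]
      exact Real.sin_le_sin_of_le_of_le_pi_div_two (by linarith) (by linarith) (by linarith [hs.2])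
  have hd : ∀ s ∈ uIcc δ (Real.pi - δ),
      HasDerivAt (fun s => ((Real.sin s)⁻¹ : ℝ) • G (ψ + K * Real.cos s))
        (-(K • h (ψ + K * Real.cos s))
          - (Real.cos s / Real.sin s ^ 2) • G (ψ + K * Real.cos s)) s := by
    intro s hs
    rw [uIcc_of_le hle] at hs
    have hs0 : Real.sin s ≠ 0 := (hσ0.trans_le (hsin s hs)).ne'
    have h1 : HasDerivAt (fun s => ψ + K * Real.cos s) (K * (-Real.sin s)) s :=
      ((Real.hasDerivAt_cos s).const_mul K).const_add ψ
    have h2 := (hGd (ψ + K * Real.cos s)).scomp s h1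
    have h3 := ((Real.hasDerivAt_sin s).inv hs0).smul h2
    convert! h3 using 1
    simp only [Function.comp, Pi.inv_apply, smul_smul, neg_div, neg_smul, sub_eq_add_neg]
    congr 1
    rw [← neg_smul]
    congr 1
    field_simp
  have hcont : ContinuousOn (fun s => -(K • h (ψ + K * Real.cos s))
          - (Real.cos s / Real.sin s ^ 2) • G (ψ + K * Real.cos s)) (uIcc δ (Real.pi - δ)) := by
    rw [uIcc_of_le hle]
    refine ContinuousOn.sub (by fun_prop) (ContinuousOn.fun_smul ?_ hGs.continuousOn)
    refine ContinuousOn.div (by fun_prop) (by fun_prop) fun s hs => ?_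
    exact pow_ne_zero _ (hσ0.trans_le (hsin s hs)).ne'
  have hcont2 : ContinuousOn (fun s => (Real.cos s / Real.sin s ^ 2) • G (ψ + K * Real.cos s))
      (uIcc δ (Real.pi - δ)) := by
    rw [uIcc_of_le hle]
    refine ContinuousOn.fun_smul ?_ hGs.continuousOn
    refine ContinuousOn.div (by fun_prop) (by fun_prop) fun s hs => ?_
    exact pow_ne_zero _ (hσ0.trans_le (hsin s hs)).ne'
  have hftc := intervalIntegral.integral_eq_sub_of_hasDerivAt hd hcont.intervalIntegrable
  rw [intervalIntegral.integral_sub ((by fun_prop : Continuous fun s =>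
    -(K • h (ψ + K * Real.cos s))).intervalIntegrable _ _) hcont2.intervalIntegrable,
    intervalIntegral.integral_neg, intervalIntegral.integral_smul, Real.sin_pi_sub] at hftc
  have hbd2 : ‖∫ s in δ..Real.pi - δ, (Real.cos s / Real.sin s ^ 2) • G (ψ + K * Real.cos s)‖
      ≤ (4 * Real.pi / σ ^ 2) * Real.pi := by
    refine (intervalIntegral.norm_integral_le_of_norm_le_const
      (C := 4 * Real.pi / σ ^ 2) fun s hs => ?_).trans ?_
    · rw [uIoc_of_le hle] at hs
      have hs' := hsin s ⟨hs.1.le, hs.2⟩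
      rw [norm_smul, Real.norm_eq_abs, abs_div, abs_of_nonneg (sq_nonneg (Real.sin s)),
        div_mul_eq_mul_div]
      refine div_le_div₀ (by positivity) ?_ (by positivity) (by gcongr)
      calc |Real.cos s| * ‖G (ψ + K * Real.cos s)‖ ≤ 1 * (4 * Real.pi) :=
            mul_le_mul (Real.abs_cos_le_one s) (hGb _) (norm_nonneg _) zero_le_one
        _ = _ := one_mul _
    · refine mul_le_mul_of_nonneg_left ?_ (by positivity)
      rw [abs_of_nonneg (by linarith)]
      linarith
  have hb1 : ∀ x, ‖((σ)⁻¹ : ℝ) • G x‖ ≤ 4 * Real.pi / σ := by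
    intro x
    rw [norm_smul, Real.norm_eq_abs, abs_of_pos (inv_pos.2 hσ0), inv_mul_eq_div]
    gcongr
    exact hGb x
  have hmain : ‖K • ∫ s in δ..Real.pi - δ, h (ψ + K * Real.cos s)‖
      ≤ 4 * Real.pi / σ + 4 * Real.pi / σ + (4 * Real.pi / σ ^ 2) * Real.pi := by
    have : K • ∫ s in δ..Real.pi - δ, h (ψ + K * Real.cos s)
        = -((σ)⁻¹ • G (ψ + K * Real.cos (Real.pi - δ)) - (σ)⁻¹ • G (ψ + K * Real.cos δ))
          - ∫ s in δ..Real.pi - δ, (Real.cos s / Real.sin s ^ 2) • G (ψ + K * Real.cos s) := by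
      rw [← hftc]; ring
    rw [this]
    refine (norm_sub_le _ _).trans (add_le_add ?_ hbd2)
    rw [norm_neg]
    exact (norm_sub_le _ _).trans (add_le_add (hb1 _) (hb1 _))
  rw [norm_smul, Real.norm_eq_abs, abs_of_pos hK] at hmain
  have hσ1 : σ ≤ 1 := Real.sin_le_one _
  have h4 : 4 * Real.pi / σ ≤ 4 * Real.pi / σ ^ 2 := by
    apply div_le_div_of_nonneg_left (by positivity) (by positivity)
    nlinarith
  have h5 : K * ‖∫ s in δ..Real.pi - δ, h (ψ + K * Real.cos s)‖ ≤ 260 / δ ^ 2 := by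
    refine hmain.trans ?_
    have h6 : 4 * Real.pi / σ ^ 2 ≤ 4 * Real.pi / (δ / 2) ^ 2 := by
      apply div_le_div_of_nonneg_left (by positivity) (by positivity)
      gcongr
    have h7 : 4 * Real.pi / (δ / 2) ^ 2 = 16 * Real.pi / δ ^ 2 := by field_simp; ring
    have hpi' := Real.pi_lt_d2
    -- Two boundary terms and one integral over a length at most π, with σ ≥ δ/2; the total 16π(2 +
    -- π) is just below 260.
    calc 4 * Real.pi / σ + 4 * Real.pi / σ + (4 * Real.pi / σ ^ 2) * Real.pi
        ≤ (16 * Real.pi / δ ^ 2) * (2 + Real.pi) := by nlinarith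
      _ = (16 * Real.pi * (2 + Real.pi)) / δ ^ 2 := by ring
      _ ≤ 260 / δ ^ 2 := by
          gcongr
          nlinarith
  rw [← div_div, div_right_comm, le_div_iff₀ hK, mul_comm]
  exact h5

/-- The reflection s ↦ 2π - s reduces to the half period [0, π]. The δ-neighbourhoods of the
critical points are bounded trivially, by 2δ for each of the four pieces. -/
lemma norm_integral_comp_cos_le {h : ℝ → ℂ} (hc : Continuous h)
    (hp : Function.Periodic h (2 * Real.pi)) (hb : ∀ x, ‖h x‖ ≤ 2)
    (h0 : ∫ s in (0 : ℝ)..2 * Real.pi, h s = 0) {K δ : ℝ} (hK : 0 < K) (hδ : 0 < δ) (hδ1 : δ ≤ 1)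
    (ψ : ℝ) :
    ‖∫ s in (0 : ℝ)..2 * Real.pi, h (ψ + K * Real.cos s)‖ ≤ 8 * δ + 520 / (K * δ ^ 2) := by
  have hpi := Real.pi_gt_three
  have hi : ∀ a b : ℝ, IntervalIntegrable (fun s => h (ψ + K * Real.cos s)) volume a b := fun a b =>
    (by fun_prop : Continuous fun s => h (ψ + K * Real.cos s)).intervalIntegrable a b
  have hsymm : ∫ s in Real.pi..2 * Real.pi, h (ψ + K * Real.cos s)
      = ∫ s in (0 : ℝ)..Real.pi, h (ψ + K * Real.cos s) := by
    have := intervalIntegral.integral_comp_sub_left (fun s => h (ψ + K * Real.cos s))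
      (2 * Real.pi) (a := 0) (b := Real.pi)
    simp only [Real.cos_two_pi_sub, sub_zero] at this
    rw [this]
    congr 1
    ring
  rw [← intervalIntegral.integral_add_adjacent_intervals (hi 0 Real.pi) (hi _ _), hsymm,
    ← intervalIntegral.integral_add_adjacent_intervals (hi 0 δ) (hi _ _),
    ← intervalIntegral.integral_add_adjacent_intervals (hi δ (Real.pi - δ)) (hi _ Real.pi)]
  have h1 : ‖∫ s in (0 : ℝ)..δ, h (ψ + K * Real.cos s)‖ ≤ 2 * δ := by
    have := intervalIntegral.norm_integral_le_of_norm_le_const (a := 0) (b := δ)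
      (f := fun s => h (ψ + K * Real.cos s)) (C := 2) (fun x _ => hb _)
    rwa [sub_zero, abs_of_pos hδ] at this
  have h3 : ‖∫ s in (Real.pi - δ)..Real.pi, h (ψ + K * Real.cos s)‖ ≤ 2 * δ := by
    have := intervalIntegral.norm_integral_le_of_norm_le_const (a := Real.pi - δ) (b := Real.pi)
      (f := fun s => h (ψ + K * Real.cos s)) (C := 2) (fun x _ => hb _)
    rwa [sub_sub_cancel, abs_of_pos hδ] at this
  have h2 := norm_integral_comp_cos_inner_le hc hp hb h0 hK hδ hδ1 ψ
  have h4 : (520 : ℝ) / (K * δ ^ 2) = 2 * (260 / (K * δ ^ 2)) := by ring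
  rw [h4]
  set A := ∫ s in (0 : ℝ)..δ, h (ψ + K * Real.cos s)
  set B := ∫ s in δ..Real.pi - δ, h (ψ + K * Real.cos s)
  set C := ∫ s in (Real.pi - δ)..Real.pi, h (ψ + K * Real.cos s)
  calc ‖A + (B + C) + (A + (B + C))‖ ≤ ‖A‖ + (‖B‖ + ‖C‖) + (‖A‖ + (‖B‖ + ‖C‖)) := by
        refine (norm_add_le _ _).trans (add_le_add ?_ ?_) <;>
        exact (norm_add_le _ _).trans (add_le_add le_rfl (norm_add_le _ _))
    _ ≤ _ := by linarith

/-- A periodic function averaged along `s ↦ ψ + K cos (s + c)` has almost its mean, for large `K`. -/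
lemma norm_integral_comp_cos_sub_le {g : ℝ → ℂ} (hc : Continuous g)
    (hp : Function.Periodic g (2 * Real.pi)) (hb : ∀ x, ‖g x‖ ≤ 1)
    {K δ : ℝ} (hK : 0 < K) (hδ : 0 < δ) (hδ1 : δ ≤ 1) (ψ c : ℝ) :
    ‖(∫ s in (0 : ℝ)..2 * Real.pi, g (ψ + K * Real.cos (s + c)))
      - ∫ s in (0 : ℝ)..2 * Real.pi, g s‖ ≤ 8 * δ + 520 / (K * δ ^ 2) := by
  set M : ℂ := (2 * Real.pi : ℝ)⁻¹ • ∫ s in (0 : ℝ)..2 * Real.pi, g s with hM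
  have h2pi := Real.two_pi_pos
  have hMn : ‖M‖ ≤ 1 := by
    have := intervalIntegral.norm_integral_le_of_norm_le_const (a := 0) (b := 2 * Real.pi)
      (f := g) (C := 1) (fun x _ => hb _)
    rw [sub_zero, abs_of_pos h2pi, one_mul] at this
    rw [hM, norm_smul, Real.norm_eq_abs, abs_of_pos (inv_pos.2 h2pi), inv_mul_le_iff₀ h2pi, mul_one]
    exact this
  have hMi : (2 * Real.pi : ℝ) • M = ∫ s in (0 : ℝ)..2 * Real.pi, g s := by
    rw [hM, smul_smul, mul_inv_cancel₀ h2pi.ne', one_smul]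
  have hshift : ∫ s in (0 : ℝ)..2 * Real.pi, g (ψ + K * Real.cos (s + c))
      = ∫ s in (0 : ℝ)..2 * Real.pi, g (ψ + K * Real.cos s) := by
    rw [intervalIntegral.integral_comp_add_right (fun s => g (ψ + K * Real.cos s)) c]
    have hper : Function.Periodic (fun s => g (ψ + K * Real.cos s)) (2 * Real.pi) := fun s => by
      simp only [Real.cos_add_two_pi]
    have := hper.intervalIntegral_add_eq c 0
    rw [zero_add] at this
    rw [← this, zero_add, add_comm c]
  have hi : ∀ a b : ℝ, IntervalIntegrable (fun s => g (ψ + K * Real.cos s)) volume a b := fun a b =>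
    (by fun_prop : Continuous fun s => g (ψ + K * Real.cos s)).intervalIntegrable a b
  -- Removing the mean, itself of modulus at most 1, leaves a mean-zero function bounded by 2.
  have := norm_integral_comp_cos_le (h := fun x => g x - M) (by fun_prop)
    (fun x => by simp only [hp x]) (fun x => (norm_sub_le _ _).trans (by linarith [hb x])) (by
      rw [intervalIntegral.integral_sub (hc.intervalIntegrable _ _) (by simp), ← hMi]
      simp) hK hδ hδ1 ψ
  rw [intervalIntegral.integral_sub (hi _ _) (by simp), intervalIntegral.integral_const,
    sub_zero, hMi] at this
  rwa [hshift]

noncomputable section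

/-! ### Compositions of alternating sinusoidal shears -/

/-- The direction of the `k`-th shear. -/
def shearDir (k : ℕ) : Fin 2 := if Even k then 0 else 1

/-- The spatial frequency of the `k`-th shear. -/
def shearFreq (k : ℕ) : ℝ := 2 ^ (k ^ 4)

/-- The unit vector of the `k`-th shear. -/
def shearVec (k : ℕ) : Eucl 2 := EuclideanSpace.single (shearDir k) 1

lemma shearFreq_pos (k : ℕ) : 0 < shearFreq k := by unfold shearFreq; positivity

lemma one_le_shearFreq (k : ℕ) : 1 ≤ shearFreq k := one_le_pow₀ (by norm_num)

lemma shearFreq_mono {j k : ℕ} (h : j ≤ k) : shearFreq j ≤ shearFreq k :=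
  pow_le_pow_right₀ (by norm_num) (Nat.pow_le_pow_left h 4)

lemma shearDir_succ_ne (k : ℕ) : shearDir (k + 1) ≠ shearDir k := by
  unfold shearDir
  by_cases h : Even k <;> simp [Nat.even_add_one, h]

lemma norm_shearVec (k : ℕ) : ‖shearVec k‖ = 1 := by simp [shearVec]

lemma shearVec_self (k : ℕ) : shearVec k (shearDir k) = 1 := by simp [shearVec]

lemma shearVec_succ (k : ℕ) : shearVec k (shearDir (k + 1)) = 0 := by
  simp [shearVec, shearDir_succ_ne]

lemma shearVec_pred (k : ℕ) : shearVec (k + 1) (shearDir k) = 0 := by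
  simp [shearVec, (shearDir_succ_ne k).symm]

/-- The displacement `Re (b e^{iφ})`. -/
def waveRe (b : ℂ) (φ : ℝ) : ℝ := (b * Complex.exp (φ * Complex.I)).re

lemma waveRe_eq (b : ℂ) (φ : ℝ) : waveRe b φ = ‖b‖ * Real.cos (φ + b.arg) := by
  unfold waveRe
  conv_lhs => rw [← Complex.norm_mul_exp_arg_mul_I b]
  rw [mul_assoc, ← Complex.exp_add, ← add_mul, Complex.re_ofReal_mul, ← Complex.ofReal_add,
    Complex.exp_ofReal_mul_I_re, add_comm]

lemma waveRe_eq' (b : ℂ) (φ c : ℝ) : waveRe b (φ + c) = ‖b‖ * Real.cos (φ + (c + b.arg)) := by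
  rw [waveRe_eq, add_assoc]

lemma abs_waveRe_le (b : ℂ) (φ : ℝ) : |waveRe b φ| ≤ ‖b‖ := by
  rw [waveRe_eq, abs_mul, abs_norm]
  exact mul_le_of_le_one_right (norm_nonneg _) (Real.abs_cos_le_one _)

lemma continuous_waveRe : Continuous fun p : ℂ × ℝ => waveRe p.1 p.2 := by
  unfold waveRe; fun_prop

lemma waveRe_periodic (b : ℂ) : Function.Periodic (waveRe b) (2 * Real.pi) := fun x => by
  rw [waveRe_eq, waveRe_eq, add_right_comm, Real.cos_add_two_pi]

lemma abs_cos_sub_cos_le (x y : ℝ) : |Real.cos x - Real.cos y| ≤ |x - y| := by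
  have := Convex.norm_image_sub_le_of_norm_deriv_le (f := Real.cos) (C := 1) (s := univ) (x := y)
    (y := x) (fun x _ => Real.differentiable_cos x) (fun x _ => by
      simpa using Real.abs_sin_le_one x) convex_univ trivial trivial
  simpa using this

lemma abs_waveRe_sub_le (b : ℂ) (x y : ℝ) : |waveRe b x - waveRe b y| ≤ ‖b‖ * |x - y| := by
  rw [waveRe_eq, waveRe_eq, ← mul_sub, abs_mul, abs_norm]
  refine mul_le_mul_of_nonneg_left ?_ (norm_nonneg _)
  have := abs_cos_sub_cos_le (x + b.arg) (y + b.arg)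
  rwa [add_sub_add_right_eq_sub] at this

/-- The `k`-th shear, of complex amplitude `β k`. -/
def shearMap (β : ℕ → ℂ) (k : ℕ) (θ : Eucl 2) : Eucl 2 :=
  θ + waveRe (β k) (shearFreq k * θ (shearDir (k + 1))) • shearVec k

/-- The composition `S_m ∘ ⋯ ∘ S_{m+j-1}` of shears. -/
def shearFlow (β : ℕ → ℂ) (m : ℕ) : ℕ → Eucl 2 → Eucl 2
  | 0 => id
  | j + 1 => shearFlow β m j ∘ shearMap β (m + j)

lemma shearFlow_succ' (β : ℕ → ℂ) (m j : ℕ) :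
    shearFlow β m (j + 1) = shearMap β m ∘ shearFlow β (m + 1) j := by
  induction j with
  | zero => simp [shearFlow]
  | succ j ih =>
    rw [shearFlow, ih, shearFlow, Function.comp_assoc]
    congr 3
    ring

lemma abs_coord_le (θ : Eucl 2) (i : Fin 2) : |θ i| ≤ ‖θ‖ := by
  simpa using PiLp.norm_apply_le θ i

lemma norm_shearMap_sub_le (β : ℕ → ℂ) (k : ℕ) (θ θ' : Eucl 2) :
    ‖shearMap β k θ - shearMap β k θ'‖ ≤ (1 + ‖β k‖ * shearFreq k) * ‖θ - θ'‖ := by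
  unfold shearMap
  rw [add_sub_add_comm, ← sub_smul]
  refine (norm_add_le _ _).trans ?_
  rw [norm_smul, norm_shearVec, mul_one, add_mul, one_mul]
  refine add_le_add le_rfl ?_
  refine (abs_waveRe_sub_le _ _ _).trans ?_
  rw [← mul_sub, abs_mul, abs_of_pos (shearFreq_pos k), mul_assoc]
  gcongr
  · exact (shearFreq_pos k).le
  · simpa using abs_coord_le (θ - θ') (shearDir (k + 1))

/-- The Lipschitz constant of `shearFlow β m j`. -/
def shearLip (β : ℕ → ℂ) (m j : ℕ) : ℝ :=
  ∏ i ∈ Finset.range j, (1 + ‖β (m + i)‖ * shearFreq (m + i))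

lemma shearLip_nonneg (β : ℕ → ℂ) (m j : ℕ) : 0 ≤ shearLip β m j :=
  Finset.prod_nonneg fun i _ => by
    have := shearFreq_pos (m + i)
    positivity

lemma norm_shearFlow_sub_le (β : ℕ → ℂ) (m j : ℕ) (θ θ' : Eucl 2) :
    ‖shearFlow β m j θ - shearFlow β m j θ'‖ ≤ shearLip β m j * ‖θ - θ'‖ := by
  induction j generalizing θ θ' with
  | zero => simp [shearFlow, shearLip]
  | succ j ih =>
    refine (ih _ _).trans ?_
    rw [show shearLip β m (j + 1) = shearLip β m j * (1 + ‖β (m + j)‖ * shearFreq (m + j)) from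
      Finset.prod_range_succ _ _, mul_assoc]
    exact mul_le_mul_of_nonneg_left (norm_shearMap_sub_le _ _ _ _) (shearLip_nonneg β m j)

/-! ### Two-scale description of the flow and the mean phase -/

/-- The phase factor seen by the `m`-th shear. -/
def phaseObs (m : ℕ) (θ : Eucl 2) : ℂ :=
  Complex.exp ((shearFreq m * θ (shearDir (m + 1)) : ℝ) * Complex.I)

lemma norm_phaseObs (m : ℕ) (θ : Eucl 2) : ‖phaseObs m θ‖ = 1 :=
  Complex.norm_exp_ofReal_mul_I _

lemma norm_exp_sub_exp_le (x y : ℝ) :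
    ‖Complex.exp (x * Complex.I) - Complex.exp (y * Complex.I)‖ ≤ |x - y| := by
  have := Convex.norm_image_sub_le_of_norm_deriv_le (𝕜 := ℝ)
    (f := fun t : ℝ => Complex.exp (t * Complex.I)) (C := 1) (s := univ) (x := y)
    (y := x) (fun x _ => by fun_prop) (fun x _ => by
      have h : HasDerivAt (fun t : ℝ => Complex.exp (t * Complex.I))
          (Complex.exp (x * Complex.I) * (1 * Complex.I)) x :=
        ((Complex.ofRealCLM.hasDerivAt (x := x)).mul_const Complex.I).cexp
      rw [h.deriv, norm_mul, Complex.norm_exp_ofReal_mul_I]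
      simp) convex_univ trivial trivial
  simpa using this

lemma norm_phaseObs_sub_le (m : ℕ) (θ θ' : Eucl 2) :
    ‖phaseObs m θ - phaseObs m θ'‖ ≤ shearFreq m * ‖θ - θ'‖ := by
  refine (norm_exp_sub_exp_le _ _).trans ?_
  rw [← mul_sub, abs_mul, abs_of_pos (shearFreq_pos m)]
  gcongr
  · exact (shearFreq_pos m).le
  · simpa using abs_coord_le (θ - θ') (shearDir (m + 1))

/-- The observable `phaseObs m ∘ shearFlow β (m + 1) j` with the phase of the next shear
separated from the position. -/
def liftedObs (β : ℕ → ℂ) (m : ℕ) : ℕ → Eucl 2 → ℝ → ℂ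
  | 0, _, φ => Complex.exp (φ * Complex.I)
  | j + 1, θ, φ => phaseObs m (shearFlow β (m + 1) j
      (θ + waveRe (β (m + 1 + j)) φ • shearVec (m + 1 + j)))

/-- A Lipschitz constant of `liftedObs` in the position. -/
def liftedLip (β : ℕ → ℂ) (m : ℕ) : ℕ → ℝ
  | 0 => 0
  | j + 1 => shearFreq m * shearLip β (m + 1) j

lemma liftedLip_nonneg (β : ℕ → ℂ) (m j : ℕ) : 0 ≤ liftedLip β m j := by
  cases j with
  | zero => exact le_rfl
  | succ j => exact mul_nonneg (shearFreq_pos m).le (shearLip_nonneg β _ j)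

/-- Separates the fast variable, the phase at frequency `shearFreq (m + j)`, from the slow position.
The averaging argument moves the phase and freezes the position. -/
lemma phaseObs_shearFlow_eq (β : ℕ → ℂ) (m j : ℕ) (θ : Eucl 2) :
    phaseObs m (shearFlow β (m + 1) j θ)
      = liftedObs β m j θ (shearFreq (m + j) * θ (shearDir (m + j + 1))) := by
  cases j with
  | zero => rfl
  | succ j =>
    simp only [liftedObs, shearFlow, Function.comp, shearMap, add_right_comm m 1 j]
    rfl

lemma norm_liftedObs (β : ℕ → ℂ) (m j : ℕ) (θ : Eucl 2) (φ : ℝ) : ‖liftedObs β m j θ φ‖ = 1 := by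
  cases j with
  | zero => exact Complex.norm_exp_ofReal_mul_I _
  | succ j => exact norm_phaseObs _ _

/-- With the phase frozen, the innermost shear translates both positions by the same vector, so its
frequency does not enter the constant. This missing factor is the scale separation. -/
lemma norm_liftedObs_sub_le (β : ℕ → ℂ) (m j : ℕ) (θ θ' : Eucl 2) (φ : ℝ) :
    ‖liftedObs β m j θ φ - liftedObs β m j θ' φ‖ ≤ liftedLip β m j * ‖θ - θ'‖ := by
  cases j with
  | zero => simp [liftedObs, liftedLip]
  | succ j =>
    refine (norm_phaseObs_sub_le _ _ _).trans ?_
    rw [liftedLip, mul_assoc]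
    refine mul_le_mul_of_nonneg_left ?_ (shearFreq_pos m).le
    refine (norm_shearFlow_sub_le _ _ _ _ _).trans (le_of_eq ?_)
    rw [add_sub_add_right_eq_sub]

lemma liftedObs_periodic (β : ℕ → ℂ) (m j : ℕ) (θ : Eucl 2) :
    Function.Periodic (liftedObs β m j θ) (2 * Real.pi) := fun φ => by
  cases j with
  | zero =>
    simp only [liftedObs]
    rw [Complex.ofReal_add, add_mul, Complex.exp_add]
    simp [Complex.exp_two_pi_mul_I]
  | succ j => simp only [liftedObs, waveRe_periodic (β (m + 1 + j)) φ]

lemma continuous_shearMap (β : ℕ → ℂ) (k : ℕ) : Continuous (shearMap β k) := by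
  unfold shearMap
  have : Continuous fun θ : Eucl 2 => waveRe (β k) (shearFreq k * θ (shearDir (k + 1))) :=
    continuous_waveRe.comp (by fun_prop : Continuous fun θ : Eucl 2 =>
      (β k, shearFreq k * θ (shearDir (k + 1))))
  fun_prop

lemma continuous_shearFlow (β : ℕ → ℂ) (m j : ℕ) : Continuous (shearFlow β m j) := by
  induction j with
  | zero => exact continuous_id
  | succ j ih => exact ih.comp (continuous_shearMap β _)

lemma continuous_phaseObs (m : ℕ) : Continuous (phaseObs m) := by
  unfold phaseObs; fun_prop

lemma continuous_liftedObs (β : ℕ → ℂ) (m j : ℕ) :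
    Continuous fun p : Eucl 2 × ℝ => liftedObs β m j p.1 p.2 := by
  cases j with
  | zero => simp only [liftedObs]; fun_prop
  | succ j =>
    refine (continuous_phaseObs m).comp ((continuous_shearFlow β (m + 1) j).comp ?_)
    have : Continuous fun p : Eucl 2 × ℝ => waveRe (β (m + 1 + j)) p.2 :=
      continuous_waveRe.comp (by fun_prop : Continuous fun p : Eucl 2 × ℝ => (β (m + 1 + j), p.2))
    fun_prop

/-- The `2π`-fold mean of `phaseObs m` at the end of the stages `m + j, …, m + 1`, when the
phase seen by the first of them is uniformly distributed. -/
def meanPhase (β : ℕ → ℂ) (y : Eucl 2) (m j : ℕ) : ℂ :=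
  ∫ v in (0 : ℝ)..2 * Real.pi, phaseObs m (shearFlow β (m + 1) j
    (y + (v / shearFreq (m + j)) • shearVec (m + j + 1)))

/-- With no preceding shear, the phase is uniform over a full period and its exponential integrates
to zero. -/
lemma meanPhase_zero (β : ℕ → ℂ) (y : Eucl 2) (m : ℕ) : meanPhase β y m 0 = 0 := by
  have h : ∀ v : ℝ, phaseObs m (shearFlow β (m + 1) 0
      (y + (v / shearFreq (m + 0)) • shearVec (m + 0 + 1)))
      = Complex.exp ((shearFreq m * y (shearDir (m + 1)) : ℝ) * Complex.I)
        * Complex.exp (Complex.I * v) := by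
    intro v
    rw [← Complex.exp_add]
    simp only [shearFlow, phaseObs, id, add_zero, PiLp.add_apply, PiLp.smul_apply, shearVec_self]
    congr 1
    rw [show shearFreq m * (y (shearDir (m + 1)) + (v / shearFreq m) • (1 : ℝ))
      = shearFreq m * y (shearDir (m + 1)) + v by
        have := (shearFreq_pos m).ne'
        simp only [smul_eq_mul]
        field_simp]
    push_cast
    ring
  unfold meanPhase
  simp_rw [h]
  rw [intervalIntegral.integral_const_mul, integral_exp_mul_complex Complex.I_ne_zero]
  simp [mul_comm Complex.I, Complex.exp_two_pi_mul_I]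

/-- With n = m + j, both means are compared with that of the lifted observable at the frozen
position y. With the extra shear n + 1, a uniform phase v becomes the phase ψ + K cos(v + const) of
shear n, where K = `shearFreq n * ‖β (n + 1)‖`, and averaging along the cosine makes it nearly
uniform; without it, the phase is uniform already. The first two error terms come from this
averaging, the last from freezing the position. -/
lemma norm_meanPhase_succ_sub_le (β : ℕ → ℂ) (y : Eucl 2) (m j : ℕ) {δ : ℝ} (hδ : 0 < δ)
    (hδ1 : δ ≤ 1) (hβ : β (m + j + 1) ≠ 0) :
    ‖meanPhase β y m (j + 1) - meanPhase β y m j‖ ≤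
      8 * δ + 520 / (shearFreq (m + j) * ‖β (m + j + 1)‖ * δ ^ 2)
        + 2 * Real.pi * (liftedLip β m j * (4 * Real.pi / shearFreq (m + j) + ‖β (m + j + 1)‖)) := by
  set n := m + j with hn
  set L := liftedLip β m j
  have hL : 0 ≤ L := liftedLip_nonneg β m j
  set G := liftedObs β m j
  have hGc : Continuous fun p : Eucl 2 × ℝ => G p.1 p.2 := continuous_liftedObs β m j
  have hlam := shearFreq_pos n
  have hlam' := shearFreq_pos (n + 1)
  set b := β (n + 1) with hb
  set ψ : ℝ := shearFreq n * y (shearDir (n + 1)) with hψ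
  set c : ℝ := shearFreq (n + 1) * y (shearDir (n + 2)) with hc
  have hpi := Real.pi_pos
  have h1 : ∀ v ∈ uIoc 0 (2 * Real.pi), ‖phaseObs m (shearFlow β (m + 1) (j + 1)
      (y + (v / shearFreq (n + 1)) • shearVec (n + 2)))
      - G y (ψ + (shearFreq n * ‖b‖) * Real.cos (v + (c + b.arg)))‖
      ≤ L * (2 * Real.pi / shearFreq n + ‖b‖) := by
    intro v hv
    rw [uIoc_of_le (by positivity)] at hv
    set x := y + (v / shearFreq (n + 1)) • shearVec (n + 2) with hx
    have e1 : phaseObs m (shearFlow β (m + 1) (j + 1) x)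
        = G (shearMap β (n + 1) x)
          (shearFreq n * (shearMap β (n + 1) x) (shearDir (n + 1))) := by
      rw [shearFlow, Function.comp, phaseObs_shearFlow_eq, add_right_comm m 1 j]
    have e2 : shearFreq (n + 1) * x (shearDir (n + 2)) = v + c := by
      rw [hx, hc]
      simp only [PiLp.add_apply, PiLp.smul_apply, shearVec_self, smul_eq_mul]
      field_simp
      ring
    have e3 : shearMap β (n + 1) x = x + (‖b‖ * Real.cos (v + (c + b.arg))) • shearVec (n + 1) := by
      rw [shearMap, show n + 1 + 1 = n + 2 from rfl, e2, ← hb, waveRe_eq']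
    have e4 : (shearMap β (n + 1) x) (shearDir (n + 1))
        = y (shearDir (n + 1)) + ‖b‖ * Real.cos (v + (c + b.arg)) := by
      rw [e3, hx]
      simp only [PiLp.add_apply, PiLp.smul_apply, shearVec_self, smul_eq_mul, mul_one,
        show n + 2 = (n + 1) + 1 from rfl, shearVec_pred, mul_zero, add_zero]
    rw [e1, e4, mul_add, ← hψ, ← mul_assoc]
    refine (norm_liftedObs_sub_le β m j _ _ _).trans ?_
    refine mul_le_mul_of_nonneg_left ?_ hL
    rw [e3, hx, add_assoc, add_sub_cancel_left]
    refine (norm_add_le _ _).trans (add_le_add ?_ ?_)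
    · rw [norm_smul, norm_shearVec, mul_one, Real.norm_eq_abs, abs_div, abs_of_pos hv.1,
        abs_of_pos hlam']
      exact div_le_div₀ (by positivity) hv.2 hlam (shearFreq_mono (Nat.le_succ n))
    · rw [norm_smul, norm_shearVec, mul_one, Real.norm_eq_abs, ← waveRe_eq' b]
      exact abs_waveRe_le _ _
  have h2 : ∀ v ∈ uIoc 0 (2 * Real.pi), ‖phaseObs m (shearFlow β (m + 1) j
      (y + (v / shearFreq n) • shearVec (n + 1))) - G y (v + ψ)‖
      ≤ L * (2 * Real.pi / shearFreq n) := by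
    intro v hv
    rw [uIoc_of_le (by positivity)] at hv
    rw [phaseObs_shearFlow_eq]
    have e2 : shearFreq n * (y + (v / shearFreq n) • shearVec (n + 1)) (shearDir (n + 1))
        = v + ψ := by
      simp only [PiLp.add_apply, PiLp.smul_apply, shearVec_self, smul_eq_mul, hψ]
      field_simp
      ring
    rw [← hn, e2]
    refine (norm_liftedObs_sub_le β m j _ _ _).trans ?_
    refine mul_le_mul_of_nonneg_left ?_ hL
    rw [add_sub_cancel_left, norm_smul, norm_shearVec, mul_one, Real.norm_eq_abs, abs_div,
      abs_of_pos hv.1, abs_of_pos hlam]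
    gcongr
    exact hv.2
  have hobs : ∀ i, Continuous fun θ => phaseObs m (shearFlow β (m + 1) i θ) := fun i =>
    (continuous_phaseObs m).comp (continuous_shearFlow β (m + 1) i)
  have hGy : Continuous (G y) := hGc.comp (by fun_prop : Continuous fun φ : ℝ => (y, φ))
  have I1 : Continuous fun v : ℝ => phaseObs m (shearFlow β (m + 1) (j + 1)
      (y + (v / shearFreq (n + 1)) • shearVec (n + 2))) := (hobs _).comp (by fun_prop)
  have I2 : Continuous fun v : ℝ => phaseObs m (shearFlow β (m + 1) j
      (y + (v / shearFreq n) • shearVec (n + 1))) := (hobs _).comp (by fun_prop)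
  have I3 : Continuous fun v : ℝ => G y (ψ + (shearFreq n * ‖b‖) * Real.cos (v + (c + b.arg))) :=
    hGy.comp (by fun_prop)
  have I4 : Continuous fun v : ℝ => G y (v + ψ) := hGy.comp (by fun_prop)
  have A1 := intervalIntegral.norm_integral_le_of_norm_le_const h1
  have A2 := intervalIntegral.norm_integral_le_of_norm_le_const h2
  rw [intervalIntegral.integral_sub (I1.intervalIntegrable _ _) (I3.intervalIntegrable _ _),
    sub_zero, abs_of_pos Real.two_pi_pos] at A1
  rw [intervalIntegral.integral_sub (I2.intervalIntegrable _ _) (I4.intervalIntegrable _ _),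
    sub_zero, abs_of_pos Real.two_pi_pos] at A2
  have A3 := norm_integral_comp_cos_sub_le hGy (liftedObs_periodic β m j y)
    (fun x => (norm_liftedObs β m j y x).le) (K := shearFreq n * ‖b‖)
    (mul_pos hlam (norm_pos_iff.2 hβ)) hδ hδ1 ψ (c + b.arg)
  have A4 : ∫ v in (0 : ℝ)..2 * Real.pi, G y (v + ψ) = ∫ v in (0 : ℝ)..2 * Real.pi, G y v := by
    rw [intervalIntegral.integral_comp_add_right (G y) ψ, zero_add, add_comm (2 * Real.pi),
      (liftedObs_periodic β m j y).intervalIntegral_add_eq ψ 0, zero_add]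
  rw [A4] at A2
  have key : ∀ a b c d : ℂ, ‖a - d‖ ≤ ‖a - b‖ + ‖b - c‖ + ‖d - c‖ := fun a b c d => by
    calc ‖a - d‖ = ‖(a - b) + (b - c) - (d - c)‖ := by congr 1; ring
      _ ≤ _ := (norm_sub_le _ _).trans (add_le_add (norm_add_le _ _) le_rfl)
  refine (key _ _ _ _).trans ((add_le_add (add_le_add A1 A3) A2).trans (le_of_eq ?_))
  ring

/-! ### Bounds on the mean phase uniform in the number of shears -/

/-- The amplitudes of the shears from stage `m + 1` on are large with respect to the wave length of
the next shear, but not too large. -/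
def ShearsMixFrom (β : ℕ → ℂ) (m : ℕ) : Prop :=
  ∀ k ≥ m, 8 ^ (k + 1) ≤ ‖β (k + 1)‖ * shearFreq k ∧ ‖β (k + 1)‖ * shearFreq k ≤ 32 ^ (k + 1)

lemma ShearsMixFrom.mono {β : ℕ → ℂ} {m n : ℕ} (h : ShearsMixFrom β m) (hmn : m ≤ n) :
    ShearsMixFrom β n := fun k hk => h k (hmn.trans hk)

/-- The upper bound on `‖β (k + 1)‖ * shearFreq k` lets the factor of each new shear trade λ_k for
λ_{k+1} at the cost of 64^(k+1). The constant therefore stays near the last frequency instead of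
being the product of all of them, and the exponents of 64 add up to at most a square. -/
lemma liftedLip_le {β : ℕ → ℂ} {m : ℕ} (h : ShearsMixFrom β m) (j : ℕ) :
    liftedLip β m (j + 1) ≤ shearFreq (m + j) * 64 ^ ((m + j) ^ 2) := by
  simp only [liftedLip]
  induction j with
  | zero =>
    simp only [shearLip, Finset.range_zero, Finset.prod_empty, add_zero]
    exact mul_le_mul_of_nonneg_left (one_le_pow₀ (by norm_num)) (shearFreq_pos m).le
  | succ j ih =>
    obtain ⟨k, hk⟩ : ∃ k, k = m + j := ⟨_, rfl⟩
    have hβ := (h k (by omega)).2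
    have hf := shearFreq_pos k
    have hf' := shearFreq_pos (k + 1)
    have hff : shearFreq k ≤ shearFreq (k + 1) := shearFreq_mono (Nat.le_succ k)
    rw [show shearLip β (m + 1) (j + 1)
      = shearLip β (m + 1) j * (1 + ‖β (m + 1 + j)‖ * shearFreq (m + 1 + j)) from
      Finset.prod_range_succ _ _, ← mul_assoc, ← add_assoc, show m + 1 + j = k + 1 by omega]
    rw [← hk] at ih ⊢
    have h1 : shearFreq k * (1 + ‖β (k + 1)‖ * shearFreq (k + 1))
        ≤ 64 ^ (k + 1) * shearFreq (k + 1) := by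
      have h32 : (1 : ℝ) ≤ 32 ^ (k + 1) := one_le_pow₀ (by norm_num)
      have h64 : (64 : ℝ) ^ (k + 1) = 2 ^ (k + 1) * 32 ^ (k + 1) := by
        rw [← mul_pow]; norm_num
      have h2 : (2 : ℝ) ≤ 2 ^ (k + 1) := by
        rw [pow_succ]; linarith [one_le_pow₀ (by norm_num : (1 : ℝ) ≤ 2) (n := k)]
      calc shearFreq k * (1 + ‖β (k + 1)‖ * shearFreq (k + 1))
          = shearFreq k + (‖β (k + 1)‖ * shearFreq k) * shearFreq (k + 1) := by ring
        _ ≤ 32 ^ (k + 1) * shearFreq (k + 1) + 32 ^ (k + 1) * shearFreq (k + 1) := by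
            gcongr
            nlinarith
        _ = 2 * 32 ^ (k + 1) * shearFreq (k + 1) := by ring
        _ ≤ _ := by rw [h64]; gcongr
    calc shearFreq m * shearLip β (m + 1) j * (1 + ‖β (k + 1)‖ * shearFreq (k + 1))
        ≤ shearFreq k * 64 ^ (k ^ 2) * (1 + ‖β (k + 1)‖ * shearFreq (k + 1)) := by
          gcongr
      _ = (shearFreq k * (1 + ‖β (k + 1)‖ * shearFreq (k + 1))) * 64 ^ (k ^ 2) := by ring
      _ ≤ (64 ^ (k + 1) * shearFreq (k + 1)) * 64 ^ (k ^ 2) := by gcongr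
      _ = shearFreq (k + 1) * 64 ^ (k ^ 2 + k + 1) := by ring
      _ ≤ _ := by
          gcongr
          · norm_num
          · nlinarith

/-- Here the choice 2^(k^4) pays off: the frequency ratio is about 2^(4k^3), which beats the loss
64^(k^2). -/
lemma liftedLip_mul_le {β : ℕ → ℂ} {m : ℕ} (h : ShearsMixFrom β m) (hm : 3 ≤ m) (j : ℕ) :
    2 * Real.pi * (liftedLip β m j * (4 * Real.pi / shearFreq (m + j) + ‖β (m + j + 1)‖))
      ≤ (1 / 2) ^ (m + j + 1) := by
  cases j with
  | zero =>
    simp only [liftedLip, zero_mul, mul_zero]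
    positivity
  | succ j =>
    have hL := liftedLip_le h j
    obtain ⟨k, hk⟩ : ∃ k, k = m + j := ⟨_, rfl⟩
    rw [← hk] at hL
    rw [← add_assoc, ← hk]
    have hβ := (h (k + 1) (by omega)).2
    have hf := shearFreq_pos (k + 1)
    have hf' := shearFreq_pos k
    have h1 : 4 * Real.pi / shearFreq (k + 1) + ‖β (k + 1 + 1)‖
        ≤ (4 * Real.pi + 32 ^ (k + 2)) / shearFreq (k + 1) := by
      rw [add_div]
      gcongr
      rwa [le_div_iff₀ hf]
    have hpi := Real.pi_lt_d2
    have hpi0 := Real.pi_pos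
    have h2 : 2 * Real.pi * (4 * Real.pi + 32 ^ (k + 2)) ≤ 64 ^ (k + 2) := by
      have h64 : (64 : ℝ) ^ (k + 2) = 2 ^ (k + 2) * 32 ^ (k + 2) := by
        rw [← mul_pow]; norm_num
      have h32 : (32 : ℝ) ^ 3 ≤ 32 ^ (k + 2) := pow_le_pow_right₀ (by norm_num) (by omega)
      have h2' : (2 : ℝ) ^ 4 ≤ 2 ^ (k + 2) := pow_le_pow_right₀ (by norm_num) (by omega)
      rw [h64]
      have h3 : 4 * Real.pi ≤ 32 ^ (k + 2) := by linarith
      calc 2 * Real.pi * (4 * Real.pi + 32 ^ (k + 2))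
          ≤ 2 * 4 * (32 ^ (k + 2) + 32 ^ (k + 2)) := by gcongr; linarith
        _ = 2 ^ 4 * 32 ^ (k + 2) := by ring
        _ ≤ _ := by gcongr
    -- Exponents of 2 in λ_k, in 64^(k^2), in 64^(k+2) and in the target (1/2)^(k+2), against
    -- λ_{k+1}.
    have hexp : k ^ 4 + 6 * k ^ 2 + 6 * (k + 2) + (k + 2) ≤ (k + 1) ^ 4 := by
      have : 3 ≤ k := by omega
      nlinarith [Nat.pow_le_pow_left this 2, Nat.pow_le_pow_left this 3]
    calc 2 * Real.pi * (liftedLip β m (j + 1)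
          * (4 * Real.pi / shearFreq (k + 1) + ‖β (k + 1 + 1)‖))
        ≤ 2 * Real.pi * ((shearFreq k * 64 ^ (k ^ 2))
          * ((4 * Real.pi + 32 ^ (k + 2)) / shearFreq (k + 1))) := by
          gcongr
      _ = (shearFreq k * 64 ^ (k ^ 2)) * (2 * Real.pi * (4 * Real.pi + 32 ^ (k + 2)))
          / shearFreq (k + 1) := by ring
      _ ≤ (shearFreq k * 64 ^ (k ^ 2)) * 64 ^ (k + 2) / shearFreq (k + 1) := by gcongr
      _ ≤ (1 / 2) ^ (k + 1 + 1) := by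
          rw [div_le_iff₀ hf, one_div, inv_pow, inv_mul_eq_div, le_div_iff₀ (by positivity)]
          unfold shearFreq
          rw [show (64 : ℝ) = 2 ^ 6 by norm_num, ← pow_mul, ← pow_mul, ← pow_add, ← pow_add,
            ← pow_add]
          exact pow_le_pow_right₀ (by norm_num) hexp

/-- If the shears mix from stage `m` on, the phase seen by the `m`-th shear is spread out,
uniformly in the number of preceding shears. -/
lemma norm_meanPhase_le {β : ℕ → ℂ} {m : ℕ} (h : ShearsMixFrom β m) (hm : 8 ≤ m) (y : Eucl 2)
    (j : ℕ) : ‖meanPhase β y m j‖ ≤ Real.pi := by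
  have hstep : ∀ j, ‖meanPhase β y m (j + 1) - meanPhase β y m j‖
      ≤ 529 * (1 / 2) ^ (m + j + 1) := by
    intro j
    have hβ := (h (m + j) (by omega)).1
    have hβ0 : β (m + j + 1) ≠ 0 := by
      intro h0
      rw [h0, norm_zero, zero_mul] at hβ
      exact absurd hβ (not_le.2 (by positivity))
    -- This δ balances 8δ against 520/(8^(m+j+1) δ²). The three error terms contribute 8, 520 and 1
    -- times (1/2)^(m+j+1), hence the 529.
    refine (norm_meanPhase_succ_sub_le β y m j (δ := (1 / 2) ^ (m + j + 1)) (by positivity)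
      (pow_le_one₀ (by norm_num) (by norm_num)) hβ0).trans ?_
    have h3 := liftedLip_mul_le h (by omega) j
    have h2 : 520 / (shearFreq (m + j) * ‖β (m + j + 1)‖ * ((1 / 2) ^ (m + j + 1)) ^ 2)
        ≤ 520 * (1 / 2 : ℝ) ^ (m + j + 1) := by
      rw [mul_comm (shearFreq _), div_eq_mul_inv]
      refine mul_le_mul_of_nonneg_left ?_ (by norm_num)
      have : (8 : ℝ) ^ (m + j + 1) * ((1 / 2) ^ (m + j + 1)) ^ 2 = 2 ^ (m + j + 1) := by
        rw [← pow_mul, mul_comm (m + j + 1) 2, pow_mul, ← mul_pow]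
        norm_num
      rw [one_div, inv_pow]
      refine inv_anti₀ (by positivity) ?_
      rw [one_div, inv_pow] at this
      exact this.symm.le.trans (mul_le_mul_of_nonneg_right hβ (by positivity))
    linarith
  have hind : ‖meanPhase β y m j‖ ≤ 529 * ((1 / 2) ^ m - (1 / 2) ^ (m + j)) := by
    induction j with
    | zero => simp [meanPhase_zero]
    | succ j ih =>
      calc ‖meanPhase β y m (j + 1)‖
          = ‖(meanPhase β y m (j + 1) - meanPhase β y m j) + meanPhase β y m j‖ := by
            rw [sub_add_cancel]
        _ ≤ 529 * (1 / 2) ^ (m + j + 1) + 529 * ((1 / 2) ^ m - (1 / 2) ^ (m + j)) :=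
            (norm_add_le _ _).trans (add_le_add (hstep j) ih)
        _ = _ := by rw [← add_assoc, pow_succ _ (m + j)]; ring
  -- The telescoped sum is at most 529/256, which is less than 3 and so less than π.
  have h8 : (1 / 2 : ℝ) ^ m ≤ (1 / 2) ^ 8 :=
    pow_le_pow_of_le_one (by norm_num) (by norm_num) hm
  have h0 : (0 : ℝ) ≤ (1 / 2) ^ (m + j) := by positivity
  have hpi := Real.pi_gt_three
  norm_num at h8
  linarith

end

noncomputable section

/-! ### Measurability into path spaces -/

lemma measurable_of_measurable_dist {α β : Type*} [MeasurableSpace α] [PseudoMetricSpace β]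
    [SecondCountableTopology β] [MeasurableSpace β] [BorelSpace β] {f : α → β}
    (h : ∀ y, Measurable fun a => dist (f a) y) : Measurable f := by
  refine measurable_of_isOpen fun U hU => ?_
  have hr : ∀ x : U, ∃ r > 0, Metric.ball (x : β) r ⊆ U := fun x => Metric.isOpen_iff.1 hU x x.2
  choose r hr0 hrU using hr
  obtain ⟨T, hT, hTU⟩ := TopologicalSpace.isOpen_iUnion_countable
    (fun x : U => Metric.ball (x : β) (r x)) fun _ => Metric.isOpen_ball
  have hU2 : U = ⋃ x ∈ T, Metric.ball (x : β) (r x) := by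
    rw [hTU]
    refine Subset.antisymm (fun x hx => ?_) (iUnion_subset hrU)
    exact mem_iUnion.2 ⟨⟨x, hx⟩, Metric.mem_ball_self (hr0 _)⟩
  rw [hU2, preimage_iUnion₂]
  exact MeasurableSet.biUnion hT fun x _ => measurableSet_lt (h x) measurable_const

/-- By continuity, the uniform distance to a fixed path is controlled on a countable dense set of
times. -/
lemma measurable_pathSpace {α : Type*} [MeasurableSpace α] {d : ℕ} {T : ℝ} {f : α → PathSpace d T}
    (h : ∀ t, Measurable fun a => f a t) : Measurable f := by
  refine measurable_of_measurable_dist fun g => ?_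
  refine measurable_of_Iic fun r => ?_
  obtain ⟨D, hDc, hD⟩ := TopologicalSpace.exists_countable_dense (Icc (0 : ℝ) T)
  rcases lt_or_ge r 0 with hr | hr
  · convert! MeasurableSet.empty
    ext a
    simp only [mem_preimage, mem_Iic, mem_empty_iff_false, iff_false, not_le]
    exact hr.trans_le dist_nonneg
  · have : (fun a => dist (f a) g) ⁻¹' Iic r = ⋂ t ∈ D, {a | dist (f a t) (g t) ≤ r} := by
      ext a
      simp only [mem_preimage, mem_Iic, mem_iInter, mem_ofPred_eq]
      rw [ContinuousMap.dist_le hr]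
      refine ⟨fun h t _ => h t, fun h t => ?_⟩
      have hc : IsClosed {t | dist (f a t) (g t) ≤ r} :=
        isClosed_le (by fun_prop) continuous_const
      have := hD.closure_eq ▸ closure_minimal (fun t ht => h t ht) hc
      exact this (mem_univ t)
    rw [this]
    exact MeasurableSet.biInter hDc fun t _ =>
      measurableSet_le ((h t).dist measurable_const) measurable_const

/-! ### The alternating shear field -/

/-- The stage `k` of times `t ∈ (2^{-(k+1)}, 2^{-k}]`. -/
def stage (t : ℝ) : ℕ := Nat.log 2 ⌊t⁻¹⌋₊

lemma measurable_stage : Measurable stage :=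
  (Measurable.of_discrete (f := Nat.log 2)).comp (Nat.measurable_floor.comp measurable_inv)

lemma stage_spec {t : ℝ} (h0 : 0 < t) (h1 : t ≤ 1) :
    (1 / 2 : ℝ) ^ (stage t + 1) < t ∧ t ≤ (1 / 2) ^ stage t := by
  have hinv : 1 ≤ t⁻¹ := (one_le_inv₀ h0).2 h1
  have hfl : ⌊t⁻¹⌋₊ ≠ 0 := (Nat.floor_pos.2 hinv).ne'
  have h2 : (2 : ℝ) ^ stage t ≤ t⁻¹ := by
    have := Nat.pow_log_le_self 2 hfl
    exact (by exact_mod_cast this : (2 : ℝ) ^ stage t ≤ (⌊t⁻¹⌋₊ : ℝ)).trans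
      (Nat.floor_le (by positivity))
  have h3 : t⁻¹ < (2 : ℝ) ^ (stage t + 1) := by
    have := Nat.lt_pow_succ_log_self (b := 2) (by norm_num) ⌊t⁻¹⌋₊
    rw [Nat.floor_lt (by positivity)] at this
    exact_mod_cast this
  constructor
  · rw [one_div, inv_pow]
    exact inv_lt_of_inv_lt₀ h0 h3
  · rw [one_div, inv_pow]
    exact (le_inv_comm₀ (by positivity) h0).1 h2

lemma stage_eq {t : ℝ} {k : ℕ} (h : t ∈ Ioc ((1 / 2 : ℝ) ^ (k + 1)) ((1 / 2) ^ k)) :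
    stage t = k := by
  have h0 : 0 < t := lt_trans (by positivity) h.1
  have h1 : t ≤ 1 := h.2.trans (pow_le_one₀ (by norm_num) (by norm_num))
  obtain ⟨h2, h3⟩ := stage_spec h0 h1
  have e1 := (pow_lt_pow_iff_right_of_lt_one₀ (by norm_num : (0 : ℝ) < 1 / 2) (by norm_num)).1
    (h2.trans_le h.2)
  have e2 := (pow_lt_pow_iff_right_of_lt_one₀ (by norm_num : (0 : ℝ) < 1 / 2) (by norm_num)).1
    (h.1.trans_le h3)
  omega

/-- The sinusoidal shear of stage `k`, with amplitude `1`. -/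
def sineShear (k : ℕ) : Eucl 2 →ᵇ Eucl 2 :=
  BoundedContinuousFunction.ofNormedAddCommGroup
    (fun x => Real.cos (shearFreq k * x (shearDir (k + 1))) • shearVec k) (by fun_prop) 1
    (fun x => by
      rw [norm_smul, norm_shearVec, mul_one]
      exact Real.abs_cos_le_one _)

lemma sineShear_apply (k : ℕ) (x : Eucl 2) :
    sineShear k x = Real.cos (shearFreq k * x (shearDir (k + 1))) • shearVec k := rfl

lemma norm_sineShear_le (k : ℕ) : ‖sineShear k‖ ≤ 1 :=
  BoundedContinuousFunction.norm_ofNormedAddCommGroup_le _ zero_le_one _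

/-- The velocity field of shears alternating between the coordinate directions, with time
dependent amplitude `b`. -/
def shearField (b : ℝ → ℝ) : VelocityField 2 := fun t => b t • sineShear (stage t)

lemma norm_shearField_le {b : ℝ → ℝ} (hb : ∀ t, |b t| ≤ 1) (t : ℝ) : ‖shearField b t‖ ≤ 1 := by
  unfold shearField
  rw [norm_smul]
  exact mul_le_one₀ (hb t) (norm_nonneg _) (norm_sineShear_le _)

lemma stronglyMeasurable_shearField {b : ℝ → ℝ} (hb : Measurable b) :
    StronglyMeasurable (shearField b) :=
  hb.stronglyMeasurable.smul
    ((StronglyMeasurable.of_discrete (f := sineShear)).comp_measurable measurable_stage)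

/-! ### Approximate solutions, started at a positive time -/

/-- The increment from time `0` of a path, extended to all times. -/
def pathIncr (w : PathSpace 2 1) (s : ℝ) : Eucl 2 :=
  w (projIcc 0 1 zero_le_one s) - w ⟨0, le_rfl, zero_le_one⟩

lemma continuous_pathIncr (w : PathSpace 2 1) : Continuous (pathIncr w) := by
  unfold pathIncr
  have := w.continuous.comp (continuous_projIcc (h := zero_le_one (α := ℝ)))
  exact this.sub continuous_const

lemma measurable_coord (i : Fin 2) : Measurable fun x : Eucl 2 => x i :=
  (EuclideanSpace.proj i : Eucl 2 →L[ℝ] ℝ).continuous.measurable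

lemma measurable_pathIncr : Measurable fun p : PathSpace 2 1 × ℝ => pathIncr p.1 p.2 := by
  have h : Continuous fun p : PathSpace 2 1 × ℝ => pathIncr p.1 p.2 := by
    unfold pathIncr
    have h1 : Continuous fun p : PathSpace 2 1 × ℝ => p.1 (projIcc 0 1 zero_le_one p.2) :=
      ContinuousEval.continuous_eval.comp
        (continuous_fst.prodMk
          ((continuous_projIcc (h := zero_le_one (α := ℝ))).comp continuous_snd))
    have h2 : Continuous fun p : PathSpace 2 1 × ℝ => p.1 ⟨0, le_rfl, zero_le_one⟩ :=
      ContinuousEval.continuous_eval.comp (continuous_fst.prodMk continuous_const)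
    exact h1.sub h2
  exact h.measurable

/-- The complex amplitude of the `k`-th shear, as seen along the path `w`. -/
def shearAmp (b : ℝ → ℝ) (w : PathSpace 2 1) (k : ℕ) : ℂ :=
  ∫ s in ((1 / 2 : ℝ) ^ (k + 1))..(1 / 2) ^ k,
    (b s : ℂ) * Complex.exp ((shearFreq k * pathIncr w s (shearDir (k + 1)) : ℝ) * Complex.I)

/-- The velocity of the approximate solution started from `z` at time `2^{-n}`. -/
def approxVel (b : ℝ → ℝ) (n : ℕ) (z : Eucl 2) (w : PathSpace 2 1) (s : ℝ) : Eucl 2 :=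
  if s ≤ (1 / 2) ^ n then 0 else
    (b s * Real.cos (shearFreq (stage s) *
      (shearFlow (shearAmp b w) (stage s + 1) (n - (stage s + 1)) z (shearDir (stage s + 1))
        + pathIncr w s (shearDir (stage s + 1))))) • shearVec (stage s)

/-- The approximate solution, without the noise. -/
def approxPos (b : ℝ → ℝ) (n : ℕ) (z : Eucl 2) (w : PathSpace 2 1) (t : ℝ) : Eucl 2 :=
  z + ∫ s in (0 : ℝ)..t, approxVel b n z w s

lemma norm_approxVel_le {b : ℝ → ℝ} (hb : ∀ t, |b t| ≤ 1) (n : ℕ) (z : Eucl 2)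
    (w : PathSpace 2 1) (s : ℝ) : ‖approxVel b n z w s‖ ≤ 1 := by
  unfold approxVel
  split_ifs
  · simp
  · rw [norm_smul, norm_shearVec, mul_one, Real.norm_eq_abs, abs_mul]
    exact mul_le_one₀ (hb s) (abs_nonneg _) (Real.abs_cos_le_one _)

lemma measurable_shearAmp {b : ℝ → ℝ} (hb : Measurable b) (k : ℕ) :
    Measurable fun w => shearAmp b w k := by
  unfold shearAmp
  simp_rw [intervalIntegral.integral_of_le
    (pow_le_pow_of_le_one (by norm_num : (0 : ℝ) ≤ 1 / 2) (by norm_num) (Nat.le_succ k))]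
  have h1 : Measurable fun p : PathSpace 2 1 × ℝ => pathIncr p.1 p.2 (shearDir (k + 1)) :=
    (measurable_coord _).comp measurable_pathIncr
  have : StronglyMeasurable fun p : PathSpace 2 1 × ℝ => (b p.2 : ℂ) *
      Complex.exp ((shearFreq k * pathIncr p.1 p.2 (shearDir (k + 1)) : ℝ) * Complex.I) :=
    ((Complex.measurable_ofReal.comp (hb.comp measurable_snd)).mul
      (Complex.measurable_exp.comp ((Complex.measurable_ofReal.comp
        (h1.const_mul _)).mul_const _))).stronglyMeasurable
  exact (this.integral_prod_right' (ν := volume.restrict (Ioc _ _))).measurable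

lemma measurable_shearFlow {α : Type*} [MeasurableSpace α] {β : α → ℕ → ℂ}
    (hβ : ∀ k, Measurable fun a => β a k) (m j : ℕ) {z : α → Eucl 2} (hz : Measurable z) :
    Measurable fun a => shearFlow (β a) m j (z a) := by
  induction j generalizing z with
  | zero => exact hz
  | succ j ih =>
    refine ih (z := fun a => shearMap (β a) (m + j) (z a)) ?_
    unfold shearMap
    have h1 : Measurable fun a => shearFreq (m + j) * z a (shearDir (m + j + 1)) :=
      ((measurable_coord _).comp hz).const_mul _
    have : Measurable fun a => waveRe (β a (m + j)) (shearFreq (m + j) * z a (shearDir (m + j + 1))) :=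
      continuous_waveRe.measurable.comp ((hβ _).prodMk h1)
    exact hz.add (this.smul_const _)

lemma measurable_approxVel {b : ℝ → ℝ} (hb : Measurable b) (n : ℕ) :
    Measurable fun p : (Eucl 2 × PathSpace 2 1) × ℝ => approxVel b n p.1.1 p.1.2 p.2 := by
  unfold approxVel
  refine Measurable.ite (measurableSet_le measurable_snd measurable_const) measurable_const ?_
  -- The stage becomes a free natural number, so that measurability can be checked for each of its
  -- countably many values.
  set F : ((Eucl 2 × PathSpace 2 1) × ℝ) × ℕ → Eucl 2 := fun q =>
    (b q.1.2 * Real.cos (shearFreq q.2 *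
      (shearFlow (shearAmp b q.1.1.2) (q.2 + 1) (n - (q.2 + 1)) q.1.1.1 (shearDir (q.2 + 1))
        + pathIncr q.1.1.2 q.1.2 (shearDir (q.2 + 1))))) • shearVec q.2 with hF
  have hFm : Measurable F := by
    refine measurable_from_prod_countable_left fun k => ?_
    have h1 : Measurable fun q : (Eucl 2 × PathSpace 2 1) × ℝ =>
        shearFlow (shearAmp b q.1.2) (k + 1) (n - (k + 1)) q.1.1 :=
      measurable_shearFlow (fun j => (measurable_shearAmp hb j).comp (measurable_snd.comp measurable_fst)) _ _
        (measurable_fst.comp measurable_fst)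
    have h2 : Measurable fun q : (Eucl 2 × PathSpace 2 1) × ℝ => pathIncr q.1.2 q.2 :=
      measurable_pathIncr.comp ((measurable_snd.comp measurable_fst).prodMk measurable_snd)
    have h3 : Measurable fun q : (Eucl 2 × PathSpace 2 1) × ℝ =>
        shearFlow (shearAmp b q.1.2) (k + 1) (n - (k + 1)) q.1.1 (shearDir (k + 1))
          + pathIncr q.1.2 q.2 (shearDir (k + 1)) :=
      ((measurable_coord (shearDir (k + 1))).comp h1).add
        ((measurable_coord (shearDir (k + 1))).comp h2)
    have h4 : Measurable fun q : (Eucl 2 × PathSpace 2 1) × ℝ => b q.2 * Real.cos (shearFreq k *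
        (shearFlow (shearAmp b q.1.2) (k + 1) (n - (k + 1)) q.1.1 (shearDir (k + 1))
          + pathIncr q.1.2 q.2 (shearDir (k + 1)))) :=
      (hb.comp measurable_snd).mul (Real.measurable_cos.comp (h3.const_mul _))
    exact h4.smul_const (shearVec k)
  exact hFm.comp (measurable_id.prodMk (measurable_stage.comp measurable_snd))

lemma intervalIntegrable_approxVel {b : ℝ → ℝ} (hbm : Measurable b) (hb : ∀ t, |b t| ≤ 1) (n : ℕ)
    (z : Eucl 2) (w : PathSpace 2 1) (s t : ℝ) :
    IntervalIntegrable (approxVel b n z w) volume s t := by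
  have h1 : Measurable (approxVel b n z w) :=
    (measurable_approxVel hbm n).comp (measurable_prodMk_left (x := (z, w)))
  exact (intervalIntegrable_const (c := (1 : ℝ))).mono_fun h1.aestronglyMeasurable
    (Filter.Eventually.of_forall fun s => by simpa using norm_approxVel_le hb n z w s)

lemma norm_approxPos_sub_le {b : ℝ → ℝ} (hbm : Measurable b) (hb : ∀ t, |b t| ≤ 1) (n : ℕ)
    (z : Eucl 2) (w : PathSpace 2 1) (s t : ℝ) :
    ‖approxPos b n z w t - approxPos b n z w s‖ ≤ |t - s| := by
  unfold approxPos
  rw [add_sub_add_left_eq_sub, intervalIntegral.integral_interval_sub_left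
    (intervalIntegrable_approxVel hbm hb n z w _ _) (intervalIntegrable_approxVel hbm hb n z w _ _)]
  simpa using intervalIntegral.norm_integral_le_of_norm_le_const (C := 1)
    fun s _ => norm_approxVel_le hb n z w s

lemma continuous_approxPos {b : ℝ → ℝ} (hbm : Measurable b) (hb : ∀ t, |b t| ≤ 1) (n : ℕ)
    (z : Eucl 2) (w : PathSpace 2 1) : Continuous (approxPos b n z w) := by
  have : LipschitzWith 1 (approxPos b n z w) := LipschitzWith.of_dist_le_mul fun t s => by
    rw [dist_eq_norm, Real.dist_eq]
    simpa using norm_approxPos_sub_le hbm hb n z w s t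
  exact this.continuous

lemma approxPos_of_le {b : ℝ → ℝ} (n : ℕ) (z : Eucl 2) (w : PathSpace 2 1) {t : ℝ}
    (h0 : 0 ≤ t) (ht : t ≤ (1 / 2) ^ n) : approxPos b n z w t = z := by
  unfold approxPos
  rw [intervalIntegral.integral_zero_ae, add_zero]
  refine Filter.Eventually.of_forall fun s hs => ?_
  rw [uIoc_of_le h0] at hs
  exact if_pos (hs.2.trans ht)

/-- The position factors out of the complex exponential, so a single complex number, depending only
on b and the noise, determines the displacement for every starting position. -/
lemma integral_waveRe {b : ℝ → ℝ} (hbm : Measurable b) (hb : ∀ t, |b t| ≤ 1) (w : PathSpace 2 1)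
    (k : ℕ) (x : ℝ) :
    ∫ s in ((1 / 2 : ℝ) ^ (k + 1))..(1 / 2) ^ k, b s * Real.cos (shearFreq k *
      (x + pathIncr w s (shearDir (k + 1)))) = waveRe (shearAmp b w k) (shearFreq k * x) := by
  unfold waveRe shearAmp
  rw [← intervalIntegral.integral_mul_const]
  have hle : (1 / 2 : ℝ) ^ (k + 1) ≤ (1 / 2) ^ k :=
    pow_le_pow_of_le_one (by norm_num : (0 : ℝ) ≤ 1 / 2) (by norm_num) (Nat.le_succ k)
  have hpc := continuous_pathIncr w
  rw [intervalIntegral.integral_of_le hle, intervalIntegral.integral_of_le hle,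
    ← RCLike.re_eq_complex_re, ← integral_re]
  · refine integral_congr_ae (Filter.Eventually.of_forall fun s => ?_)
    simp only [RCLike.re_eq_complex_re]
    rw [mul_assoc, ← Complex.exp_add, Complex.re_ofReal_mul, ← add_mul, ← Complex.ofReal_add,
      Complex.exp_ofReal_mul_I_re]
    congr 2
    ring
  · refine Integrable.mono' (g := fun _ => (1 : ℝ)) (integrable_const _) ?_
      (Filter.Eventually.of_forall fun s => ?_)
    · apply Measurable.aestronglyMeasurable
      have := hpc.measurable
      fun_prop
    · rw [norm_mul, norm_mul, Complex.norm_exp_ofReal_mul_I, Complex.norm_exp_ofReal_mul_I]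
      simpa using hb s

lemma approxPos_stage {b : ℝ → ℝ} (hbm : Measurable b) (hb : ∀ t, |b t| ≤ 1) (n : ℕ)
    (z : Eucl 2) (w : PathSpace 2 1) {k : ℕ} (hk : k + 1 ≤ n) :
    approxPos b n z w ((1 / 2) ^ k) = approxPos b n z w ((1 / 2) ^ (k + 1))
      + waveRe (shearAmp b w k) (shearFreq k *
        shearFlow (shearAmp b w) (k + 1) (n - (k + 1)) z (shearDir (k + 1))) • shearVec k := by
  unfold approxPos
  rw [← intervalIntegral.integral_add_adjacent_intervals
    (intervalIntegrable_approxVel hbm hb n z w 0 ((1 / 2) ^ (k + 1)))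
    (intervalIntegrable_approxVel hbm hb n z w _ _), add_assoc]
  congr 2
  rw [← integral_waveRe hbm hb, ← intervalIntegral.integral_smul_const]
  have hle : (1 / 2 : ℝ) ^ (k + 1) ≤ (1 / 2) ^ k :=
    pow_le_pow_of_le_one (by norm_num : (0 : ℝ) ≤ 1 / 2) (by norm_num) (Nat.le_succ k)
  refine intervalIntegral.integral_congr_ae (Filter.Eventually.of_forall fun s hs => ?_)
  rw [uIoc_of_le hle] at hs
  have hn : (1 / 2 : ℝ) ^ n ≤ (1 / 2) ^ (k + 1) :=
    pow_le_pow_of_le_one (by norm_num : (0 : ℝ) ≤ 1 / 2) (by norm_num) hk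
  rw [approxVel, if_neg (not_le.2 (hn.trans_lt hs.1)), stage_eq hs]

lemma approxPos_pow {b : ℝ → ℝ} (hbm : Measurable b) (hb : ∀ t, |b t| ≤ 1) (j : ℕ)
    (z : Eucl 2) (w : PathSpace 2 1) (k : ℕ) :
    approxPos b (k + j) z w ((1 / 2) ^ k) = shearFlow (shearAmp b w) k j z := by
  induction j generalizing k with
  | zero => exact approxPos_of_le _ _ _ (by positivity) le_rfl
  | succ j ih =>
    have h := ih (k + 1)
    rw [show k + 1 + j = k + (j + 1) by ring] at h
    rw [approxPos_stage hbm hb (k + (j + 1)) z w (k := k) (by omega), h, shearFlow_succ',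
      show k + (j + 1) - (k + 1) = j by omega]
    rfl

/-- After its starting time, the approximate solution solves the equation. -/
lemma approxVel_eq_shearField {b : ℝ → ℝ} (hbm : Measurable b) (hb : ∀ t, |b t| ≤ 1) (n : ℕ)
    (z : Eucl 2) (w : PathSpace 2 1) {s : ℝ} (hs : (1 / 2) ^ n < s) (hs1 : s ≤ 1) :
    approxVel b n z w s = shearField b s (approxPos b n z w s + pathIncr w s) := by
  have h0 : 0 < s := lt_trans (by positivity) hs
  obtain ⟨h1, h2⟩ := stage_spec h0 hs1
  set k := stage s with hk
  have hkn : k + 1 ≤ n :=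
    (pow_lt_pow_iff_right_of_lt_one₀ (by norm_num : (0 : ℝ) < 1 / 2) (by norm_num)).1
      (hs.trans_le h2)
  -- Stage k moves the position along `shearVec k` only, so the coordinate that its shear reads
  -- keeps its value from the start of the stage.
  have hpos : (approxPos b n z w s) (shearDir (k + 1))
      = shearFlow (shearAmp b w) (k + 1) (n - (k + 1)) z (shearDir (k + 1)) := by
    have e1 := approxPos_pow hbm hb (n - (k + 1)) z w (k + 1)
    rw [show k + 1 + (n - (k + 1)) = n by omega] at e1
    rw [← e1]
    have e2 : approxPos b n z w s = approxPos b n z w ((1 / 2) ^ (k + 1))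
        + (∫ r in ((1 / 2 : ℝ) ^ (k + 1))..s, b r * Real.cos (shearFreq k *
      (shearFlow (shearAmp b w) (k + 1) (n - (k + 1)) z (shearDir (k + 1))
        + pathIncr w r (shearDir (k + 1))))) • shearVec k := by
      unfold approxPos
      rw [← intervalIntegral.integral_add_adjacent_intervals
        (intervalIntegrable_approxVel hbm hb n z w 0 ((1 / 2) ^ (k + 1)))
        (intervalIntegrable_approxVel hbm hb n z w _ _), add_assoc,
        ← intervalIntegral.integral_smul_const]
      congr 2
      refine intervalIntegral.integral_congr_ae (Filter.Eventually.of_forall fun r hr => ?_)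
      rw [uIoc_of_le h1.le] at hr
      have hn : (1 / 2 : ℝ) ^ n ≤ (1 / 2) ^ (k + 1) :=
        pow_le_pow_of_le_one (by norm_num : (0 : ℝ) ≤ 1 / 2) (by norm_num) hkn
      rw [approxVel, if_neg (not_le.2 (hn.trans_lt hr.1)),
        stage_eq (k := k) ⟨hr.1, hr.2.trans h2⟩]
    rw [e2]
    simp [shearVec_succ]
  rw [approxVel, if_neg (not_le.2 hs), shearField,
    BoundedContinuousFunction.smul_apply, sineShear_apply, smul_smul, ← hk, PiLp.add_apply, hpos]

/-! ### Measurability, causality and defect of the approximate paths -/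

/-- The approximate solution. -/
def approxPath {b : ℝ → ℝ} (hbm : Measurable b) (hb : ∀ t, |b t| ≤ 1) (n : ℕ)
    (z : Eucl 2) (w : PathSpace 2 1) : PathSpace 2 1 where
  toFun t := approxPos b n z w t + (w t - w ⟨0, le_rfl, zero_le_one⟩)
  continuous_toFun := by
    have := continuous_approxPos hbm hb n z w
    fun_prop

lemma pathIncr_coe (w : PathSpace 2 1) (t : Icc (0 : ℝ) 1) :
    pathIncr w t = w t - w ⟨0, le_rfl, zero_le_one⟩ := by
  rw [pathIncr, projIcc_val]

lemma measurable_approxPath {b : ℝ → ℝ} (hbm : Measurable b) (hb : ∀ t, |b t| ≤ 1) (n : ℕ) :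
    Measurable fun p : Eucl 2 × PathSpace 2 1 => approxPath hbm hb n p.1 p.2 := by
  refine measurable_pathSpace fun t => ?_
  have h1 : Measurable fun p : Eucl 2 × PathSpace 2 1 => approxPos b n p.1 p.2 t := by
    unfold approxPos
    simp_rw [intervalIntegral.integral_of_le t.2.1]
    exact measurable_fst.add ((measurable_approxVel hbm n).stronglyMeasurable.integral_prod_right'
      (ν := volume.restrict (Ioc _ _))).measurable
  have h2 : ∀ t : Icc (0 : ℝ) 1, Measurable fun p : Eucl 2 × PathSpace 2 1 => p.2 t := fun t =>
    (ContinuousEvalConst.continuous_eval_const t).measurable.comp measurable_snd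
  exact h1.add ((h2 t).sub (h2 _))

lemma pathIncr_congr {w w' : PathSpace 2 1} {t : ℝ}
    (h : ∀ s : Icc (0 : ℝ) 1, s ≤ t → w s = w' s) (ht : 0 ≤ t) {s : ℝ} (hs : s ∈ Icc (0 : ℝ) 1)
    (hst : s ≤ t) : pathIncr w s = pathIncr w' s := by
  unfold pathIncr
  rw [projIcc_of_mem _ hs]
  exact congrArg₂ (· - ·) (h ⟨s, hs⟩ hst) (h ⟨0, le_rfl, zero_le_one⟩ ht)

lemma shearAmp_congr {b : ℝ → ℝ} {w w' : PathSpace 2 1} {t : ℝ}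
    (h : ∀ s : Icc (0 : ℝ) 1, s ≤ t → w s = w' s) (ht : 0 ≤ t) {k : ℕ} (hk : (1 / 2) ^ k ≤ t) :
    shearAmp b w k = shearAmp b w' k := by
  have hle : (1 / 2 : ℝ) ^ (k + 1) ≤ (1 / 2) ^ k :=
    pow_le_pow_of_le_one (by norm_num : (0 : ℝ) ≤ 1 / 2) (by norm_num) (Nat.le_succ k)
  refine intervalIntegral.integral_congr_ae (Filter.Eventually.of_forall fun s hs => ?_)
  rw [uIoc_of_le hle] at hs
  have hs0 : 0 < s := lt_trans (by positivity) hs.1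
  have hs1 : s ≤ 1 := hs.2.trans (pow_le_one₀ (by norm_num) (by norm_num))
  have : pathIncr w s = pathIncr w' s :=
    pathIncr_congr h ht ⟨hs0.le, hs1⟩ (hs.2.trans hk)
  rw [this]

lemma shearFlow_congr {β β' : ℕ → ℂ} {m : ℕ} (h : ∀ k ≥ m, β k = β' k) (j : ℕ) :
    shearFlow β m j = shearFlow β' m j := by
  induction j with
  | zero => rfl
  | succ j ih =>
    rw [shearFlow, shearFlow, ih]
    congr 1
    funext θ
    rw [shearMap, shearMap, h _ (Nat.le_add_right m j)]

/-- The approximate solution up to time `t` depends on the noise up to time `t` only. -/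
lemma approxPath_congr {b : ℝ → ℝ} (hbm : Measurable b) (hb : ∀ t, |b t| ≤ 1) (n : ℕ)
    (z : Eucl 2) {w w' : PathSpace 2 1} {t : ℝ} (ht0 : 0 ≤ t) (ht : t ≤ 1)
    (h : restrictPath ht w = restrictPath ht w') :
    restrictPath ht (approxPath hbm hb n z w) = restrictPath ht (approxPath hbm hb n z w') := by
  have hw : ∀ s : Icc (0 : ℝ) 1, s ≤ t → w s = w' s := fun s hs =>
    DFunLike.congr_fun h ⟨s, s.2.1, hs⟩
  have hvel : ∀ s : ℝ, 0 < s → s ≤ t → approxVel b n z w s = approxVel b n z w' s := by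
    intro s hs0 hst
    obtain ⟨h1, h2⟩ := stage_spec hs0 (hst.trans ht)
    -- Only the stages completed before time s enter; the current stage is seen through the noise at
    -- time s itself.
    have e1 : shearFlow (shearAmp b w) (stage s + 1) = shearFlow (shearAmp b w') (stage s + 1) := by
      funext j
      refine shearFlow_congr (fun k hk => shearAmp_congr hw ht0 ?_) j
      exact (pow_le_pow_of_le_one (by norm_num : (0 : ℝ) ≤ 1 / 2) (by norm_num) hk).trans
        (h1.le.trans hst)
    have e2 : pathIncr w s = pathIncr w' s :=
      pathIncr_congr hw ht0 ⟨hs0.le, hst.trans ht⟩ hst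
    rw [approxVel, approxVel, e1, e2]
  ext1 s
  refine congrArg₂ (· + ·) ?_ (congrArg₂ (· - ·) (hw ⟨s, s.2.1, s.2.2.trans ht⟩ s.2.2) (hw ⟨0, le_rfl, zero_le_one⟩ ht0))
  change z + (∫ r in (0 : ℝ)..(s : ℝ), _) = z + ∫ r in (0 : ℝ)..(s : ℝ), _
  refine congrArg (z + ·) ?_
  refine intervalIntegral.integral_congr_ae (Filter.Eventually.of_forall fun r hr => ?_)
  rw [uIoc_of_le s.2.1] at hr
  exact hvel r hr.1 (hr.2.trans s.2.2)

/-- After the starting time 2^(-n) the equation holds exactly. The defect is the error in the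
initial value plus the drift omitted before that time, of norm at most 1. -/
lemma norm_approxPath_defect_le {b : ℝ → ℝ} (hbm : Measurable b) (hb : ∀ t, |b t| ≤ 1) (n : ℕ)
    (z y : Eucl 2) (w : PathSpace 2 1) (t : Icc (0 : ℝ) 1) :
    ‖approxPath hbm hb n z w t - (y + (∫ s in (0 : ℝ)..t,
      shearField b s (approxPath hbm hb n z w (projIcc 0 1 zero_le_one s))) + w t
        - w ⟨0, le_rfl, zero_le_one⟩)‖ ≤ ‖z - y‖ + (1 / 2) ^ n := by
  have hX : ∀ s ∈ Icc (0 : ℝ) 1, approxPath hbm hb n z w (projIcc 0 1 zero_le_one s)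
      = approxPos b n z w s + pathIncr w s := by
    intro s hs
    rw [projIcc_of_mem _ hs, pathIncr, projIcc_of_mem _ hs]
    rfl
  have hc : Continuous fun s => approxPath hbm hb n z w (projIcc 0 1 zero_le_one s) :=
    (approxPath hbm hb n z w).continuous.comp continuous_projIcc
  have hum : StronglyMeasurable fun s =>
      shearField b s (approxPath hbm hb n z w (projIcc 0 1 zero_le_one s)) :=
    (ContinuousEval.continuous_eval
      (F := Eucl 2 →ᵇ Eucl 2)).comp_stronglyMeasurable
      ((stronglyMeasurable_shearField hbm).prodMk hc.stronglyMeasurable)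
  have hub : ∀ s, ‖shearField b s (approxPath hbm hb n z w (projIcc 0 1 zero_le_one s))‖ ≤ 1 :=
    fun s => ((shearField b s).norm_coe_le_norm _).trans (norm_shearField_le hb s)
  have hui : ∀ s t, IntervalIntegrable (fun s =>
      shearField b s (approxPath hbm hb n z w (projIcc 0 1 zero_le_one s))) volume s t := fun s t =>
    (intervalIntegrable_const (c := (1 : ℝ))).mono_fun hum.aestronglyMeasurable
      (Filter.Eventually.of_forall fun s => by simpa using hub s)
  have hvi := intervalIntegrable_approxVel hbm hb n z w
  have e : approxPath hbm hb n z w t - (y + (∫ s in (0 : ℝ)..t,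
      shearField b s (approxPath hbm hb n z w (projIcc 0 1 zero_le_one s))) + w t
        - w ⟨0, le_rfl, zero_le_one⟩)
      = (z - y) + ∫ s in (0 : ℝ)..t, (approxVel b n z w s -
        shearField b s (approxPath hbm hb n z w (projIcc 0 1 zero_le_one s))) := by
    rw [intervalIntegral.integral_sub (hvi _ _) (hui _ _)]
    change z + _ + (w t - _) - _ = _
    abel
  rw [e]
  refine (norm_add_le _ _).trans (add_le_add le_rfl ?_)
  have hD : ∀ s t, IntervalIntegrable (fun s => approxVel b n z w s -
        shearField b s (approxPath hbm hb n z w (projIcc 0 1 zero_le_one s))) volume s t :=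
    fun s t => (hvi s t).sub (hui s t)
  have hzero : ∀ s, (1 / 2) ^ n < s → s ≤ 1 → approxVel b n z w s -
        shearField b s (approxPath hbm hb n z w (projIcc 0 1 zero_le_one s)) = 0 := by
    intro s h1 h2
    rw [approxVel_eq_shearField hbm hb n z w h1 h2,
      hX s ⟨(lt_trans (by positivity) h1).le, h2⟩, sub_self]
  have hle : ∀ s, s ≤ (1 / 2) ^ n → ‖approxVel b n z w s -
        shearField b s (approxPath hbm hb n z w (projIcc 0 1 zero_le_one s))‖ ≤ 1 := by
    intro s hs
    rw [approxVel, if_pos hs, zero_sub, norm_neg]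
    exact hub s
  rcases le_total (t : ℝ) ((1 / 2) ^ n) with ht | ht
  · refine (intervalIntegral.norm_integral_le_of_norm_le_const (C := 1) fun s hs => ?_).trans ?_
    · rw [uIoc_of_le t.2.1] at hs
      exact hle s (hs.2.trans ht)
    · rw [one_mul, sub_zero, abs_of_nonneg t.2.1]
      exact ht
  · rw [← intervalIntegral.integral_add_adjacent_intervals (hD 0 ((1 / 2) ^ n)) (hD _ t)]
    rw [intervalIntegral.integral_zero_ae (a := (1 / 2) ^ n), add_zero]
    · refine (intervalIntegral.norm_integral_le_of_norm_le_const (C := 1) fun s hs => ?_).trans ?_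
      · rw [uIoc_of_le (by positivity)] at hs
        exact hle s hs.2
      · rw [one_mul, sub_zero, abs_of_nonneg (by positivity)]
    · refine Filter.Eventually.of_forall fun s hs => ?_
      rw [uIoc_of_le ht] at hs
      exact hzero s hs.1 (hs.2.trans t.2.2)

end

noncomputable section

open Filter Topology

/-! ### Weak convergence with a fixed marginal -/

/-- Since all second marginals equal ν, approximating g in L¹(ν) by a bounded continuous function
costs the same error for every n and for the limit. Conditional probabilities given the noise, which
need not be continuous, thereby become admissible test functions. -/
lemma tendsto_integral_mul_of_map_snd_eq {A B : Type*} [TopologicalSpace A] [MeasurableSpace A]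
    [BorelSpace A] [SecondCountableTopology A] [TopologicalSpace.PseudoMetrizableSpace A]
    [TopologicalSpace B] [MeasurableSpace B] [BorelSpace B] [SecondCountableTopology B]
    [TopologicalSpace.PseudoMetrizableSpace B]
    {μs : ℕ → ProbabilityMeasure (A × B)} {μ : ProbabilityMeasure (A × B)}
    (hμ : Tendsto μs atTop (𝓝 μ)) {ν : Measure B} [IsProbabilityMeasure ν]
    (hs : ∀ n, (μs n : Measure (A × B)).map Prod.snd = ν)
    (hl : (μ : Measure (A × B)).map Prod.snd = ν) (f : A →ᵇ ℝ) {g : B → ℝ} (hg : Measurable g)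
    {C : ℝ} (hC : ∀ x, |g x| ≤ C) :
    Tendsto (fun n => ∫ p, f p.1 * g p.2 ∂(μs n : Measure (A × B))) atTop
      (𝓝 (∫ p, f p.1 * g p.2 ∂(μ : Measure (A × B)))) := by
  let _ := TopologicalSpace.pseudoMetrizableSpacePseudoMetric B
  have hgi : Integrable g ν := (integrable_const C).mono' hg.aestronglyMeasurable
    (Eventually.of_forall fun x => hC x)
  rw [Metric.tendsto_atTop]
  intro ε hε
  set M := ‖f‖ + 1 with hM
  have hM0 : 0 < M := by positivity
  obtain ⟨g', hg', hgi'⟩ := hgi.exists_boundedContinuous_integral_sub_le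
    (show 0 < ε / (4 * M) by positivity)
  have hclose : ∀ κ : Measure (A × B), IsProbabilityMeasure κ → κ.map Prod.snd = ν →
      |(∫ p, f p.1 * g p.2 ∂κ) - ∫ p, f p.1 * g' p.2 ∂κ| ≤ ε / 4 := by
    intro κ _ hκ
    have i1 : Integrable (fun p : A × B => f p.1 * g p.2) κ := by
      refine (integrable_const (‖f‖ * C)).mono' ?_ (Eventually.of_forall fun p => ?_)
      · exact ((f.continuous.measurable.comp measurable_fst).mul
          (hg.comp measurable_snd)).aestronglyMeasurable
      · rw [norm_mul]
        exact mul_le_mul (f.norm_coe_le_norm _) (hC _) (norm_nonneg _) (norm_nonneg _)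
    have i2 : Integrable (fun p : A × B => f p.1 * g' p.2) κ := by
      refine (integrable_const (‖f‖ * ‖g'‖)).mono' ?_ (Eventually.of_forall fun p => ?_)
      · exact ((f.continuous.measurable.comp measurable_fst).mul
          (g'.continuous.measurable.comp measurable_snd)).aestronglyMeasurable
      · rw [norm_mul]
        exact mul_le_mul (f.norm_coe_le_norm _) (g'.norm_coe_le_norm _) (norm_nonneg _)
          (norm_nonneg _)
    rw [← integral_sub i1 i2, ← Real.norm_eq_abs]
    have i3 : Integrable (fun b => ‖g b - g' b‖) (κ.map Prod.snd) := by
      rw [hκ]; exact (hgi.sub hgi').norm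
    have i4 : Integrable (fun p : A × B => ‖g p.2 - g' p.2‖) κ :=
      i3.comp_measurable measurable_snd
    have e1 : ∫ p, ‖g p.2 - g' p.2‖ ∂κ = ∫ b, ‖g b - g' b‖ ∂ν := by
      rw [← hκ, integral_map measurable_snd.aemeasurable i3.aestronglyMeasurable]
    calc ‖∫ p, (f p.1 * g p.2 - f p.1 * g' p.2) ∂κ‖
        ≤ ∫ p, M * ‖g p.2 - g' p.2‖ ∂κ := by
          refine norm_integral_le_of_norm_le (i4.const_mul M) (Eventually.of_forall fun p => ?_)
          rw [← mul_sub, norm_mul]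
          exact mul_le_mul_of_nonneg_right ((f.norm_coe_le_norm _).trans (by linarith))
            (norm_nonneg _)
      _ = M * ∫ b, ‖g b - g' b‖ ∂ν := by rw [integral_const_mul, e1]
      _ ≤ M * (ε / (4 * M)) := by gcongr
      _ = ε / 4 := by field_simp
  have hconv := (ProbabilityMeasure.tendsto_iff_forall_integral_tendsto.1 hμ)
    ((f.compContinuous ⟨Prod.fst, continuous_fst⟩) * (g'.compContinuous ⟨Prod.snd, continuous_snd⟩))
  obtain ⟨N, hN⟩ := Metric.tendsto_atTop.1 hconv (ε / 4) (by positivity)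
  refine ⟨N, fun n hn => ?_⟩
  have h1 := hN n hn
  have h2 := hclose (μs n) inferInstance (hs n)
  have h3 := hclose μ inferInstance hl
  simp only [BoundedContinuousFunction.coe_mul, BoundedContinuousFunction.compContinuous_apply,
    ContinuousMap.coe_mk, Pi.mul_apply] at h1
  rw [Real.dist_eq, abs_lt] at *
  rw [abs_le] at h2 h3
  constructor <;> linarith [h1.1, h1.2, h2.1, h2.2, h3.1, h3.2]

/-! ### A criterion for conditional independence -/

/-- Bounded continuous functions determine finite Borel measures, so g need only be tested by such
functions, while k and f are tested by measurable sets. The identity compares the image under g of a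
restriction of μ with the image of a density, and boxes then determine the joint law of (k, g, f).
-/
lemma condIndepFun_of_integral_eq {S A B D : Type*} [MeasurableSpace S] [StandardBorelSpace S]
    [TopologicalSpace A] [MeasurableSpace A] [BorelSpace A] [StandardBorelSpace A] [Nonempty A]
    [HasOuterApproxClosed A] [MeasurableSpace B] [StandardBorelSpace B] [Nonempty B]
    [MeasurableSpace D] {μ : Measure S} [IsFiniteMeasure μ] {g : S → A} {f : S → B} {k : S → D}
    (hg : Measurable g) (hf : Measurable f) (hk : Measurable k)
    (h : ∀ φ : A →ᵇ ℝ, ∀ s : Set D, ∀ t : Set B, MeasurableSet s → MeasurableSet t →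
      ∫ x, φ (g x) * (s.indicator 1 (k x) * t.indicator 1 (f x)) ∂μ
        = ∫ x, φ (g x) * (s.indicator 1 (k x) * (condDistrib f k μ (k x)).real t) ∂μ) :
    CondIndepFun (MeasurableSpace.comap k inferInstance) hk.comap_le g f μ := by
  rw [condIndepFun_iff_condDistrib_prod_ae_eq_prodMkRight hf hg hk,
    condDistrib_ae_eq_iff_measure_eq_compProd _ hf.aemeasurable]
  refine Measure.ext_prod₃_iff'.2 fun {s c t} hs hc ht => ?_
  set R := condDistrib f k μ with hR
  set ρ : S → ℝ≥0∞ := fun x => s.indicator (fun d => R d t) (k x) with hρ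
  have hρm : Measurable ρ := ((R.measurable_coe ht).indicator hs).comp hk
  have hρ1 : ∀ x, ρ x ≤ 1 := fun x => by
    simp only [hρ, indicator]
    split_ifs
    · exact prob_le_one
    · exact zero_le
  have hfin : ∫⁻ x, ρ x ∂μ ≠ ∞ :=
    ((lintegral_mono hρ1).trans_lt (by simp [measure_lt_top])).ne
  have : IsFiniteMeasure (μ.withDensity ρ) := isFiniteMeasure_withDensity hfin
  have hset : MeasurableSet (k ⁻¹' s ∩ f ⁻¹' t) := (hk hs).inter (hf ht)
  have key : (μ.restrict (k ⁻¹' s ∩ f ⁻¹' t)).map g = (μ.withDensity ρ).map g := by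
    refine ext_of_forall_integral_eq_of_IsFiniteMeasure fun φ => ?_
    rw [integral_map hg.aemeasurable φ.continuous.measurable.aestronglyMeasurable,
      integral_map hg.aemeasurable φ.continuous.measurable.aestronglyMeasurable,
      integral_withDensity_eq_integral_toReal_smul hρm
        (Eventually.of_forall fun x => (hρ1 x).trans_lt ENNReal.one_lt_top),
      ← integral_indicator hset]
    convert h φ s t hs ht using 1
    · refine integral_congr_ae (Eventually.of_forall fun x => ?_)
      simp only [indicator, mem_inter_iff, mem_preimage, Pi.one_apply]
      by_cases h1 : k x ∈ s <;> by_cases h2 : f x ∈ t <;> simp [h1, h2]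
    · refine integral_congr_ae (Eventually.of_forall fun x => ?_)
      simp only [hρ, indicator, Pi.one_apply, Measure.real]
      by_cases h1 : k x ∈ s <;> simp [h1, mul_comm]
  have key2 : (μ.restrict (k ⁻¹' s ∩ f ⁻¹' t)).map g c = (μ.withDensity ρ).map g c := by rw [key]
  rw [Measure.map_apply hg hc, Measure.map_apply hg hc, Measure.restrict_apply (hg hc),
    withDensity_apply _ (hg hc)] at key2
  rw [Measure.map_apply ((hk.prodMk hg).prodMk hf) ((hs.prod hc).prod ht),
    Measure.compProd_apply_prod (hs.prod hc) ht]
  have e1 : (fun a => ((k a, g a), f a)) ⁻¹' ((s ×ˢ c) ×ˢ t) = g ⁻¹' c ∩ (k ⁻¹' s ∩ f ⁻¹' t) := by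
    ext x
    simp only [mem_preimage, mem_prod, mem_inter_iff]
    tauto
  rw [e1, key2, setLIntegral_map (hs.prod hc) (by
      exact (R.prodMkRight A).measurable_coe ht) (hk.prodMk hg)]
  have e2 : (fun a => (k a, g a)) ⁻¹' (s ×ˢ c) = k ⁻¹' s ∩ g ⁻¹' c := rfl
  rw [e2, inter_comm (k ⁻¹' s), ← lintegral_indicator (hg hc), ← lintegral_indicator ((hg hc).inter (hk hs))]
  refine lintegral_congr fun x => ?_
  simp only [hρ, indicator, mem_inter_iff, mem_preimage]
  by_cases h1 : k x ∈ s <;> by_cases h2 : g x ∈ c <;> simp [h1, h2]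

/-! ### Compactness of laws of approximate solutions -/

lemma isCompact_lipschitz_paths {d : ℕ} (y : Eucl d) :
    IsCompact {θ : PathSpace d 1 | ‖θ ⟨0, le_rfl, zero_le_one⟩ - y‖ ≤ 1 ∧
      ∀ s t, ‖θ t - θ s‖ ≤ |(t : ℝ) - s|} := by
  refine ArzelaAscoli.isCompact_of_equicontinuous _ ?_ ?_
  · have himg : ContinuousMap.toFun '' {θ : PathSpace d 1 | ‖θ ⟨0, le_rfl, zero_le_one⟩ - y‖ ≤ 1 ∧
        ∀ s t, ‖θ t - θ s‖ ≤ |(t : ℝ) - s|}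
        = {θ : Icc (0 : ℝ) 1 → Eucl d | ‖θ ⟨0, le_rfl, zero_le_one⟩ - y‖ ≤ 1 ∧
        ∀ s t, ‖θ t - θ s‖ ≤ |(t : ℝ) - s|} := by
      ext θ
      constructor
      · rintro ⟨θ', h, rfl⟩
        exact h
      · intro h
        have hL : LipschitzWith 1 θ := LipschitzWith.of_dist_le_mul fun s t => by
          rw [dist_eq_norm, Subtype.dist_eq, Real.dist_eq]
          simpa using h.2 t s
        exact ⟨⟨θ, hL.continuous⟩, h, rfl⟩
    rw [himg]
    have hc : IsClosed {θ : Icc (0 : ℝ) 1 → Eucl d | ‖θ ⟨0, le_rfl, zero_le_one⟩ - y‖ ≤ 1 ∧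
        ∀ s t, ‖θ t - θ s‖ ≤ |(t : ℝ) - s|} := by
      have h1 : IsClosed {θ : Icc (0 : ℝ) 1 → Eucl d | ‖θ ⟨0, le_rfl, zero_le_one⟩ - y‖ ≤ 1} :=
        isClosed_le (by fun_prop) continuous_const
      have h2 : IsClosed {θ : Icc (0 : ℝ) 1 → Eucl d | ∀ s t, ‖θ t - θ s‖ ≤ |(t : ℝ) - s|} := by
        simp only [ofPred_forall]
        exact isClosed_iInter fun s => isClosed_iInter fun t =>
          isClosed_le (by fun_prop) continuous_const
      exact h1.inter h2
    refine (isCompact_univ_pi fun _ : Icc (0 : ℝ) 1 =>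
      isCompact_closedBall y 2).of_isClosed_subset hc fun θ h t _ => ?_
    rw [mem_closedBall_iff_norm]
    have h1 := h.2 ⟨0, le_rfl, zero_le_one⟩ t
    rw [sub_zero, abs_of_nonneg t.2.1] at h1
    calc ‖θ t - y‖ = ‖(θ t - θ ⟨0, le_rfl, zero_le_one⟩) + (θ ⟨0, le_rfl, zero_le_one⟩ - y)‖ := by
          rw [sub_add_sub_cancel]
      _ ≤ 2 := (norm_add_le _ _).trans (by linarith [h.1, t.2.2])
  · refine LipschitzWith.uniformEquicontinuous _ 1 (fun θ => ?_) |>.equicontinuous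
    exact LipschitzWith.of_dist_le_mul fun s t => by
      rw [dist_eq_norm, Subtype.dist_eq, Real.dist_eq]
      simpa using θ.2.2 t s

/-- Each `u s` is continuous, so dominated convergence suffices; no continuity of the drift in time
is needed. -/
lemma continuous_integral_drift {d : ℕ} {u : VelocityField d} (hu : StronglyMeasurable u)
    (hub : ∀ t, ‖u t‖ ≤ 1) (t : ℝ) :
    Continuous fun X : PathSpace d 1 =>
      ∫ s in (0 : ℝ)..t, u s (X (projIcc 0 1 zero_le_one s)) := by
  refine intervalIntegral.continuous_of_dominated_interval (bound := fun _ => 1) (fun X => ?_)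
    (fun X => Eventually.of_forall fun s _ => ((u s).norm_coe_le_norm _).trans (hub s))
    intervalIntegrable_const (Eventually.of_forall fun s _ => ?_)
  · have hc : Continuous fun s => X (projIcc 0 1 zero_le_one s) :=
      X.continuous.comp continuous_projIcc
    exact ((ContinuousEval.continuous_eval (F := Eucl d →ᵇ Eucl d)).comp_stronglyMeasurable
      (hu.prodMk hc.stronglyMeasurable)).aestronglyMeasurable
  · exact (u s).continuous.comp (ContinuousEvalConst.continuous_eval_const _)

lemma isClosed_defect_le {d : ℕ} {u : VelocityField d} (hu : StronglyMeasurable u)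
    (hub : ∀ t, ‖u t‖ ≤ 1) (y : Eucl d) (ε : ℝ) :
    IsClosed {p : PathSpace d 1 × PathSpace d 1 | ∀ t : Icc (0 : ℝ) 1,
      ‖p.1 t - (y + (∫ s in (0 : ℝ)..t, u s (p.1 (projIcc 0 1 zero_le_one s))) + p.2 t
        - p.2 ⟨0, le_rfl, zero_le_one⟩)‖ ≤ ε} := by
  simp only [ofPred_forall]
  refine isClosed_iInter fun t => isClosed_le ?_ continuous_const
  have h1 := (continuous_integral_drift hu hub t).comp (continuous_fst (Y := PathSpace d 1))
  have h2 : ∀ t : Icc (0 : ℝ) 1, Continuous fun p : PathSpace d 1 × PathSpace d 1 => p.1 t :=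
    fun t => (ContinuousEvalConst.continuous_eval_const t).comp continuous_fst
  have h3 : ∀ t : Icc (0 : ℝ) 1, Continuous fun p : PathSpace d 1 × PathSpace d 1 => p.2 t :=
    fun t => (ContinuousEvalConst.continuous_eval_const t).comp continuous_snd
  exact ((h2 t).sub (((continuous_const.add h1).add (h3 t)).sub (h3 _))).norm

/-- Extension of a path on `[0,t]` by a constant. -/
def extendPath {d : ℕ} {t : ℝ} (ht : 0 ≤ t) (γ : PathSpace d t) : PathSpace d 1 :=
  ⟨fun s => γ (projIcc 0 t ht s),
    γ.continuous.comp (continuous_projIcc.comp continuous_subtype_val)⟩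

lemma measurable_extendPath {d : ℕ} {t : ℝ} (ht : 0 ≤ t) :
    Measurable (extendPath (d := d) ht) :=
  measurable_pathSpace fun _ => (ContinuousEvalConst.continuous_eval_const _).measurable

lemma restrictPath_extendPath {d : ℕ} {t : ℝ} (ht0 : 0 ≤ t) (ht : t ≤ 1) (γ : PathSpace d t) :
    restrictPath ht (extendPath ht0 γ) = γ := by
  ext1 s
  change γ (projIcc 0 t ht0 s) = γ s
  rw [projIcc_val]

lemma continuous_restrictPath {d : ℕ} {t T : ℝ} (h : t ≤ T) :
    Continuous (restrictPath (d := d) h) :=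
  ContinuousMap.continuous_precomp _

/-- Tower property: against a function of the past of the noise, an event of the whole noise may be
replaced by its conditional probability given that past. -/
lemma integral_indicator_eq_condDistrib {d : ℕ} {t : ℝ} (ht : t ≤ 1)
    {μ : Measure (PathSpace d 1 × PathSpace d 1)} [IsFiniteMeasure μ] [Nonempty (PathSpace d 1)]
    {h : PathSpace d t → ℝ} (hm : Measurable h) {C : ℝ} (hC : ∀ x, |h x| ≤ C)
    {B : Set (PathSpace d 1)} (hB : MeasurableSet B) :
    ∫ w, h (restrictPath ht w) * B.indicator 1 w ∂μ.map Prod.snd =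
      ∫ w, h (restrictPath ht w) *
        (condDistrib Prod.snd (fun p => restrictPath ht p.2) μ (restrictPath ht w)).real B
          ∂μ.map Prod.snd := by
  have hr : Measurable fun p : PathSpace d 1 × PathSpace d 1 => restrictPath ht p.2 :=
    (measurable_restrictPath ht).comp measurable_snd
  set R := condDistrib Prod.snd (fun p : PathSpace d 1 × PathSpace d 1 => restrictPath ht p.2) μ
  have hRm : Measurable fun a => (R a).real B := (R.measurable_coe hB).ennreal_toReal
  have hF : Measurable fun q : PathSpace d t × PathSpace d 1 => h q.1 * B.indicator 1 q.2 :=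
    (hm.comp measurable_fst).mul ((measurable_one.indicator hB).comp measurable_snd)
  have hFb : ∀ q : PathSpace d t × PathSpace d 1, ‖h q.1 * B.indicator (1 : PathSpace d 1 → ℝ) q.2‖ ≤ C := by
    intro q
    rw [norm_mul]
    have h0 : (0 : ℝ) ≤ C := (abs_nonneg _).trans (hC q.1)
    calc ‖h q.1‖ * ‖B.indicator (1 : PathSpace d 1 → ℝ) q.2‖ ≤ C * 1 := by
          refine mul_le_mul (hC q.1) ?_ (norm_nonneg _) h0
          by_cases hq : q.2 ∈ B <;> simp [hq]
      _ = C := mul_one C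
  have hmap : ∀ G : PathSpace d 1 → ℝ, Measurable G →
      ∫ w, G w ∂μ.map Prod.snd = ∫ p, G p.2 ∂μ := fun G hG =>
    integral_map measurable_snd.aemeasurable hG.aestronglyMeasurable
  rw [hmap (fun w => h (restrictPath ht w) * B.indicator 1 w)
      ((hm.comp (measurable_restrictPath ht)).mul (measurable_one.indicator hB)),
    hmap (fun w => h (restrictPath ht w) * (R (restrictPath ht w)).real B)
      ((hm.comp (measurable_restrictPath ht)).mul (hRm.comp (measurable_restrictPath ht)))]
  have e1 : ∫ p, h (restrictPath ht p.2) * B.indicator 1 p.2 ∂μ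
      = ∫ q, h q.1 * B.indicator 1 q.2 ∂(μ.map fun p => (restrictPath ht p.2, p.2)) := by
    rw [integral_map (hr.prodMk measurable_snd).aemeasurable hF.aestronglyMeasurable]
  have e2 : (μ.map fun p => (restrictPath ht p.2, p.2))
      = (μ.map fun p => restrictPath ht p.2) ⊗ₘ R :=
    (compProd_map_condDistrib measurable_snd.aemeasurable).symm
  rw [e1, e2, Measure.integral_compProd]
  · rw [integral_map hr.aemeasurable]
    · refine integral_congr_ae (Eventually.of_forall fun p => ?_)
      simp only [integral_const_mul]
      congr 1
      rw [integral_indicator_one hB]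
    · exact hF.stronglyMeasurable.integral_kernel_prod_right'.aestronglyMeasurable
  · exact (integrable_const C).mono' hF.aestronglyMeasurable (Eventually.of_forall hFb)

/-- Causal approximate solutions, of equicontinuous difference to the noise, have a subsequence
whose laws, jointly with the noise, converge to a weak solution. -/
theorem exists_isWeakSolution_of_approx {d : ℕ} {u : VelocityField d} (hu : StronglyMeasurable u)
    (hub : ∀ t, ‖u t‖ ≤ 1) {y : Eucl d} {𝕎 : Measure (PathSpace d 1)} [IsProbabilityMeasure 𝕎]
    {S : Type*} [MeasurableSpace S] {ν : Measure S} [IsProbabilityMeasure ν]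
    {X : ℕ → S → PathSpace d 1 → PathSpace d 1}
    (hXm : ∀ n, Measurable fun p : S × PathSpace d 1 => X n p.1 p.2)
    (hinit : ∀ᵐ s ∂ν, ∀ n w, ‖X n s w ⟨0, le_rfl, zero_le_one⟩ - y‖ ≤ 1)
    (hLip : ∀ n s w t t', ‖(X n s w t - w t) - (X n s w t' - w t')‖ ≤ |(t : ℝ) - t'|)
    {δ : ℕ → ℝ} (hδ : Tendsto δ atTop (𝓝 0))
    (hdef : ∀ᵐ s ∂ν, ∀ n w, ∀ t : Icc (0 : ℝ) 1, ‖X n s w t - (y + (∫ r in (0 : ℝ)..t,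
      u r (X n s w (projIcc 0 1 zero_le_one r))) + w t - w ⟨0, le_rfl, zero_le_one⟩)‖ ≤ δ n)
    (hcausal : ∀ (t : ℝ) (_ : 0 ≤ t) (ht : t ≤ 1) n s w w', restrictPath ht w = restrictPath ht w' →
      restrictPath ht (X n s w) = restrictPath ht (X n s w')) :
    ∃ (𝕏 : Measure (PathSpace d 1 × PathSpace d 1)) (_ : IsProbabilityMeasure 𝕏),
      IsWeakSolution zero_le_one u y 𝕎 𝕏 ∧ ∃ φ : ℕ → ℕ, StrictMono φ ∧
        ∀ (f : PathSpace d 1 →ᵇ ℝ) (g : PathSpace d 1 → ℝ) (C : ℝ), Measurable g →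
          (∀ w, |g w| ≤ C) → Tendsto (fun n => ∫ w, (∫ s, f (X (φ n) s w) ∂ν) * g w ∂𝕎) atTop
            (𝓝 (∫ p, f p.1 * g p.2 ∂𝕏)) := by
  have hpair : ∀ n, Measurable fun p : S × PathSpace d 1 => (X n p.1 p.2, p.2) := fun n =>
    (hXm n).prodMk measurable_snd
  set 𝕏s : ℕ → ProbabilityMeasure (PathSpace d 1 × PathSpace d 1) := fun n =>
    ⟨(ν.prod 𝕎).map fun p => (X n p.1 p.2, p.2),
      Measure.isProbabilityMeasure_map (hpair n).aemeasurable⟩ with h𝕏s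
  have hcoe : ∀ n, (𝕏s n : Measure (PathSpace d 1 × PathSpace d 1))
      = (ν.prod 𝕎).map fun p => (X n p.1 p.2, p.2) := fun n => rfl
  have hsnd : ∀ n, (𝕏s n : Measure (PathSpace d 1 × PathSpace d 1)).map Prod.snd = 𝕎 := fun n => by
    rw [hcoe, Measure.map_map measurable_snd (hpair n)]
    change (ν.prod 𝕎).map Prod.snd = 𝕎
    rw [Measure.map_snd_prod, measure_univ, one_smul]
  -- tightness
  set sh : PathSpace d 1 → PathSpace d 1 := fun w =>
    w - ContinuousMap.const _ (w ⟨0, le_rfl, zero_le_one⟩) with hsh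
  have hshc : Continuous sh := continuous_id.sub
    (ContinuousMap.continuous_const'.comp (ContinuousEvalConst.continuous_eval_const _))
  have hpair' : ∀ n, Measurable fun p : S × PathSpace d 1 => (X n p.1 p.2 - sh p.2, p.2) := fun n =>
    ((hXm n).sub (hshc.measurable.comp measurable_snd)).prodMk measurable_snd
  -- Without the noise increment, all paths lie almost surely in one compact set of Lipschitz paths;
  -- the noise component has a fixed law. The homeomorphic shift back preserves tightness.
  have htight0 : IsTightMeasureSet
      (range fun n => (ν.prod 𝕎).map fun p => (X n p.1 p.2 - sh p.2, p.2)) := by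
    refine IsTightMeasureSet.prodMk ?_ ?_
    · rw [isTightMeasureSet_iff_exists_isCompact_measure_compl_le]
      intro ε _
      refine ⟨_, isCompact_lipschitz_paths y, ?_⟩
      rintro _ ⟨_, ⟨n, rfl⟩, rfl⟩
      refine le_of_eq_of_le ?_ zero_le
      rw [Measure.fst, Measure.map_map measurable_fst (hpair' n), ← mem_ae_iff,
        mem_ae_map_iff (measurable_fst.comp (hpair' n)).aemeasurable
          (isCompact_lipschitz_paths y).measurableSet]
      filter_upwards [Measure.quasiMeasurePreserving_fst.ae hinit] with p hp
      refine ⟨?_, fun s t => ?_⟩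
      · have := hp n p.2
        change ‖(X n p.1 p.2 _ - (p.2 _ - p.2 _)) - y‖ ≤ 1
        rwa [sub_self, sub_zero]
      · have := hLip n p.1 p.2 t s
        change ‖(X n p.1 p.2 t - (p.2 t - p.2 _)) - (X n p.1 p.2 s - (p.2 s - p.2 _))‖ ≤ _
        convert this using 2
        abel
    · refine (isTightMeasureSet_singleton (μ := 𝕎)).subset ?_
      rintro _ ⟨_, ⟨n, rfl⟩, rfl⟩
      rw [Measure.snd, Measure.map_map measurable_snd (hpair' n)]
      change (ν.prod 𝕎).map Prod.snd = 𝕎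
      rw [Measure.map_snd_prod, measure_univ, one_smul]
  have htight : IsTightMeasureSet {((μ : ProbabilityMeasure (PathSpace d 1 × PathSpace d 1)) :
      Measure (PathSpace d 1 × PathSpace d 1)) | μ ∈ range 𝕏s} := by
    have hΦ : Continuous fun p : PathSpace d 1 × PathSpace d 1 => (p.1 + sh p.2, p.2) :=
      (continuous_fst.add (hshc.comp continuous_snd)).prodMk continuous_snd
    refine (htight0.map hΦ).subset ?_
    rintro _ ⟨_, ⟨n, rfl⟩, rfl⟩
    refine ⟨_, ⟨n, rfl⟩, ?_⟩
    rw [Measure.map_map hΦ.measurable (hpair' n), hcoe]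
    congr 1
    funext p
    simp
  obtain ⟨𝕏, -, φ, hφ, hlim⟩ := (isCompact_closure_of_isTightMeasureSet htight).isSeqCompact
    (fun n => subset_closure (mem_range_self n))
  have hlsnd : (𝕏 : Measure (PathSpace d 1 × PathSpace d 1)).map Prod.snd = 𝕎 := by
    have hprob : IsProbabilityMeasure ((𝕏 : Measure (PathSpace d 1 × PathSpace d 1)).map Prod.snd) :=
      Measure.isProbabilityMeasure_map measurable_snd.aemeasurable
    refine ext_of_forall_integral_eq_of_IsFiniteMeasure fun f => ?_
    have h1 := (ProbabilityMeasure.tendsto_iff_forall_integral_tendsto.1 hlim)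
      (f.compContinuous ⟨Prod.snd, continuous_snd⟩)
    have h2 : ∀ κ : Measure (PathSpace d 1 × PathSpace d 1),
        ∫ p, f.compContinuous ⟨Prod.snd, continuous_snd⟩ p ∂κ = ∫ w, f w ∂κ.map Prod.snd := by
      intro κ
      rw [integral_map measurable_snd.aemeasurable f.continuous.measurable.aestronglyMeasurable]
      rfl
    simp only [h2, Function.comp, hsnd] at h1
    exact tendsto_nhds_unique h1 tendsto_const_nhds
  have hconv : ∀ (f : PathSpace d 1 →ᵇ ℝ) (g : PathSpace d 1 → ℝ) (C : ℝ), Measurable g →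
      (∀ w, |g w| ≤ C) → Tendsto (fun n => ∫ w, (∫ s, f (X (φ n) s w) ∂ν) * g w ∂𝕎) atTop
        (𝓝 (∫ p, f p.1 * g p.2 ∂(𝕏 : Measure (PathSpace d 1 × PathSpace d 1)))) := by
    intro f g C hg hC
    refine (tendsto_integral_mul_of_map_snd_eq hlim (fun n => hsnd (φ n)) hlsnd f hg hC).congr
      fun n => ?_
    have hm : Measurable fun p : PathSpace d 1 × PathSpace d 1 => f p.1 * g p.2 :=
      (f.continuous.measurable.comp measurable_fst).mul (hg.comp measurable_snd)
    rw [Function.comp, hcoe, integral_map (hpair _).aemeasurable hm.aestronglyMeasurable,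
      integral_prod_symm]
    · refine integral_congr_ae (Eventually.of_forall fun w => ?_)
      exact integral_mul_const (μ := ν) (g w) fun s => f (X (φ n) s w)
    · refine (integrable_const (‖f‖ * C)).mono' (hm.comp (hpair _)).aestronglyMeasurable
        (Eventually.of_forall fun p => ?_)
      rw [norm_mul]
      exact mul_le_mul (f.norm_coe_le_norm _) (hC _) (norm_nonneg _) (norm_nonneg _)
  refine ⟨𝕏, inferInstance, ⟨hlsnd, fun t ht0 ht => ?_, ?_⟩, φ, hφ, hconv⟩
  · refine condIndepFun_of_integral_eq ((measurable_restrictPath ht).comp measurable_fst)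
      measurable_snd ((measurable_restrictPath ht).comp measurable_snd) fun f A B hA hB => ?_
    set R := condDistrib Prod.snd (fun p : PathSpace d 1 × PathSpace d 1 => restrictPath ht p.2)
      (𝕏 : Measure (PathSpace d 1 × PathSpace d 1)) with hR
    have hrm := measurable_restrictPath (d := d) ht
    have hRm : Measurable fun a => (R a).real B := (R.measurable_coe hB).ennreal_toReal
    have hind : ∀ w, |A.indicator (1 : PathSpace d t → ℝ) (restrictPath ht w)| ≤ 1 := fun w => by
      by_cases h : restrictPath ht w ∈ A <;> simp [h]
    have hA1 : Measurable fun w => A.indicator (1 : PathSpace d t → ℝ) (restrictPath ht w) :=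
      (measurable_one.indicator hA).comp hrm
    -- The two sides of the criterion are limits of integrals that agree for each n. Both test
    -- functions of the noise are merely measurable.
    have c1 := hconv (f.compContinuous ⟨restrictPath ht, continuous_restrictPath ht⟩)
      (fun w => A.indicator 1 (restrictPath ht w) * B.indicator 1 w) 1
      (hA1.mul (measurable_one.indicator hB)) (fun w => by
        rw [abs_mul]
        refine mul_le_one₀ (hind w) (abs_nonneg _) ?_
        by_cases h : w ∈ B <;> simp [h])
    have c2 := hconv (f.compContinuous ⟨restrictPath ht, continuous_restrictPath ht⟩)
      (fun w => A.indicator 1 (restrictPath ht w) * (R (restrictPath ht w)).real B) 1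
      (hA1.mul (hRm.comp hrm)) (fun w => by
        rw [abs_mul]
        refine mul_le_one₀ (hind w) (abs_nonneg _) ?_
        rw [abs_of_nonneg measureReal_nonneg]
        exact measureReal_le_one)
    refine tendsto_nhds_unique c1 (c2.congr fun n => ?_)
    -- By causality the average over the starting phase is a function of the noise up to time t.
    -- Extending the past by a constant realizes it as such.
    set H : PathSpace d t → ℝ := fun a =>
      (∫ s, f (restrictPath ht (X (φ n) s (extendPath ht0 a))) ∂ν) * A.indicator 1 a with hH
    have hHm : Measurable H := by
      refine Measurable.mul ?_ (measurable_one.indicator hA)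
      have h1 : Measurable fun q : PathSpace d t × S =>
          f (restrictPath ht (X (φ n) q.2 (extendPath ht0 q.1))) :=
        f.continuous.measurable.comp (hrm.comp ((hXm (φ n)).comp (measurable_snd.prodMk
          ((measurable_extendPath ht0).comp measurable_fst))))
      exact h1.stronglyMeasurable.integral_prod_right'.measurable
    have hHb : ∀ a, |H a| ≤ ‖f‖ := fun a => by
      rw [hH, abs_mul]
      have h1 : |∫ s, f (restrictPath ht (X (φ n) s (extendPath ht0 a))) ∂ν| ≤ ‖f‖ := by
        have := norm_integral_le_of_norm_le_const (μ := ν) (C := ‖f‖)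
          (f := fun s => f (restrictPath ht (X (φ n) s (extendPath ht0 a))))
          (Eventually.of_forall fun s => f.norm_coe_le_norm _)
        simpa using this
      calc _ ≤ ‖f‖ * 1 := mul_le_mul h1 (by by_cases h : a ∈ A <;> simp [h]) (abs_nonneg _)
            (norm_nonneg _)
        _ = ‖f‖ := mul_one _
    have hHeq : ∀ w, (∫ s, (f.compContinuous ⟨restrictPath ht, continuous_restrictPath ht⟩)
        (X (φ n) s w) ∂ν) * A.indicator 1 (restrictPath ht w) = H (restrictPath ht w) := by
      intro w
      rw [hH]
      simp only
      congr 1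
      refine integral_congr_ae (Eventually.of_forall fun s => ?_)
      change f (restrictPath ht (X (φ n) s w)) = _
      rw [hcausal t ht0 ht (φ n) s w (extendPath ht0 (restrictPath ht w))
        (restrictPath_extendPath ht0 ht _).symm]
    have := integral_indicator_eq_condDistrib (μ := (𝕏 : Measure _)) ht hHm hHb hB
    rw [hlsnd, ← hR] at this
    simp only [← mul_assoc, hHeq]
    exact this.symm
  · have hcl : ∀ k : ℕ, ∀ᵐ p ∂(𝕏 : Measure (PathSpace d 1 × PathSpace d 1)), ∀ t : Icc (0 : ℝ) 1,
        ‖p.1 t - (y + (∫ s in (0 : ℝ)..t, u s (p.1 (projIcc 0 1 zero_le_one s))) + p.2 t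
          - p.2 ⟨0, le_rfl, zero_le_one⟩)‖ ≤ 1 / (k + 1 : ℝ) := by
      intro k
      -- The closed set of pairs with small defect has full measure for all large n, so by the
      -- portmanteau theorem also in the limit.
      have hF := isClosed_defect_le hu hub y (1 / (k + 1 : ℝ))
      set F := {p : PathSpace d 1 × PathSpace d 1 | ∀ t : Icc (0 : ℝ) 1,
        ‖p.1 t - (y + (∫ s in (0 : ℝ)..t, u s (p.1 (projIcc 0 1 zero_le_one s))) + p.2 t
        - p.2 ⟨0, le_rfl, zero_le_one⟩)‖ ≤ 1 / (k + 1 : ℝ)} with hFdef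
      have hlims := ProbabilityMeasure.limsup_measure_closed_le_of_tendsto hlim hF
      have hev : ∀ᶠ n in atTop, ((𝕏s ∘ φ) n : Measure (PathSpace d 1 × PathSpace d 1)) F = 1 := by
        have h1 : ∀ᶠ n in atTop, δ (φ n) < 1 / (k + 1 : ℝ) :=
          (hδ.comp hφ.tendsto_atTop).eventually_lt_const (by positivity)
        filter_upwards [h1] with n hn
        have hP : IsProbabilityMeasure ((𝕏s ∘ φ) n : Measure (PathSpace d 1 × PathSpace d 1)) :=
          inferInstance
        rw [← prob_compl_eq_zero_iff hF.measurableSet, ← mem_ae_iff, Function.comp, hcoe,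
          mem_ae_map_iff (hpair _).aemeasurable hF.measurableSet]
        filter_upwards [Measure.quasiMeasurePreserving_fst.ae hdef] with p hp t
        exact (hp (φ n) p.2 t).trans hn.le
      rw [limsup_congr hev, limsup_const] at hlims
      exact (prob_compl_eq_zero_iff hF.measurableSet).2 (le_antisymm prob_le_one hlims)
    filter_upwards [ae_all_iff.2 hcl] with p hp t
    have h0 : ‖p.1 t - (y + (∫ s in (0 : ℝ)..t, u s (p.1 (projIcc 0 1 zero_le_one s))) + p.2 t
          - p.2 ⟨0, le_rfl, zero_le_one⟩)‖ ≤ 0 :=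
      ge_of_tendsto' tendsto_one_div_add_atTop_nhds_zero_nat fun k => hp k t
    exact sub_eq_zero.1 (norm_le_zero_iff.1 h0)

/-! ### Weak solutions spread out by mixing shears -/

lemma measurableSet_shearsMixFrom {α : Type*} [MeasurableSpace α] {β : α → ℕ → ℂ}
    (hβ : ∀ k, Measurable fun a => β a k) (m : ℕ) :
    MeasurableSet {a | ShearsMixFrom (β a) m} := by
  have : {a | ShearsMixFrom (β a) m} = ⋂ k, ⋂ (_ : k ≥ m),
      ({a | 8 ^ (k + 1) ≤ ‖β a (k + 1)‖ * shearFreq k} ∩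
        {a | ‖β a (k + 1)‖ * shearFreq k ≤ 32 ^ (k + 1)}) := by
    ext a
    simp [ShearsMixFrom]
  rw [this]
  refine MeasurableSet.iInter fun k => MeasurableSet.iInter fun _ => MeasurableSet.inter ?_ ?_
  · exact measurableSet_le measurable_const ((hβ _).norm.mul_const _)
  · exact measurableSet_le ((hβ _).norm.mul_const _) measurable_const

/-- The time `2^{-k}`. -/
def dyadicTime (k : ℕ) : Icc (0 : ℝ) 1 :=
  ⟨(1 / 2) ^ k, by positivity, pow_le_one₀ (by norm_num) (by norm_num)⟩

/-- The phase of the `m`-th shear at the end of the preceding stages. -/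
def pathPhase (m : ℕ) (X : PathSpace 2 1) : ℝ :=
  shearFreq m * X (dyadicTime (m + 1)) (shearDir (m + 1))

lemma continuous_pathPhase (m : ℕ) : Continuous (pathPhase m) := by
  unfold pathPhase
  have : Continuous fun X : PathSpace 2 1 => X (dyadicTime (m + 1)) :=
    ContinuousEvalConst.continuous_eval_const _
  fun_prop

lemma continuous_cos_pathPhase (m : ℕ) : Continuous fun X => Real.cos (pathPhase m X) :=
  Real.continuous_cos.comp (continuous_pathPhase m)

lemma continuous_sin_pathPhase (m : ℕ) : Continuous fun X => Real.sin (pathPhase m X) :=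
  Real.continuous_sin.comp (continuous_pathPhase m)

/-- A law of paths is spread out at the scale of the `m`-th shear. -/
def PhaseSpread (κ : Measure (PathSpace 2 1)) (m : ℕ) : Prop :=
  |∫ X, Real.cos (pathPhase m X) ∂κ| ≤ 1 / 2 ∧ |∫ X, Real.sin (pathPhase m X) ∂κ| ≤ 1 / 2

/-- A deterministic path has a deterministic phase r, and cos² r + sin² r = 1 exceeds 1/4 + 1/4. -/
lemma PhaseSpread.not_ae_restrictPath_eq {κ : Measure (PathSpace 2 1)} [IsProbabilityMeasure κ]
    {m : ℕ} (h : PhaseSpread κ m) {ε : ℝ} (hε : ε ≤ 1) (hm : (1 / 2) ^ (m + 1) ≤ ε)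
    (x₀ : PathSpace 2 ε) : ¬ ∀ᵐ X ∂κ, restrictPath hε X = x₀ := by
  intro hae
  obtain ⟨r, hr⟩ : ∃ r : ℝ, ∀ᵐ X ∂κ, pathPhase m X = r := by
    refine ⟨shearFreq m * x₀ ⟨(1 / 2) ^ (m + 1), by positivity, hm⟩ (shearDir (m + 1)), ?_⟩
    filter_upwards [hae] with X hX
    rw [← hX]
    rfl
  have h1 : ∫ X, Real.cos (pathPhase m X) ∂κ = Real.cos r := by
    rw [integral_congr_ae (g := fun _ => Real.cos r) (by filter_upwards [hr] with X hX; rw [hX])]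
    simp
  have h2 : ∫ X, Real.sin (pathPhase m X) ∂κ = Real.sin r := by
    rw [integral_congr_ae (g := fun _ => Real.sin r) (by filter_upwards [hr] with X hX; rw [hX])]
    simp
  rw [PhaseSpread, h1, h2] at h
  have h3 := sq_le_sq' (by linarith [abs_le.1 h.1]) (abs_le.1 h.1).2
  have h4 := sq_le_sq' (by linarith [abs_le.1 h.2]) (abs_le.1 h.2).2
  have := Real.sin_sq_add_cos_sq r
  norm_num at h3 h4
  linarith

/-- The starting point of the approximate solutions. -/
def approxStart (y : Eucl 2) (n : ℕ) (s : ℝ) : Eucl 2 :=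
  y + (s / shearFreq n) • shearVec (n + 1)

/-- The uniform distribution of phases. -/
def phaseLaw : Measure ℝ := ProbabilityTheory.cond volume (Ioc 0 (2 * Real.pi))

instance : IsProbabilityMeasure phaseLaw := by
  refine cond_isProbabilityMeasure_of_finite ?_ ?_
  · simp [Real.pi_pos]
  · simp [ENNReal.mul_eq_top]

lemma ae_phaseLaw : ∀ᵐ s ∂phaseLaw, s ∈ Ioc 0 (2 * Real.pi) := ae_cond_mem measurableSet_Ioc

lemma integral_phaseLaw {E : Type*} [NormedAddCommGroup E] [NormedSpace ℝ E] (f : ℝ → E) :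
    ∫ s, f s ∂phaseLaw = (2 * Real.pi)⁻¹ • ∫ s in (0 : ℝ)..2 * Real.pi, f s := by
  rw [phaseLaw, ProbabilityTheory.cond, integral_smul_measure, intervalIntegral.integral_of_le (by positivity),
    Real.volume_Ioc, sub_zero, ENNReal.toReal_inv, ENNReal.toReal_ofReal (by positivity)]

lemma norm_approxStart_sub_le (y : Eucl 2) (n : ℕ) {s : ℝ} (hs : s ∈ Ioc 0 (2 * Real.pi)) :
    ‖approxStart y n s - y‖ ≤ 2 * Real.pi / shearFreq n := by
  rw [approxStart, add_sub_cancel_left, norm_smul, norm_shearVec, mul_one, Real.norm_eq_abs,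
    abs_div, abs_of_pos hs.1, abs_of_pos (shearFreq_pos n)]
  have := shearFreq_pos n
  gcongr
  exact hs.2

/-- For fixed noise, the noise increment only multiplies the phase factor by a constant of modulus
1. What remains is `meanPhase` divided by 2π. -/
lemma norm_integral_exp_pathPhase_le {b : ℝ → ℝ} (hbm : Measurable b) (hb : ∀ t, |b t| ≤ 1)
    (y : Eucl 2) {w : PathSpace 2 1} {m : ℕ} (hm : 8 ≤ m) (h : ShearsMixFrom (shearAmp b w) m)
    {n : ℕ} (hn : m ≤ n) :
    ‖∫ s, Complex.exp ((pathPhase m (approxPath hbm hb (n + 1) (approxStart y n s) w) : ℝ)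
      * Complex.I) ∂phaseLaw‖ ≤ 1 / 2 := by
  have e1 : ∀ s, Complex.exp ((pathPhase m (approxPath hbm hb (n + 1) (approxStart y n s) w) : ℝ)
      * Complex.I) = phaseObs m (shearFlow (shearAmp b w) (m + 1) (n - m) (approxStart y n s))
        * Complex.exp ((shearFreq m * pathIncr w (dyadicTime (m + 1)) (shearDir (m + 1)) : ℝ)
          * Complex.I) := by
    intro s
    have e2 := approxPos_pow hbm hb (n - m) (approxStart y n s) w (m + 1)
    rw [show m + 1 + (n - m) = n + 1 by omega] at e2
    rw [← e2, phaseObs, ← Complex.exp_add, ← add_mul, ← Complex.ofReal_add, ← mul_add]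
    rw [pathIncr_coe]
    rfl
  simp_rw [e1]
  rw [integral_mul_const, norm_mul, Complex.norm_exp_ofReal_mul_I, mul_one, integral_phaseLaw,
    norm_smul, Real.norm_eq_abs, abs_of_pos (by positivity)]
  have h2 := norm_meanPhase_le h hm y (n - m)
  unfold meanPhase at h2
  rw [show m + (n - m) = n by omega] at h2
  rw [inv_mul_le_iff₀ Real.two_pi_pos]
  refine h2.trans (le_of_eq ?_)
  ring

lemma setIntegral_spread_le {b : ℝ → ℝ} (hbm : Measurable b) (hb : ∀ t, |b t| ≤ 1)
    (y : Eucl 2) {w : PathSpace 2 1} {m : ℕ} (hm : 8 ≤ m) (h : ShearsMixFrom (shearAmp b w) m)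
    {n : ℕ} (hn : m ≤ n) :
    |∫ s, Real.cos (pathPhase m (approxPath hbm hb (n + 1) (approxStart y n s) w)) ∂phaseLaw|
      ≤ 1 / 2 ∧
    |∫ s, Real.sin (pathPhase m (approxPath hbm hb (n + 1) (approxStart y n s) w)) ∂phaseLaw|
      ≤ 1 / 2 := by
  have h0 := norm_integral_exp_pathPhase_le hbm hb y hm h hn
  have hsm : Measurable fun s => approxStart y n s := by unfold approxStart; fun_prop
  have hPm : Measurable fun s => pathPhase m (approxPath hbm hb (n + 1) (approxStart y n s) w) :=
    (continuous_pathPhase m).measurable.comp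
      ((measurable_approxPath hbm hb (n + 1)).comp (hsm.prodMk measurable_const))
  have hi : Integrable (fun s => Complex.exp ((pathPhase m (approxPath hbm hb (n + 1)
      (approxStart y n s) w) : ℝ) * Complex.I)) phaseLaw := by
    refine (integrable_const (1 : ℝ)).mono' ?_ (Eventually.of_forall fun s => ?_)
    · exact (Complex.measurable_exp.comp
        ((Complex.measurable_ofReal.comp hPm).mul_const _)).aestronglyMeasurable
    · rw [Complex.norm_exp_ofReal_mul_I]
  constructor
  · have h1 := (Complex.abs_re_le_norm _).trans h0
    rw [← RCLike.re_eq_complex_re, ← integral_re hi] at h1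
    simpa only [RCLike.re_eq_complex_re, Complex.exp_ofReal_mul_I_re] using h1
  · have h1 := (Complex.abs_im_le_norm _).trans h0
    rw [← RCLike.im_eq_complex_im, ← integral_im hi] at h1
    simpa only [RCLike.im_eq_complex_im, Complex.exp_ofReal_mul_I_im] using h1

/-- Disintegration turns the hypothesis into a bound on the integral of the conditional mean over
every measurable subset of G, which forces the bound almost everywhere on G. -/
lemma ae_abs_integral_condDistrib_le {𝕎 : Measure (PathSpace 2 1)} [IsProbabilityMeasure 𝕎]
    {𝕏 : Measure (PathSpace 2 1 × PathSpace 2 1)} [IsProbabilityMeasure 𝕏]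
    (hsnd : 𝕏.map Prod.snd = 𝕎) (f : PathSpace 2 1 →ᵇ ℝ) {G : Set (PathSpace 2 1)}
    (hG : MeasurableSet G) (h : ∀ B ⊆ G, MeasurableSet B →
      |∫ p, f p.1 * B.indicator 1 p.2 ∂𝕏| ≤ 1 / 2 * 𝕎.real B) :
    ∀ᵐ w ∂𝕎, w ∈ G → |∫ X, f X ∂condDistrib Prod.fst Prod.snd 𝕏 w| ≤ 1 / 2 := by
  set κ := condDistrib Prod.fst Prod.snd 𝕏 with hκ
  set φ : PathSpace 2 1 → ℝ := fun w => ∫ X, f X ∂κ w with hφ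
  have hfm : Measurable f := f.continuous.measurable
  have hφm : Measurable φ :=
    ((hfm.comp measurable_snd).stronglyMeasurable.integral_kernel_prod_right'
      (κ := κ) (f := fun p => f p.2)).measurable
  have hφb : ∀ w, |φ w| ≤ ‖f‖ := fun w => by
    have := norm_integral_le_of_norm_le_const (μ := κ w) (C := ‖f‖) (f := f)
      (Eventually.of_forall fun s => f.norm_coe_le_norm _)
    simpa using this
  have hφi : ∀ μ : Measure (PathSpace 2 1), IsFiniteMeasure μ → Integrable φ μ := fun μ _ =>
    (integrable_const ‖f‖).mono' hφm.aestronglyMeasurable (Eventually.of_forall hφb)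
  have hcomp : 𝕏.map (fun p => (p.2, p.1)) = 𝕎 ⊗ₘ κ := by
    rw [← hsnd]
    exact (compProd_map_condDistrib measurable_fst.aemeasurable).symm
  have hset : ∀ B, MeasurableSet B → ∫ w in B, φ w ∂𝕎 = ∫ p, f p.1 * B.indicator 1 p.2 ∂𝕏 := by
    intro B hB
    have hFm : Measurable fun q : PathSpace 2 1 × PathSpace 2 1 =>
        f q.2 * B.indicator (1 : PathSpace 2 1 → ℝ) q.1 :=
      (hfm.comp measurable_snd).mul ((measurable_one.indicator hB).comp measurable_fst)
    have e1 : ∫ p, f p.1 * B.indicator 1 p.2 ∂𝕏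
        = ∫ q, f q.2 * B.indicator 1 q.1 ∂(𝕏.map fun p => (p.2, p.1)) := by
      rw [integral_map (measurable_snd.prodMk measurable_fst).aemeasurable
        hFm.aestronglyMeasurable]
    rw [e1, hcomp, Measure.integral_compProd]
    · rw [← integral_indicator hB]
      refine integral_congr_ae (Eventually.of_forall fun w => ?_)
      simp only [integral_mul_const]
      by_cases hw : w ∈ B <;> simp [hw, hφ]
    · refine (integrable_const (‖f‖ * 1)).mono' hFm.aestronglyMeasurable
        (Eventually.of_forall fun p => ?_)
      rw [norm_mul]
      refine mul_le_mul (f.norm_coe_le_norm _) ?_ (norm_nonneg _) (norm_nonneg _)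
      by_cases hw : p.1 ∈ B <;> simp [hw]
  have hB2 : ∀ B, MeasurableSet B → |∫ w in B, φ w ∂𝕎.restrict G| ≤ ∫ w in B, (1 / 2 : ℝ) ∂𝕎.restrict G := by
    intro B hB
    rw [Measure.restrict_restrict hB, hset _ (hB.inter hG)]
    refine (h _ inter_subset_right (hB.inter hG)).trans (le_of_eq ?_)
    simp [Measure.real, mul_comm]
  have hle1 : φ ≤ᵐ[𝕎.restrict G] fun _ => 1 / 2 :=
    ae_le_of_forall_setIntegral_le (hφi _ inferInstance) (integrable_const _)
      fun B hB _ => (le_abs_self _).trans (hB2 B hB)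
  have hle2 : (fun w => -φ w) ≤ᵐ[𝕎.restrict G] fun _ => 1 / 2 :=
    ae_le_of_forall_setIntegral_le (hφi _ inferInstance).neg (integrable_const _)
      fun B hB _ => by
        rw [integral_neg]
        exact (neg_le_abs _).trans (hB2 B hB)
  have hle3 : ∀ᵐ w ∂𝕎.restrict G, |φ w| ≤ 1 / 2 := by
    filter_upwards [hle1, hle2] with w h1 h2
    exact abs_le.2 ⟨by linarith, h1⟩
  exact (ae_restrict_iff' hG).1 hle3

lemma half_pow_tendsto : Tendsto (fun n : ℕ => 8 * (1 / 2 : ℝ) ^ n) atTop (𝓝 0) := by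
  simpa using (tendsto_pow_atTop_nhds_zero_of_lt_one (by norm_num : (0 : ℝ) ≤ 1 / 2)
    (by norm_num)).const_mul 8

lemma inv_shearFreq_le (n : ℕ) : 1 / shearFreq n ≤ (1 / 2) ^ n := by
  rw [one_div_pow]
  refine one_div_le_one_div_of_le (by positivity) ?_
  exact pow_le_pow_right₀ (by norm_num) (Nat.le_self_pow (by norm_num) n)

/-- If the shears mix almost surely, there is a weak solution whose conditional law given the
noise is spread out at arbitrarily small times. -/
theorem exists_isWeakSolution_spread {b : ℝ → ℝ} (hbm : Measurable b) (hb : ∀ t, |b t| ≤ 1)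
    {𝕎 : Measure (PathSpace 2 1)} [IsProbabilityMeasure 𝕎]
    (hmix : ∀ᵐ w ∂𝕎, ∃ m, ShearsMixFrom (shearAmp b w) m) (y : Eucl 2) :
    ∃ (𝕏 : Measure (PathSpace 2 1 × PathSpace 2 1)) (_ : IsProbabilityMeasure 𝕏),
      IsWeakSolution zero_le_one (shearField b) y 𝕎 𝕏 ∧
      ∀ᵐ w ∂𝕎, ∃ M, ∀ m ≥ M, PhaseSpread (condDistrib Prod.fst Prod.snd 𝕏 w) m := by
  -- The first shear met after time 2^(-(n+4)) is number n + 3, and the perturbation makes its phase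
  -- uniform. The offset 3 brings the starting points within distance 1 of y, as 2π < 7 < 2^3.
  set X : ℕ → ℝ → PathSpace 2 1 → PathSpace 2 1 := fun n s w =>
    approxPath hbm hb (n + 3 + 1) (approxStart y (n + 3) s) w with hX
  have hstart : ∀ n s, s ∈ Ioc 0 (2 * Real.pi) →
      ‖approxStart y (n + 3) s - y‖ ≤ 7 * (1 / 2) ^ (n + 3) := fun n s hs => by
    refine (norm_approxStart_sub_le y (n + 3) hs).trans ?_
    have h1 := inv_shearFreq_le (n + 3)
    have h2 := Real.pi_lt_d2
    have h3 : 0 ≤ 1 / shearFreq (n + 3) := by have := shearFreq_pos (n + 3); positivity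
    rw [div_eq_mul_one_div]
    nlinarith [Real.pi_pos]
  have hXm : ∀ n, Measurable fun p : ℝ × PathSpace 2 1 => X n p.1 p.2 := fun n => by
    have hsm : Measurable fun s => approxStart y (n + 3) s := by unfold approxStart; fun_prop
    exact (measurable_approxPath hbm hb (n + 3 + 1)).comp
      ((hsm.comp measurable_fst).prodMk measurable_snd)
  have hdef0 : ∀ s ∈ Ioc 0 (2 * Real.pi), ∀ n w, ∀ t : Icc (0 : ℝ) 1,
      ‖X n s w t - (y + (∫ r in (0 : ℝ)..t,
      shearField b r (X n s w (projIcc 0 1 zero_le_one r))) + w t - w ⟨0, le_rfl, zero_le_one⟩)‖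
        ≤ 8 * (1 / 2) ^ n := fun s hs n w t => by
    refine (norm_approxPath_defect_le hbm hb (n + 3 + 1) _ y w t).trans ?_
    have h1 := hstart n s hs
    have h2 : (0 : ℝ) ≤ (1 / 2) ^ n := by positivity
    rw [pow_add] at h1
    rw [add_assoc, pow_add (1 / 2 : ℝ) n]
    norm_num at h1 ⊢
    linarith
  have hinit : ∀ᵐ s ∂phaseLaw, ∀ n w, ‖X n s w ⟨0, le_rfl, zero_le_one⟩ - y‖ ≤ 1 := by
    filter_upwards [ae_phaseLaw] with s hs n w
    have e1 : X n s w ⟨0, le_rfl, zero_le_one⟩ = approxStart y (n + 3) s := by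
      change approxPos b _ _ w 0 + (w _ - w _) = _
      rw [approxPos_of_le _ _ _ le_rfl (by positivity), sub_self, add_zero]
    rw [e1]
    have h1 := hstart n s hs
    have h2 : (1 / 2 : ℝ) ^ n ≤ 1 := pow_le_one₀ (by norm_num) (by norm_num)
    rw [pow_add] at h1
    norm_num at h1
    linarith
  have hLip : ∀ n s w t t', ‖(X n s w t - w t) - (X n s w t' - w t')‖ ≤ |(t : ℝ) - t'| := by
    intro n s w t t'
    have := norm_approxPos_sub_le hbm hb (n + 3 + 1) (approxStart y (n + 3) s) w t' t
    convert this using 2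
    change (approxPos b _ _ w t + (w t - w _) - w t) - (approxPos b _ _ w t' + (w t' - w _) - w t') = _
    abel
  have hdef : ∀ᵐ s ∂phaseLaw, ∀ n w, ∀ t : Icc (0 : ℝ) 1, ‖X n s w t - (y + (∫ r in (0 : ℝ)..t,
      shearField b r (X n s w (projIcc 0 1 zero_le_one r))) + w t - w ⟨0, le_rfl, zero_le_one⟩)‖
        ≤ 8 * (1 / 2) ^ n := by
    filter_upwards [ae_phaseLaw] with s hs n w t
    exact hdef0 s hs n w t
  obtain ⟨𝕏, h𝕏, hweak, φ, hφ, hconv⟩ := exists_isWeakSolution_of_approx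
    (stronglyMeasurable_shearField hbm) (norm_shearField_le hb) (y := y) (𝕎 := 𝕎) (ν := phaseLaw)
    (X := X) hXm hinit hLip half_pow_tendsto hdef
    fun t ht0 ht n s w w' h => approxPath_congr hbm hb _ _ ht0 ht h
  refine ⟨𝕏, h𝕏, hweak, ?_⟩
  have hG : ∀ m, MeasurableSet {w | ShearsMixFrom (shearAmp b w) m} :=
    measurableSet_shearsMixFrom (measurable_shearAmp hbm)
  have hbound : ∀ (m : ℕ) (_ : 8 ≤ m) (f : PathSpace 2 1 →ᵇ ℝ),
      (∀ w, ShearsMixFrom (shearAmp b w) m → ∀ n, m ≤ n →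
        |∫ s, f (approxPath hbm hb (n + 1) (approxStart y n s) w) ∂phaseLaw| ≤ 1 / 2) →
      ∀ B ⊆ {w | ShearsMixFrom (shearAmp b w) m}, MeasurableSet B →
        |∫ p, f p.1 * B.indicator 1 p.2 ∂𝕏| ≤ 1 / 2 * 𝕎.real B := by
    intro m hm f hf B hBG hB
    have h1 := hconv f (B.indicator 1) 1 (measurable_one.indicator hB) (fun w => by
      by_cases h : w ∈ B <;> simp [h])
    -- The bound holds for every noise path in B and all large n, hence for the integral over B, and
    -- passes to the limit.
    refine le_of_tendsto h1.abs ?_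
    filter_upwards [eventually_ge_atTop m] with n hn
    have h2 : ∫ w, (1 / 2 : ℝ) * B.indicator 1 w ∂𝕎 = 1 / 2 * 𝕎.real B := by
      rw [integral_const_mul, integral_indicator_one hB]
    rw [← h2, ← Real.norm_eq_abs]
    refine norm_integral_le_of_norm_le ?_ (Eventually.of_forall fun w => ?_)
    · exact ((integrable_indicator_iff hB).2 (integrable_const (1 : ℝ)).integrableOn).const_mul _
    · rw [norm_mul]
      by_cases h : w ∈ B
      · simp only [h, indicator_of_mem, Pi.one_apply, norm_one, mul_one]
        exact hf w (hBG h) (φ n + 3) (hn.trans (hφ.le_apply.trans (Nat.le_add_right _ _)))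
      · simp [h]
  have hcos : ∀ m, 8 ≤ m → ∀ᵐ w ∂𝕎, w ∈ {w | ShearsMixFrom (shearAmp b w) m} →
      |∫ X, Real.cos (pathPhase m X) ∂condDistrib Prod.fst Prod.snd 𝕏 w| ≤ 1 / 2 := by
    intro m hm
    exact ae_abs_integral_condDistrib_le hweak.noise_marginal
      (BoundedContinuousFunction.ofNormedAddCommGroup _ (continuous_cos_pathPhase m) 1
        fun X => Real.abs_cos_le_one _) (hG m)
      (hbound m hm _ fun w hw n hn => (setIntegral_spread_le hbm hb y hm hw hn).1)
  have hsin : ∀ m, 8 ≤ m → ∀ᵐ w ∂𝕎, w ∈ {w | ShearsMixFrom (shearAmp b w) m} →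
      |∫ X, Real.sin (pathPhase m X) ∂condDistrib Prod.fst Prod.snd 𝕏 w| ≤ 1 / 2 := by
    intro m hm
    exact ae_abs_integral_condDistrib_le hweak.noise_marginal
      (BoundedContinuousFunction.ofNormedAddCommGroup _ (continuous_sin_pathPhase m) 1
        fun X => Real.abs_sin_le_one _) (hG m)
      (hbound m hm _ fun w hw n hn => (setIntegral_spread_le hbm hb y hm hw hn).2)
  have hall : ∀ᵐ w ∂𝕎, ∀ m, 8 ≤ m → ShearsMixFrom (shearAmp b w) m →
      PhaseSpread (condDistrib Prod.fst Prod.snd 𝕏 w) m := by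
    refine ae_all_iff.2 fun m => ?_
    by_cases hm : 8 ≤ m
    · filter_upwards [hcos m hm, hsin m hm] with w h1 h2 _ hw
      exact ⟨h1 hw, h2 hw⟩
    · exact Eventually.of_forall fun w h => absurd h hm
  filter_upwards [hall, hmix] with w hw ⟨m, hm⟩
  exact ⟨max m 8, fun k hk => hw k ((le_max_right _ _).trans hk)
    (hm.mono ((le_max_left _ _).trans hk))⟩

/-! ### Nonuniqueness from spread-out conditional laws -/

lemma IsCaratheodorySolution.restrictPath {d : ℕ} {u : VelocityField d} {y : Eucl d}
    {w X : PathSpace d 1} (h : IsCaratheodorySolution zero_le_one u y w X) {ε : ℝ} (hε0 : 0 ≤ ε)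
    (hε : ε ≤ 1) :
    IsCaratheodorySolution hε0 u y (restrictPath hε w) (restrictPath hε X) := by
  intro t
  have h1 := h ⟨t, t.2.1, t.2.2.trans hε⟩
  refine h1.trans ?_
  congr 3
  refine intervalIntegral.integral_congr fun s hs => ?_
  rw [uIcc_of_le t.2.1] at hs
  change u s (X _) = u s (X _)
  congr 2
  apply Subtype.ext
  simp only [ContinuousMap.coe_mk, projIcc_of_mem zero_le_one
    ⟨hs.1, hs.2.trans (t.2.2.trans hε)⟩, projIcc_of_mem hε0 ⟨hs.1, hs.2.trans t.2.2⟩]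

lemma exists_dyadic_le {ε : ℝ} (hε : 0 < ε) (M : ℕ) : ∃ m ≥ M, (1 / 2 : ℝ) ^ (m + 1) ≤ ε := by
  obtain ⟨n, hn⟩ := exists_pow_lt_of_lt_one hε (by norm_num : (1 / 2 : ℝ) < 1)
  refine ⟨max M n, le_max_left _ _, le_trans ?_ hn.le⟩
  exact pow_le_pow_of_le_one (by norm_num) (by norm_num)
    ((le_max_right M n).trans (Nat.le_succ _))

/-- The conditional law of the path is not a Dirac mass on any initial interval. -/
def CondSpread (𝕎 : Measure (PathSpace 2 1)) (𝕏 : Measure (PathSpace 2 1 × PathSpace 2 1))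
    [IsFiniteMeasure 𝕏] : Prop :=
  ∀ᵐ w ∂𝕎, ∀ ε : ℝ, 0 < ε → ∀ hε : ε ≤ 1, ∀ x₀ : PathSpace 2 ε,
    ¬ ∀ᵐ X ∂condDistrib Prod.fst Prod.snd 𝕏 w, restrictPath hε X = x₀

lemma condSpread_of_phaseSpread {𝕎 : Measure (PathSpace 2 1)}
    {𝕏 : Measure (PathSpace 2 1 × PathSpace 2 1)} [IsFiniteMeasure 𝕏]
    (h : ∀ᵐ w ∂𝕎, ∃ M, ∀ m ≥ M, PhaseSpread (condDistrib Prod.fst Prod.snd 𝕏 w) m) :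
    CondSpread 𝕎 𝕏 := by
  filter_upwards [h] with w ⟨M, hM⟩ ε hε0 hε x₀
  obtain ⟨m, hm, hmε⟩ := exists_dyadic_le hε0 M
  exact (hM m hm).not_ae_restrictPath_eq hε hmε x₀

/-- On a second countable space a probability measure is carried by its support, so a one-point
support would make the restricted path deterministic. -/
lemma CondSpread.support_nontrivial {𝕎 : Measure (PathSpace 2 1)}
    {𝕏 : Measure (PathSpace 2 1 × PathSpace 2 1)} [IsFiniteMeasure 𝕏]
    (h : CondSpread 𝕎 𝕏) (hsnd : 𝕏.map Prod.snd = 𝕎) {ε : ℝ} (hε0 : 0 < ε) (hε : ε ≤ 1) :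
    ∀ᵐ w ∂𝕎, (condLawGivenNoise 𝕏 hε w).support.Nontrivial := by
  have h1 : condLawGivenNoise 𝕏 hε
      =ᵐ[𝕎] (condDistrib Prod.fst Prod.snd 𝕏).map (restrictPath hε) := by
    rw [← hsnd]
    exact condDistrib_comp (μ := 𝕏) Prod.snd (Y := Prod.fst) measurable_fst.aemeasurable
      (measurable_restrictPath hε)
  filter_upwards [h, h1] with w hw hw1
  rw [hw1, Kernel.map_apply _ (measurable_restrictPath hε)]
  set κ := condDistrib Prod.fst Prod.snd 𝕏 w with hκ
  set μ := κ.map (restrictPath hε) with hμ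
  have hμp : IsProbabilityMeasure μ :=
    Measure.isProbabilityMeasure_map (measurable_restrictPath hε).aemeasurable
  obtain ⟨x₀, hx₀⟩ := Measure.nonempty_support (μ := μ) (IsProbabilityMeasure.ne_zero μ)
  by_contra hnt
  rw [not_nontrivial_iff] at hnt
  have hs : μ.support = {x₀} := hnt.eq_singleton_of_mem hx₀
  have h2 : ∀ᵐ x ∂μ, x ∈ μ.support := Measure.support_mem_ae
  rw [hs] at h2
  exact hw ε hε0 hε x₀ (ae_of_ae_map (measurable_restrictPath hε).aemeasurable h2)

lemma IsWeakSolution.congr {d : ℕ} {T : ℝ} {hT : 0 ≤ T} {u : VelocityField d} {y : Eucl d}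
    {𝕎 : Measure (PathSpace d T)} {𝕏 𝕏' : Measure (PathSpace d T × PathSpace d T)}
    [IsFiniteMeasure 𝕏] [IsFiniteMeasure 𝕏'] (h : IsWeakSolution hT u y 𝕎 𝕏) (he : 𝕏' = 𝕏) :
    IsWeakSolution hT u y 𝕎 𝕏' := by
  subst he
  exact h

/-- Given the noise, draw two independent copies from the conditional law. Each copy has the joint
law `𝕏` with the noise; if they agreed almost surely, Fubini would make the conditional law of the
restricted path a Dirac mass. -/
lemma CondSpread.pathwiseNonuniqueOn {u : VelocityField 2} {y : Eucl 2}
    {𝕎 : Measure (PathSpace 2 1)} [IsProbabilityMeasure 𝕎]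
    {𝕏 : Measure (PathSpace 2 1 × PathSpace 2 1)} [IsProbabilityMeasure 𝕏]
    (h : CondSpread 𝕎 𝕏) (hX : IsWeakSolution zero_le_one u y 𝕎 𝕏) {ε : ℝ} (hε0 : 0 < ε)
    (hε : ε ≤ 1) : PathwiseNonuniqueOn zero_le_one u y 𝕎 hε := by
  set κ := condDistrib Prod.fst Prod.snd 𝕏 with hκ
  have hcomp : 𝕏.map (fun p => (p.2, p.1)) = 𝕎 ⊗ₘ κ := by
    rw [← hX.noise_marginal]
    exact (compProd_map_condDistrib measurable_fst.aemeasurable).symm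
  have hswap : (𝕎 ⊗ₘ κ).map (fun q => (q.2, q.1)) = 𝕏 := by
    rw [← hcomp, Measure.map_map (by fun_prop) (by fun_prop)]
    exact Measure.map_id
  set F : PathSpace 2 1 × PathSpace 2 1 × PathSpace 2 1 →
    PathSpace 2 1 × PathSpace 2 1 × PathSpace 2 1 := fun q => (q.2.1, q.2.2, q.1) with hF
  have hFm : Measurable F := by fun_prop
  set 𝕐 := (𝕎 ⊗ₘ (κ ×ₖ κ)).map F with h𝕐
  have hprob : IsProbabilityMeasure 𝕐 := Measure.isProbabilityMeasure_map hFm.aemeasurable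
  have e1 : 𝕐.map (fun p => (p.1, p.2.2)) = 𝕏 := by
    have h1 : 𝕎 ⊗ₘ κ = (𝕎 ⊗ₘ (κ ×ₖ κ)).map (Prod.map id Prod.fst) := by
      rw [← Measure.compProd_map measurable_fst, ← Kernel.fst_eq, Kernel.fst_prod]
    rw [← hswap, h1, h𝕐, Measure.map_map (by fun_prop) hFm,
      Measure.map_map (by fun_prop) (by fun_prop)]
    rfl
  have e2 : 𝕐.map (fun p => p.2) = 𝕏 := by
    have h1 : 𝕎 ⊗ₘ κ = (𝕎 ⊗ₘ (κ ×ₖ κ)).map (Prod.map id Prod.snd) := by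
      rw [← Measure.compProd_map measurable_snd, ← Kernel.snd_eq, Kernel.snd_prod]
    rw [← hswap, h1, h𝕐, Measure.map_map (by fun_prop) hFm,
      Measure.map_map (by fun_prop) (by fun_prop)]
    rfl
  refine ⟨𝕐, hprob, hX.congr e1, hX.congr e2, fun hae => ?_⟩
  have h1 := Measure.ae_ae_of_ae_compProd (ae_of_ae_map hFm.aemeasurable hae)
  obtain ⟨w, hw, hw1⟩ := (h.and h1).exists
  rw [Kernel.prod_apply] at hw1
  obtain ⟨X₁, hX₁⟩ := (Measure.ae_ae_of_ae_prod hw1).exists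
  exact hw ε hε0 hε (restrictPath hε X₁) (hX₁.mono fun _ h => h.symm)

/-- If the shears mix for the noise path `w`, the equation driven by `w` has several solutions on
every initial interval. -/
theorem nontrivial_solutions_of_shearsMix {b : ℝ → ℝ} (hbm : Measurable b) (hb : ∀ t, |b t| ≤ 1)
    {w : PathSpace 2 1} (hmix : ∃ m, ShearsMixFrom (shearAmp b w) m) (y : Eucl 2) {ε : ℝ}
    (hε0 : 0 < ε) (hε : ε ≤ 1) :
    {X : PathSpace 2 ε | IsCaratheodorySolution hε0.le (shearField b) y
      (restrictPath hε w) X}.Nontrivial := by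
  -- With a Dirac mass as noise law, the conditional law is a probability measure on the solutions
  -- driven by this single path w.
  obtain ⟨𝕏, h𝕏, hweak, hspread⟩ := exists_isWeakSolution_spread hbm hb
    (𝕎 := Measure.dirac w) (by rw [ae_dirac_eq]; exact hmix) y
  have h := condSpread_of_phaseSpread hspread
  set κ := condDistrib Prod.fst Prod.snd 𝕏 with hκ
  have hcomp : 𝕏.map (fun p => (p.2, p.1)) = Measure.dirac w ⊗ₘ κ := by
    rw [← hweak.noise_marginal]
    exact (compProd_map_condDistrib measurable_fst.aemeasurable).symm
  have hswap : (Measure.dirac w ⊗ₘ κ).map (fun q => (q.2, q.1)) = 𝕏 := by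
    rw [← hcomp, Measure.map_map (by fun_prop) (by fun_prop)]
    exact Measure.map_id
  have hsol := hweak.solves
  rw [← hswap] at hsol
  have h1 := Measure.ae_ae_of_ae_compProd (ae_of_ae_map
    (measurable_snd.prodMk measurable_fst).aemeasurable hsol)
  rw [ae_dirac_eq] at h1
  rw [CondSpread, ae_dirac_eq] at h
  have h2 : ∀ᵐ X ∂κ w, IsCaratheodorySolution zero_le_one (shearField b) y w X := h1
  have h3 : ∀ x₀ : PathSpace 2 ε, ¬ ∀ᵐ X ∂κ w, restrictPath hε X = x₀ := h ε hε0 hε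
  obtain ⟨X₁, hX₁⟩ := h2.exists
  obtain ⟨X₂, hne, hX₂⟩ := ((not_eventually.1 (h3 (restrictPath hε X₁))).and_eventually h2).exists
  exact ⟨_, hX₂.restrictPath hε0.le hε, _, hX₁.restrictPath hε0.le hε, hne⟩

/-! ### Linear combinations of independent Gaussian variables -/

/-- The law of independent standard Gaussian variables indexed by `ℕ × ℕ`. -/
def gaussField : Measure (ℕ × ℕ → ℝ) := Measure.infinitePi fun _ => gaussianReal 0 1

instance : IsProbabilityMeasure gaussField := by
  unfold gaussField
  infer_instance

lemma gaussField_map_eval (p : ℕ × ℕ) : gaussField.map (fun ω => ω p) = gaussianReal 0 1 :=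
  Measure.infinitePi_map_eval _ p

lemma gaussField_map_sum (k N : ℕ) (r : ℕ → ℝ) :
    gaussField.map (fun ω => ∑ j ∈ Finset.range N, r j * ω (k, j))
      = gaussianReal 0 (∑ j ∈ Finset.range N, r j ^ 2).toNNReal := by
  set X : Fin N → (ℕ × ℕ → ℝ) → ℝ := fun j ω => r j * ω (k, j) with hX
  have hmap : ∀ j, gaussField.map (X j) = gaussianReal 0 (r j ^ 2).toNNReal := fun j => by
    have h1 := gaussianReal_map_const_mul (μ := 0) (v := 1) (r j)
    rw [mul_zero, mul_one, ← gaussField_map_eval (k, j),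
      Measure.map_map (by fun_prop) (by fun_prop)] at h1
    rw [show (r j ^ 2).toNNReal = .mk (r j ^ 2) (sq_nonneg _) from
      NNReal.coe_injective (Real.coe_toNNReal _ (sq_nonneg _))]
    exact h1
  have hXm : ∀ j, Measurable (X j) := fun j => by fun_prop
  have hg : ∀ j, HasGaussianLaw (X j) gaussField := fun j =>
    ⟨by rw [hmap j]; infer_instance⟩
  have hind : iIndepFun X gaussField := by
    have h1 : iIndepFun (fun (i : ℕ × ℕ) (ω : ℕ × ℕ → ℝ) => r i.2 * ω i) gaussField :=
      iIndepFun_infinitePi (X := fun (i : ℕ × ℕ) x => r i.2 * x) fun i => by fun_prop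
    exact h1.precomp (g := fun j : Fin N => (k, (j : ℕ))) fun i j h => by simpa [Fin.ext_iff] using h
  have hmean : ∀ j, ∫ ω, X j ω ∂gaussField = 0 := fun j => by
    have := integral_map (μ := gaussField) (hXm j).aemeasurable (f := fun x : ℝ => x)
      measurable_id.aestronglyMeasurable
    rw [← this, hmap, integral_id_gaussianReal]
  have hvar : ∀ j, Var[X j; gaussField] = r j ^ 2 := fun j => by
    have := variance_id_map (μ := gaussField) (hXm j).aemeasurable
    rw [← this, hmap, variance_id_gaussianReal, Real.coe_toNNReal _ (sq_nonneg _)]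
  have e : (fun ω : ℕ × ℕ → ℝ => ∑ j ∈ Finset.range N, r j * ω (k, j)) = ∑ j, X j := by
    ext ω
    rw [Finset.sum_apply, Finset.sum_range]
  rw [e, (hind.hasGaussianLaw_sum hg).map_eq_gaussianReal]
  congr 1
  · simp only [Finset.sum_apply]
    rw [integral_finsetSum _ fun j _ => (hg j).integrable]
    simp [hmean]
  · rw [IndepFun.variance_sum (fun j _ => (hg j).memLp_two) fun i _ j _ hij => hind.indepFun hij]
    simp [hvar, Finset.sum_range]

/-- The density is at most 1/(2s), because √(2πv) ≥ 2s, and the interval has length 2ρ. -/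
lemma gaussianReal_abs_le (v : ℝ≥0) {s ρ : ℝ} (hs : 0 < s) (hv : s ^ 2 ≤ v) :
    gaussianReal 0 v {x | |x| ≤ ρ} ≤ ENNReal.ofReal (ρ / s) := by
  have hv0 : 0 < (v : ℝ) := lt_of_lt_of_le (by positivity) hv
  have hset : {x : ℝ | |x| ≤ ρ} = Icc (-ρ) ρ := by ext x; simp [abs_le]
  rcases lt_or_ge ρ 0 with hρ | hρ
  · rw [hset, Icc_eq_empty (by linarith)]
    simp
  rw [gaussianReal_apply _ (fun h => by simp [h] at hv0), hset]
  have hpdf : ∀ x, gaussianPDF 0 v x ≤ ENNReal.ofReal (1 / (2 * s)) := fun x => by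
    refine ENNReal.ofReal_le_ofReal ?_
    rw [gaussianPDFReal]
    have h1 : Real.exp (-(x - 0) ^ 2 / (2 * v)) ≤ 1 := Real.exp_le_one_iff.2 <|
      div_nonpos_of_nonpos_of_nonneg (neg_nonpos.2 (sq_nonneg _)) (by positivity)
    have h2 : 2 * s ≤ √(2 * Real.pi * v) := by
      refine Real.le_sqrt_of_sq_le ?_
      nlinarith [Real.pi_gt_three]
    calc (√(2 * Real.pi * v))⁻¹ * Real.exp (-(x - 0) ^ 2 / (2 * v))
        ≤ (√(2 * Real.pi * v))⁻¹ * 1 := by gcongr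
      _ ≤ 1 / (2 * s) := by
        rw [mul_one, one_div]
        gcongr
  refine (lintegral_mono hpdf).trans ?_
  rw [setLIntegral_const, Real.volume_Icc, ← ENNReal.ofReal_mul (by positivity)]
  refine ENNReal.ofReal_le_ofReal (le_of_eq ?_)
  field_simp
  ring

lemma gaussianReal_le_abs (v : ℝ≥0) {ρ : ℝ} (hρ : 0 < ρ) :
    gaussianReal 0 v {x | ρ ≤ |x|} ≤ ENNReal.ofReal (v / ρ ^ 2) := by
  have h := meas_ge_le_variance_div_sq (μ := gaussianReal 0 v) (X := id)
    (memLp_id_gaussianReal 2) hρ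
  simpa [integral_id_gaussianReal, variance_id_gaussianReal] using h

/-- Chernoff bound at t = 1 and t = -1, with exp(1/2) ≤ 2. -/
lemma gaussianReal_lt_abs_le (M : ℝ) :
    gaussianReal 0 1 {x | M < |x|} ≤ ENNReal.ofReal (4 * Real.exp (-M)) := by
  have hmgf : ∀ t : ℝ, mgf id (gaussianReal 0 1) t = Real.exp (t ^ 2 / 2) := fun t => by
    rw [mgf_gaussianReal (μ := 0) (v := 1) Measure.map_id]
    simp
  have hexp : Real.exp (1 / 2) ≤ 2 := by
    have h1 : Real.exp (1 / 2) ^ 2 = Real.exp 1 := by rw [← Real.exp_nat_mul]; norm_num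
    have h2 := Real.exp_one_lt_d9
    nlinarith [Real.exp_pos (1 / 2)]
  have h1 : (gaussianReal 0 1).real {x | M ≤ id x} ≤ 2 * Real.exp (-M) := by
    refine (measure_ge_le_exp_mul_mgf (μ := gaussianReal 0 1) (X := id) (t := 1) M zero_le_one
      (by simpa using integrable_exp_mul_gaussianReal (μ := 0) (v := 1) 1)).trans ?_
    rw [hmgf]
    have := Real.exp_pos (-M)
    norm_num
    nlinarith
  have h2 : (gaussianReal 0 1).real {x | id x ≤ -M} ≤ 2 * Real.exp (-M) := by
    refine (measure_le_le_exp_mul_mgf (μ := gaussianReal 0 1) (X := id) (t := -1) (-M) (by norm_num)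
      (by simpa using integrable_exp_mul_gaussianReal (μ := 0) (v := 1) (-1))).trans ?_
    rw [hmgf]
    have := Real.exp_pos (-M)
    norm_num
    nlinarith
  have hsub : {x : ℝ | M < |x|} ⊆ {x | M ≤ id x} ∪ {x | id x ≤ -M} := fun x hx => by
    rcases lt_abs.1 (show M < |x| from hx) with h | h
    · exact Or.inl h.le
    · exact Or.inr (by simp only [mem_ofPred_eq, id]; linarith)
  have h3 := (measureReal_mono (μ := gaussianReal 0 1) hsub).trans (measureReal_union_le _ _)
  rw [← ofReal_measureReal]
  exact ENNReal.ofReal_le_ofReal (by linarith)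

lemma gaussField_exists_lt_abs_le (k N : ℕ) (M : ℝ) :
    gaussField {ω | ∃ j < N, M < |ω (k, j)|} ≤ ENNReal.ofReal (N * (4 * Real.exp (-M))) := by
  have e : {ω : ℕ × ℕ → ℝ | ∃ j < N, M < |ω (k, j)|}
      = ⋃ j ∈ Finset.range N, {ω | M < |ω (k, j)|} := by
    ext ω; simp
  rw [e]
  refine (measure_biUnion_finset_le _ _).trans ?_
  have h : ∀ j ∈ Finset.range N, gaussField {ω | M < |ω (k, j)|}
      ≤ ENNReal.ofReal (4 * Real.exp (-M)) := fun j _ => by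
    have h1 := Measure.map_apply (μ := gaussField) (f := fun ω => ω (k, j)) (by fun_prop)
      (measurableSet_lt measurable_const measurable_id.abs : MeasurableSet {x : ℝ | M < |x|})
    rw [gaussField_map_eval] at h1
    refine le_trans (le_of_eq h1.symm) (gaussianReal_lt_abs_le M)
  refine (Finset.sum_le_sum h).trans (le_of_eq ?_)
  rw [Finset.sum_const, Finset.card_range, nsmul_eq_mul, ENNReal.ofReal_mul (Nat.cast_nonneg N),
    ENNReal.ofReal_natCast]

lemma gaussField_abs_sum_le (k N : ℕ) (r : ℕ → ℝ) {s ρ : ℝ} (hs : 0 < s)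
    (hv : s ^ 2 ≤ ∑ j ∈ Finset.range N, r j ^ 2) :
    gaussField {ω | |∑ j ∈ Finset.range N, r j * ω (k, j)| ≤ ρ} ≤ ENNReal.ofReal (ρ / s) := by
  have h1 := Measure.map_apply (μ := gaussField)
    (f := fun ω => ∑ j ∈ Finset.range N, r j * ω (k, j)) (by fun_prop)
    (measurableSet_le measurable_id.abs measurable_const : MeasurableSet {x : ℝ | |x| ≤ ρ})
  rw [gaussField_map_sum] at h1
  refine le_trans (le_of_eq h1.symm) (gaussianReal_abs_le _ hs ?_)
  rwa [Real.coe_toNNReal _ (Finset.sum_nonneg fun _ _ => sq_nonneg _)]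

lemma gaussField_le_abs_sum (k N : ℕ) (r : ℕ → ℝ) {ρ : ℝ} (hρ : 0 < ρ) :
    gaussField {ω | ρ ≤ |∑ j ∈ Finset.range N, r j * ω (k, j)|}
      ≤ ENNReal.ofReal ((∑ j ∈ Finset.range N, r j ^ 2) / ρ ^ 2) := by
  have h1 := Measure.map_apply (μ := gaussField)
    (f := fun ω => ∑ j ∈ Finset.range N, r j * ω (k, j)) (by fun_prop)
    (measurableSet_le measurable_const measurable_id.abs : MeasurableSet {x : ℝ | ρ ≤ |x|})
  rw [gaussField_map_sum] at h1
  refine le_trans (le_of_eq h1.symm) ((gaussianReal_le_abs _ hρ).trans (le_of_eq ?_))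
  rw [Real.coe_toNNReal _ (Finset.sum_nonneg fun _ _ => sq_nonneg _)]

/-- The random combination `∑ⱼ gⱼ cⱼ` of complex numbers. -/
def gaussComb (c : ℕ → ℂ) (k N : ℕ) (ω : ℕ × ℕ → ℝ) : ℂ :=
  ∑ j ∈ Finset.range N, (ω (k, j) : ℂ) * c j

lemma gaussComb_re (c : ℕ → ℂ) (k N : ℕ) (ω : ℕ × ℕ → ℝ) :
    (gaussComb c k N ω).re = ∑ j ∈ Finset.range N, (c j).re * ω (k, j) := by
  rw [gaussComb, Complex.re_sum]
  exact Finset.sum_congr rfl fun j _ => by simp [mul_comm]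

lemma gaussComb_im (c : ℕ → ℂ) (k N : ℕ) (ω : ℕ × ℕ → ℝ) :
    (gaussComb c k N ω).im = ∑ j ∈ Finset.range N, (c j).im * ω (k, j) := by
  rw [gaussComb, Complex.im_sum]
  exact Finset.sum_congr rfl fun j _ => by simp [mul_comm]

lemma sum_re_sq_add_sum_im_sq (c : ℕ → ℂ) (N : ℕ) :
    ∑ j ∈ Finset.range N, (c j).re ^ 2 + ∑ j ∈ Finset.range N, (c j).im ^ 2
      = ∑ j ∈ Finset.range N, ‖c j‖ ^ 2 := by
  rw [← Finset.sum_add_distrib]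
  exact Finset.sum_congr rfl fun j _ => by rw [Complex.sq_norm, Complex.normSq_apply]; ring

/-- The real or the imaginary part carries at least half of the square sum; the one-dimensional
small-ball bound for that part is enough. -/
lemma gaussField_norm_gaussComb_le (c : ℕ → ℂ) (k N : ℕ) {s ρ : ℝ} (hs : 0 < s)
    (hc : 2 * s ^ 2 ≤ ∑ j ∈ Finset.range N, ‖c j‖ ^ 2) :
    gaussField {ω | ‖gaussComb c k N ω‖ ≤ ρ} ≤ ENNReal.ofReal (ρ / s) := by
  rw [← sum_re_sq_add_sum_im_sq] at hc
  rcases le_or_gt (s ^ 2) (∑ j ∈ Finset.range N, (c j).re ^ 2) with h | h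
  · refine (measure_mono fun ω hω => ?_).trans (gaussField_abs_sum_le k N (fun j => (c j).re) hs h)
    rw [mem_ofPred_eq, ← gaussComb_re]
    exact (Complex.abs_re_le_norm _).trans hω
  · refine (measure_mono fun ω hω => ?_).trans
      (gaussField_abs_sum_le k N (fun j => (c j).im) hs (by linarith))
    rw [mem_ofPred_eq, ← gaussComb_im]
    exact (Complex.abs_im_le_norm _).trans hω

lemma gaussField_le_norm_gaussComb (c : ℕ → ℂ) (k N : ℕ) {ρ : ℝ} (hρ : 0 < ρ) :
    gaussField {ω | ρ ≤ ‖gaussComb c k N ω‖}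
      ≤ ENNReal.ofReal (4 * (∑ j ∈ Finset.range N, ‖c j‖ ^ 2) / ρ ^ 2) := by
  have hsub : {ω | ρ ≤ ‖gaussComb c k N ω‖}
      ⊆ {ω | ρ / 2 ≤ |∑ j ∈ Finset.range N, (c j).re * ω (k, j)|} ∪
        {ω | ρ / 2 ≤ |∑ j ∈ Finset.range N, (c j).im * ω (k, j)|} := by
    intro ω hω
    by_contra hn
    simp only [mem_union, mem_ofPred_eq, not_or, not_le] at hn
    rw [← gaussComb_re, ← gaussComb_im] at hn
    have h1 := Complex.norm_le_abs_re_add_abs_im (gaussComb c k N ω)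
    have h2 : ρ ≤ ‖gaussComb c k N ω‖ := hω
    linarith [hn.1, hn.2]
  refine (measure_mono hsub).trans ((measure_union_le _ _).trans ?_)
  refine (add_le_add (gaussField_le_abs_sum k N _ (half_pos hρ))
    (gaussField_le_abs_sum k N _ (half_pos hρ))).trans ?_
  rw [← ENNReal.ofReal_add (by positivity) (by positivity), ← sum_re_sq_add_sum_im_sq]
  refine ENNReal.ofReal_le_ofReal (le_of_eq ?_)
  field_simp
  ring

/-! ### Subdivision of a stage into cells -/

/-- The left endpoint of the `j`-th of `N` equal cells of the interval `[L, 2L]`. -/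
def cellTime (L : ℝ) (N j : ℕ) : ℝ := L * (1 + j / N)

/-- The index of the cell containing `t`. -/
def cellIndex (L : ℝ) (N : ℕ) (t : ℝ) : ℕ := ⌊(t / L - 1) * N⌋₊

/-- The integral over the `j`-th cell of a unit complex number with phase `φ`. -/
def cellAmp (L : ℝ) (N : ℕ) (φ : ℝ → ℝ) (j : ℕ) : ℂ :=
  ∫ s in cellTime L N j..cellTime L N (j + 1), Complex.exp ((φ s : ℝ) * Complex.I)

/-- The mean oscillation of a phase over the cells. -/
def cellOsc (L : ℝ) (N : ℕ) (φ : ℝ → ℝ) : ℝ :=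
  ∫ s in L..2 * L, |φ s - φ (cellTime L N (cellIndex L N s))|

lemma measurable_cellIndex (L : ℝ) (N : ℕ) : Measurable (cellIndex L N) :=
  Nat.measurable_floor.comp (by fun_prop)

lemma measurable_cellTime_cellIndex (L : ℝ) (N : ℕ) :
    Measurable fun s => cellTime L N (cellIndex L N s) :=
  (measurable_from_top (f := fun j : ℕ => cellTime L N j)).comp (measurable_cellIndex L N)

lemma cellTime_zero (L : ℝ) (N : ℕ) : cellTime L N 0 = L := by simp [cellTime]

lemma cellTime_self (L : ℝ) {N : ℕ} (hN : 0 < N) : cellTime L N N = 2 * L := by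
  have : (N : ℝ) ≠ 0 := by positivity
  rw [cellTime, div_self this]
  ring

lemma cellTime_succ_sub (L : ℝ) (N j : ℕ) : cellTime L N (j + 1) - cellTime L N j = L / N := by
  unfold cellTime
  push_cast
  ring

lemma cellTime_le_succ {L : ℝ} (hL : 0 < L) (N j : ℕ) :
    cellTime L N j ≤ cellTime L N (j + 1) := by
  rw [← sub_nonneg, cellTime_succ_sub]
  positivity

lemma cellIndex_eq {L : ℝ} (hL : 0 < L) {N j : ℕ} (hN : 0 < N) {t : ℝ}
    (ht : t ∈ Ico (cellTime L N j) (cellTime L N (j + 1))) : cellIndex L N t = j := by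
  have hN' : (0 : ℝ) < N := by positivity
  rw [cellTime, cellTime] at ht
  have h1 : (1 + j / N : ℝ) ≤ t / L := by rw [le_div_iff₀ hL, mul_comm]; exact ht.1
  have h2 : t / L < (1 + (j + 1 : ℕ) / N : ℝ) := by rw [div_lt_iff₀ hL, mul_comm _ L]; exact ht.2
  have h3 : (j : ℝ) ≤ (t / L - 1) * N := by
    rw [← div_le_iff₀ hN']; linarith
  have h4 : (t / L - 1) * N < j + 1 := by
    rw [← lt_div_iff₀ hN']
    push_cast at h2
    linarith
  exact (Nat.floor_eq_iff (le_trans (Nat.cast_nonneg j) h3)).2 ⟨h3, h4⟩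

lemma cellTime_cellIndex_le {L : ℝ} (hL : 0 < L) {N : ℕ} (hN : 0 < N) {t : ℝ} (ht : L ≤ t) :
    cellTime L N (cellIndex L N t) ≤ t ∧ L ≤ cellTime L N (cellIndex L N t) ∧
      t - cellTime L N (cellIndex L N t) ≤ L / N := by
  have hN' : (0 : ℝ) < N := by positivity
  have h0 : 0 ≤ (t / L - 1) * N := by
    have : 1 ≤ t / L := by rwa [le_div_iff₀ hL, one_mul]
    exact mul_nonneg (by linarith) hN'.le
  have h1 : (cellIndex L N t : ℝ) ≤ (t / L - 1) * N := Nat.floor_le h0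
  have h2 : (t / L - 1) * N < (cellIndex L N t : ℝ) + 1 := Nat.lt_floor_add_one _
  have e : t = L * (t / L) := by field_simp
  refine ⟨?_, ?_, ?_⟩
  · rw [← div_le_iff₀ hN'] at h1
    conv_rhs => rw [e]
    exact mul_le_mul_of_nonneg_left (by linarith) hL.le
  · rw [cellTime]
    have : (0 : ℝ) ≤ cellIndex L N t / N := by positivity
    nlinarith
  · rw [← lt_div_iff₀ hN', add_div] at h2
    have h3 : L * (t / L) ≤ L * (1 + (cellIndex L N t / N + 1 / N)) :=
      mul_le_mul_of_nonneg_left (by linarith) hL.le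
    rw [← e] at h3
    rw [cellTime]
    have : L * (1 + (cellIndex L N t / N + 1 / N : ℝ)) = L * (1 + cellIndex L N t / N) + L / N := by
      ring
    linarith

lemma sum_integral_cells {E : Type*} [NormedAddCommGroup E] [NormedSpace ℝ E] {L : ℝ} {N : ℕ}
    (hN : 0 < N) {f : ℝ → E} (hf : ∀ s t, IntervalIntegrable f volume s t) :
    ∑ j ∈ Finset.range N, ∫ s in cellTime L N j..cellTime L N (j + 1), f s
      = ∫ s in L..2 * L, f s := by
  rw [intervalIntegral.sum_integral_adjacent_intervals fun j _ => hf _ _, cellTime_zero,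
    cellTime_self L hN]

lemma norm_cellAmp_le {L : ℝ} (hL : 0 < L) (N : ℕ) (φ : ℝ → ℝ) (j : ℕ) :
    ‖cellAmp L N φ j‖ ≤ L / N := by
  have h := intervalIntegral.norm_integral_le_of_norm_le_const (a := cellTime L N j)
    (b := cellTime L N (j + 1)) (f := fun s => Complex.exp ((φ s : ℝ) * Complex.I)) (C := 1)
    fun s _ => (Complex.norm_exp_ofReal_mul_I _).le
  rwa [cellTime_succ_sub, one_mul, abs_of_nonneg (by positivity)] at h

lemma sum_sq_norm_cellAmp_le {L : ℝ} (hL : 0 < L) {N : ℕ} (hN : 0 < N) (φ : ℝ → ℝ) :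
    ∑ j ∈ Finset.range N, ‖cellAmp L N φ j‖ ^ 2 ≤ L ^ 2 / N := by
  have hN' : (0 : ℝ) < N := by positivity
  calc ∑ j ∈ Finset.range N, ‖cellAmp L N φ j‖ ^ 2 ≤ ∑ j ∈ Finset.range N, (L / N) ^ 2 :=
        Finset.sum_le_sum fun j _ => pow_le_pow_left₀ (norm_nonneg _) (norm_cellAmp_le hL N φ j) 2
    _ = L ^ 2 / N := by
        rw [Finset.sum_const, Finset.card_range, nsmul_eq_mul]
        field_simp

lemma intervalIntegrable_cellOsc {φ : ℝ → ℝ} (hφ : Continuous φ) {C : ℝ} (hC : ∀ s, |φ s| ≤ C)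
    (L : ℝ) (N : ℕ) (s t : ℝ) :
    IntervalIntegrable (fun s => |φ s - φ (cellTime L N (cellIndex L N s))|) volume s t := by
  refine (intervalIntegrable_const (c := C + C)).mono_fun' ?_ (Eventually.of_forall fun s => ?_)
  · exact ((hφ.measurable.sub (hφ.measurable.comp
      (measurable_cellTime_cellIndex L N))).abs).aestronglyMeasurable
  · simp only [Real.norm_eq_abs, abs_abs]
    exact (abs_sub _ _).trans (add_le_add (hC _) (hC _))

/-- On a cell the integrand stays close to its value at the left endpoint, so the cell integral
falls short of L/N in modulus by at most the oscillation on that cell. Only the total oscillation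
matters, which allows a few bad cells. -/
lemma le_sum_sq_norm_cellAmp {φ : ℝ → ℝ} (hφ : Continuous φ) {C : ℝ} (hC : ∀ s, |φ s| ≤ C)
    {L : ℝ} (hL : 0 < L) {N : ℕ} (hN : 0 < N) (hosc : cellOsc L N φ ≤ L / 4) :
    L ^ 2 / (2 * N) ≤ ∑ j ∈ Finset.range N, ‖cellAmp L N φ j‖ ^ 2 := by
  have hN' : (0 : ℝ) < N := by positivity
  set D : ℕ → ℝ := fun j => ∫ s in cellTime L N j..cellTime L N (j + 1),
    |φ s - φ (cellTime L N (cellIndex L N s))| with hD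
  have hDsum : ∑ j ∈ Finset.range N, D j = cellOsc L N φ :=
    sum_integral_cells hN (intervalIntegrable_cellOsc hφ hC L N)
  have hcexp : Continuous fun s => Complex.exp ((φ s : ℝ) * Complex.I) := by fun_prop
  have h1 : ∀ j, L / N - D j ≤ ‖cellAmp L N φ j‖ := by
    intro j
    have hD' : D j = ∫ s in cellTime L N j..cellTime L N (j + 1), |φ s - φ (cellTime L N j)| := by
      refine intervalIntegral.integral_congr_Ioo_of_le (cellTime_le_succ hL N j) fun s hs => ?_
      simp only [cellIndex_eq hL hN (Ioo_subset_Ico_self hs)]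
    set z := Complex.exp ((φ (cellTime L N j) : ℝ) * Complex.I) with hz
    have h2 : cellAmp L N φ j - (L / N : ℝ) • z = ∫ s in cellTime L N j..cellTime L N (j + 1),
        (Complex.exp ((φ s : ℝ) * Complex.I) - z) := by
      rw [intervalIntegral.integral_sub (hcexp.intervalIntegrable _ _)
        intervalIntegrable_const, intervalIntegral.integral_const, cellTime_succ_sub]
      rfl
    have h3 : ‖cellAmp L N φ j - (L / N : ℝ) • z‖ ≤ D j := by
      rw [h2, hD']
      refine intervalIntegral.norm_integral_le_of_norm_le (cellTime_le_succ hL N j) ?_ ?_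
      · exact Eventually.of_forall fun s _ => norm_exp_sub_exp_le _ _
      · exact Continuous.intervalIntegrable (by fun_prop) _ _
    have h4 : ‖(L / N : ℝ) • z‖ = L / N := by
      rw [norm_smul, hz, Complex.norm_exp_ofReal_mul_I, mul_one, Real.norm_eq_abs,
        abs_of_pos (by positivity)]
    have h5 := norm_sub_norm_le ((L / N : ℝ) • z) (cellAmp L N φ j)
    rw [norm_sub_rev, h4] at h5
    linarith
  -- Expanding (‖c_j‖ - L/N)² ≥ 0 linearizes the square, whatever the sign of L/N - D_j.
  have h6 : ∀ j, (L / N) ^ 2 - 2 * (L / N) * D j ≤ ‖cellAmp L N φ j‖ ^ 2 := by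
    intro j
    have h7 := h1 j
    have h8 : 0 < L / N := by positivity
    nlinarith [sq_nonneg (‖cellAmp L N φ j‖ - L / N)]
  calc L ^ 2 / (2 * N) = L ^ 2 / N - 2 * (L / N) * (L / 4) := by field_simp; ring
    _ ≤ L ^ 2 / N - 2 * (L / N) * cellOsc L N φ := by gcongr
    _ = ∑ j ∈ Finset.range N, ((L / N) ^ 2 - 2 * (L / N) * D j) := by
      rw [Finset.sum_sub_distrib, ← Finset.mul_sum, hDsum, Finset.sum_const, Finset.card_range,
        nsmul_eq_mul]
      field_simp
    _ ≤ _ := Finset.sum_le_sum fun j _ => h6 j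

/-! ### The random amplitude -/

/-- The scale of the amplitude during the `k`-th stage. -/
def ampScale (α : ℝ) (k : ℕ) : ℝ := shearFreq k ^ (-α) / (8 * (k + 1) ^ 4)

/-- The level at which the Gaussian variables of the `k`-th stage are truncated. -/
def clampLevel (k : ℕ) : ℝ := 4 * (k + 1) ^ 4

/-- The ratio of the size of the `k`-th shear without cancellations to the size needed. -/
def ampRatio (α : ℝ) (k : ℕ) : ℝ :=
  ampScale α k * (1 / 2) ^ (k + 1) * shearFreq (k - 1) / 16 ^ k

/-- The number of cells in the `k`-th stage. -/
def cellCount (α : ℝ) (k : ℕ) : ℕ := ⌈ampRatio α k ^ 2⌉₊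

/-- The random amplitude: on each cell of each stage, an independent truncated Gaussian. -/
def randAmp (α : ℝ) (ω : ℕ × ℕ → ℝ) (t : ℝ) : ℝ :=
  ampScale α (stage t) * max (-clampLevel (stage t)) (min (clampLevel (stage t))
    (ω (stage t, cellIndex ((1 / 2) ^ (stage t + 1)) (cellCount α (stage t)) t)))

lemma ampScale_pos (α : ℝ) (k : ℕ) : 0 < ampScale α k := by
  have := shearFreq_pos k
  unfold ampScale
  positivity

lemma ampRatio_pos (α : ℝ) (k : ℕ) : 0 < ampRatio α k := by
  have := shearFreq_pos (k - 1)
  have := ampScale_pos α k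
  unfold ampRatio
  positivity

lemma cellCount_pos (α : ℝ) (k : ℕ) : 0 < cellCount α k :=
  Nat.ceil_pos.2 (pow_pos (ampRatio_pos α k) 2)

lemma abs_clamp_le {M : ℝ} (hM : 0 ≤ M) (x : ℝ) : |max (-M) (min M x)| ≤ M :=
  abs_le.2 ⟨le_max_left _ _, max_le (by linarith) (min_le_left _ _)⟩

/-- The factors (k + 1)^4 in `ampScale` and `clampLevel` cancel: truncation yields a sure bound, at
a cost polynomial in k. -/
lemma abs_randAmp_le (α : ℝ) (ω : ℕ × ℕ → ℝ) (t : ℝ) :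
    |randAmp α ω t| ≤ shearFreq (stage t) ^ (-α) / 2 := by
  unfold randAmp
  rw [abs_mul, abs_of_pos (ampScale_pos α _)]
  refine (mul_le_mul_of_nonneg_left (abs_clamp_le (by unfold clampLevel; positivity) _)
    (ampScale_pos α _).le).trans (le_of_eq ?_)
  unfold ampScale clampLevel
  field_simp
  ring

lemma abs_randAmp_le_one {α : ℝ} (hα : 0 ≤ α) (ω : ℕ × ℕ → ℝ) (t : ℝ) : |randAmp α ω t| ≤ 1 := by
  have h := abs_randAmp_le α ω t
  have h1 : shearFreq (stage t) ^ (-α) ≤ 1 :=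
    Real.rpow_le_one_of_one_le_of_nonpos (one_le_shearFreq _) (by linarith)
  linarith

lemma measurable_eval_countable {ι : Type*} [Countable ι] [MeasurableSpace ι]
    [MeasurableSingletonClass ι] : Measurable fun q : (ι → ℝ) × ι => q.1 q.2 :=
  measurable_from_prod_countable_left fun y => measurable_pi_apply y

lemma measurable_cell (α : ℝ) :
    Measurable fun t => cellIndex ((1 / 2) ^ (stage t + 1)) (cellCount α (stage t)) t := by
  have h : Measurable fun q : ℕ × ℝ => cellIndex ((1 / 2) ^ (q.1 + 1)) (cellCount α q.1) q.2 :=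
    measurable_from_prod_countable_right fun k =>
      measurable_cellIndex ((1 / 2) ^ (k + 1)) (cellCount α k)
  exact h.comp (measurable_stage.prodMk measurable_id)

lemma measurable_randAmp (α : ℝ) : Measurable fun p : (ℕ × ℕ → ℝ) × ℝ => randAmp α p.1 p.2 := by
  have hc : ∀ f : ℕ → ℝ, Measurable fun p : (ℕ × ℕ → ℝ) × ℝ => f (stage p.2) := fun f =>
    measurable_from_top.comp (measurable_stage.comp measurable_snd)
  have h4 := measurable_eval_countable.comp (measurable_fst (α := ℕ × ℕ → ℝ).prodMk
    ((measurable_stage.prodMk (measurable_cell α)).comp measurable_snd))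
  exact (hc (ampScale α)).mul ((hc fun k => -clampLevel k).max ((hc clampLevel).min h4))

/-- When no truncation is active, the amplitude is a Gaussian constant on each cell and comes out of
the cell integral. -/
lemma shearAmp_randAmp {α : ℝ} (hα : 0 ≤ α) {ω : ℕ × ℕ → ℝ} {k : ℕ}
    (hω : ∀ j < cellCount α k, |ω (k, j)| ≤ clampLevel k) (w : PathSpace 2 1) :
    shearAmp (randAmp α ω) w k = ampScale α k * gaussComb (cellAmp ((1 / 2) ^ (k + 1))
      (cellCount α k) fun s => shearFreq k * pathIncr w s (shearDir (k + 1))) k (cellCount α k) ω := by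
  set L : ℝ := (1 / 2) ^ (k + 1) with hLdef
  have hL : 0 < L := by positivity
  have h2L : (1 / 2 : ℝ) ^ k = 2 * L := by rw [hLdef, pow_succ]; ring
  have hN := cellCount_pos α k
  set N := cellCount α k with hNdef
  set φ : ℝ → ℝ := fun s => shearFreq k * pathIncr w s (shearDir (k + 1)) with hφ
  have hφc : Continuous φ := by
    have h1 := continuous_pathIncr w
    fun_prop
  have hF : ∀ s t, IntervalIntegrable (fun s => (randAmp α ω s : ℂ) *
      Complex.exp ((φ s : ℝ) * Complex.I)) volume s t := by
    intro s t
    refine (intervalIntegrable_const (c := (1 : ℝ))).mono_fun' ?_ (Eventually.of_forall fun s => ?_)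
    · exact ((Complex.measurable_ofReal.comp
        ((measurable_randAmp α).comp measurable_prodMk_left)).mul
        (by fun_prop)).aestronglyMeasurable
    · simp only [norm_mul, Complex.norm_exp_ofReal_mul_I, mul_one, Complex.norm_real]
      exact abs_randAmp_le_one hα ω s
  rw [shearAmp, h2L, ← sum_integral_cells hN hF, gaussComb, Finset.mul_sum]
  refine Finset.sum_congr rfl fun j hj => ?_
  rw [Finset.mem_range] at hj
  rw [← mul_assoc, cellAmp, ← intervalIntegral.integral_const_mul]
  refine intervalIntegral.integral_congr_Ioo_of_le (cellTime_le_succ hL N j) fun s hs => ?_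
  have hmem : s ∈ Ioc ((1 / 2 : ℝ) ^ (k + 1)) ((1 / 2) ^ k) := by
    rw [← hLdef, h2L]
    have h1 : (0 : ℝ) ≤ j / N := by positivity
    have h2 : ((j + 1 : ℕ) / N : ℝ) ≤ 1 := by
      rw [div_le_one (by positivity)]
      exact_mod_cast hj
    have h3 := hs.1
    have h4 := hs.2
    unfold cellTime at h3 h4
    constructor <;> nlinarith
  have hst := stage_eq hmem
  have hb : randAmp α ω s = ampScale α k * ω (k, j) := by
    unfold randAmp
    rw [hst, cellIndex_eq hL hN (Ioo_subset_Ico_self hs)]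
    have := abs_le.1 (hω j hj)
    rw [min_eq_right this.2, max_eq_right this.1]
  simp only [hb]
  push_cast
  ring

/-! ### Oscillation of fractional Brownian motion -/

lemma IsFBM.memLp_two {d : ℕ} {T H : ℝ} {𝕎 : Measure (PathSpace d T)} (h : IsFBM H 𝕎)
    (t : Icc (0 : ℝ) T) (i : Fin d) : MemLp (fun w : PathSpace d T => w t i) 2 𝕎 :=
  ((h.gaussian.hasGaussianLaw_eval t).map_fun
    (EuclideanSpace.proj i : Eucl d →L[ℝ] ℝ)).memLp_two

/-- The covariance gives the second moment of the increment, and nonnegativity of the variance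
passes from it to the first moment. -/
lemma IsFBM.integral_abs_sub_le {d : ℕ} {T H : ℝ} (hH : 0 < H) {𝕎 : Measure (PathSpace d T)}
    [IsProbabilityMeasure 𝕎] (h : IsFBM H 𝕎) (s t : Icc (0 : ℝ) T) (i : Fin d) :
    ∫ w, |w s i - w t i| ∂𝕎 ≤ |(s : ℝ) - t| ^ H := by
  have hs := h.memLp_two s i
  have ht := h.memLp_two t i
  have hsq : ∫ w, (w s i - w t i) ^ 2 ∂𝕎 = (|(s : ℝ) - t| ^ H) ^ 2 := by
    have e : ∀ w : PathSpace d T, (w s i - w t i) ^ 2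
        = w s i * w s i - (w s i * w t i + w t i * w s i) + w t i * w t i := fun w => by ring
    have hint : ∀ s t : Icc (0 : ℝ) T, Integrable (fun w : PathSpace d T => w s i * w t i) 𝕎 :=
      fun s t => (h.memLp_two s i).integrable_mul (h.memLp_two t i)
    have hint2 : Integrable (fun w : PathSpace d T => w s i * w t i + w t i * w s i) 𝕎 :=
      (hint s t).add (hint t s)
    have hint3 : Integrable (fun w : PathSpace d T =>
      w s i * w s i - (w s i * w t i + w t i * w s i)) 𝕎 := (hint s s).sub hint2
    simp_rw [e]
    rw [integral_add hint3 (hint t t), integral_sub (hint s s) hint2,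
      integral_add (hint s t) (hint t s), h.covariance, h.covariance, h.covariance, h.covariance]
    simp only [if_true, sub_self, abs_zero]
    rw [Real.zero_rpow (by positivity), abs_sub_comm (t : ℝ) s, ← Real.rpow_natCast,
      ← Real.rpow_mul (abs_nonneg _), mul_comm H]
    push_cast
    ring
  have hX : MemLp (fun w : PathSpace d T => |w s i - w t i|) 2 𝕎 := (hs.sub ht).abs
  have hv := variance_nonneg (fun w : PathSpace d T => |w s i - w t i|) 𝕎
  rw [variance_eq_sub hX] at hv
  simp only [Pi.pow_apply, sq_abs] at hv
  rw [hsq] at hv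
  exact le_of_sq_le_sq (by linarith) (by positivity)

lemma IsFBM.lintegral_enorm_sub_le {d : ℕ} {T H : ℝ} (hH : 0 < H) {𝕎 : Measure (PathSpace d T)}
    [IsProbabilityMeasure 𝕎] (h : IsFBM H 𝕎) (s t : Icc (0 : ℝ) T) (i : Fin d) :
    ∫⁻ w, ‖w s i - w t i‖ₑ ∂𝕎 ≤ ENNReal.ofReal (|(s : ℝ) - t| ^ H) := by
  have hi : Integrable (fun w : PathSpace d T => w s i - w t i) 𝕎 :=
    ((h.memLp_two s i).sub (h.memLp_two t i)).integrable one_le_two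
  rw [← ofReal_integral_norm_eq_lintegral_enorm hi]
  exact ENNReal.ofReal_le_ofReal (h.integral_abs_sub_le hH s t i)

lemma pathIncr_sub (w : PathSpace 2 1) (s t : ℝ) (i : Fin 2) :
    pathIncr w s i - pathIncr w t i
      = w (projIcc 0 1 zero_le_one s) i - w (projIcc 0 1 zero_le_one t) i := by
  simp [pathIncr]

/-- Tonelli and Markov: the expected oscillation is at most lam · L · (L/N)^H, as each time is
within L/N of its cell endpoint. No modulus of continuity of the paths is needed. -/
lemma IsFBM.measure_lt_cellOsc_le {H : ℝ} (hH : 0 < H) {𝕎 : Measure (PathSpace 2 1)}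
    [IsProbabilityMeasure 𝕎] (h : IsFBM H 𝕎) {L : ℝ} (hL : 0 < L) (hL1 : 2 * L ≤ 1) {N : ℕ}
    (hN : 0 < N) {lam : ℝ} (hlam : 0 < lam) (i : Fin 2) :
    𝕎 {w | L / 4 < cellOsc L N fun s => lam * pathIncr w s i}
      ≤ ENNReal.ofReal (4 * lam * (L / N) ^ H) := by
  set ρ : ℝ → ℝ := fun s => cellTime L N (cellIndex L N s) with hρ
  have hρm : Measurable ρ := measurable_cellTime_cellIndex L N
  set F : PathSpace 2 1 → ℝ → ℝ := fun w s => pathIncr w s i - pathIncr w (ρ s) i with hF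
  have hFm : Measurable fun p : PathSpace 2 1 × ℝ => F p.1 p.2 :=
    ((measurable_coord i).comp measurable_pathIncr).sub
      ((measurable_coord i).comp
        (measurable_pathIncr.comp (measurable_fst.prodMk (hρm.comp measurable_snd))))
  set G : PathSpace 2 1 → ℝ≥0∞ := fun w => ∫⁻ s in Ioc L (2 * L), ‖F w s‖ₑ with hG
  have hGm : Measurable G := hFm.enorm.lintegral_prod_right'
  have hGint : ∫⁻ w, G w ∂𝕎 ≤ ENNReal.ofReal (L * (L / N) ^ H) := by
    rw [hG, lintegral_lintegral_swap hFm.enorm.aemeasurable]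
    have hb : ∀ s ∈ Ioc L (2 * L), ∫⁻ w, ‖F w s‖ₑ ∂𝕎 ≤ ENNReal.ofReal ((L / N) ^ H) := by
      intro s hs
      obtain ⟨h1, h2, h3⟩ := cellTime_cellIndex_le hL hN hs.1.le
      have hs01 : s ∈ Icc (0 : ℝ) 1 := ⟨hL.le.trans hs.1.le, hs.2.trans hL1⟩
      have hρ01 : ρ s ∈ Icc (0 : ℝ) 1 := ⟨hL.le.trans h2, h1.trans hs01.2⟩
      simp only [hF, pathIncr_sub]
      refine (h.lintegral_enorm_sub_le hH _ _ i).trans (ENNReal.ofReal_le_ofReal ?_)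
      rw [projIcc_of_mem _ hs01, projIcc_of_mem _ hρ01]
      refine Real.rpow_le_rpow (abs_nonneg _) ?_ hH.le
      rw [abs_of_nonneg (sub_nonneg.2 h1)]
      exact h3
    refine (setLIntegral_mono' measurableSet_Ioc hb).trans (le_of_eq ?_)
    rw [setLIntegral_const, Real.volume_Ioc, ← ENNReal.ofReal_mul (by positivity)]
    congr 1
    ring
  have hsub : {w | L / 4 < cellOsc L N fun s => lam * pathIncr w s i}
      ⊆ {w | ENNReal.ofReal (L / (4 * lam)) ≤ G w} := by
    intro w hw
    have h1 : cellOsc L N (fun s => lam * pathIncr w s i) = lam * ∫ s in L..2 * L, |F w s| := by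
      rw [cellOsc, ← intervalIntegral.integral_const_mul]
      congr 1
      ext s
      rw [← mul_sub, abs_mul, abs_of_pos hlam]
    have hw' : L / 4 < lam * ∫ s in L..2 * L, |F w s| := h1 ▸ hw
    have h2 : L / (4 * lam) ≤ ∫ s in L..2 * L, |F w s| := by
      rw [div_le_iff₀ (by positivity)]
      linarith
    refine (ENNReal.ofReal_le_ofReal h2).trans ?_
    rw [intervalIntegral.integral_of_le (by linarith)]
    refine (Real.ofReal_le_enorm _).trans ((enorm_integral_le_lintegral_enorm _).trans (le_of_eq ?_))
    simp only [hG, Real.enorm_abs]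
  refine (measure_mono hsub).trans ((meas_ge_le_lintegral_div hGm.aemeasurable
    (by simp; positivity) ENNReal.ofReal_ne_top).trans ?_)
  refine (ENNReal.div_le_div_right hGint _).trans (le_of_eq ?_)
  rw [← ENNReal.ofReal_div_of_pos (by positivity)]
  congr 1
  field_simp

/-! ### Growth of the parameters -/

lemma shearFreq_eq_rpow (k : ℕ) : shearFreq k = (2 : ℝ) ^ ((k : ℝ) ^ 4) := by
  rw [shearFreq, ← Real.rpow_natCast]
  push_cast
  rfl

lemma nat_succ_le_two_pow (k : ℕ) : (k + 1 : ℝ) ≤ 2 ^ k := by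
  exact_mod_cast Nat.succ_le_of_lt (Nat.lt_two_pow_self (n := k))

/-- Up to lower order in the exponent, the ratio is λ_k^(1-α): passing from λ_k to λ_{k-1} costs
2^(4k^3), and the remaining factors cost at most 2^(13k^3). -/
lemma rpow_le_ampRatio (α : ℝ) {k : ℕ} (hk : 1 ≤ k) :
    (2 : ℝ) ^ ((1 - α) * (k : ℝ) ^ 4 - 17 * (k : ℝ) ^ 3) ≤ ampRatio α k := by
  have hk' : (1 : ℝ) ≤ k := by exact_mod_cast hk
  have h1 : (8 * (k + 1) ^ 4 * 2 ^ (k + 1) * 16 ^ k : ℝ) ≤ (2 : ℝ) ^ (13 * (k : ℝ) ^ 3) := by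
    calc (8 * (k + 1) ^ 4 * 2 ^ (k + 1) * 16 ^ k : ℝ)
        ≤ 8 * (2 ^ k) ^ 4 * 2 ^ (k + 1) * 16 ^ k := by gcongr; exact nat_succ_le_two_pow k
      _ = (2 : ℝ) ^ (9 * k + 4 : ℕ) := by
        rw [show (8 : ℝ) = 2 ^ 3 by norm_num, show (16 : ℝ) = 2 ^ 4 by norm_num, ← pow_mul,
          ← pow_mul, ← pow_add, ← pow_add, ← pow_add]
        congr 1
        ring
      _ = (2 : ℝ) ^ ((9 * k + 4 : ℕ) : ℝ) := (Real.rpow_natCast _ _).symm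
      _ ≤ (2 : ℝ) ^ (13 * (k : ℝ) ^ 3) := by
        refine Real.rpow_le_rpow_of_exponent_le one_le_two ?_
        push_cast
        nlinarith [pow_le_pow_right₀ hk' (show 1 ≤ 3 by norm_num)]
  have h2 : (2 : ℝ) ^ ((k : ℝ) ^ 4 - 4 * (k : ℝ) ^ 3) ≤ shearFreq (k - 1) := by
    rw [shearFreq_eq_rpow]
    refine Real.rpow_le_rpow_of_exponent_le one_le_two ?_
    rw [Nat.cast_sub hk, Nat.cast_one]
    nlinarith [sq_nonneg ((k : ℝ) - 1)]
  have e : ampRatio α k = shearFreq k ^ (-α) * shearFreq (k - 1)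
      / (8 * (k + 1) ^ 4 * 2 ^ (k + 1) * 16 ^ k) := by
    unfold ampRatio ampScale
    rw [one_div_pow]
    field_simp
  have h3 : shearFreq k ^ (-α) = (2 : ℝ) ^ (-α * (k : ℝ) ^ 4) := by
    rw [shearFreq_eq_rpow, ← Real.rpow_mul zero_le_two]
    congr 1
    ring
  rw [e, h3]
  calc (2 : ℝ) ^ ((1 - α) * (k : ℝ) ^ 4 - 17 * (k : ℝ) ^ 3)
      = (2 : ℝ) ^ (-α * (k : ℝ) ^ 4) * (2 : ℝ) ^ ((k : ℝ) ^ 4 - 4 * (k : ℝ) ^ 3)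
        / (2 : ℝ) ^ (13 * (k : ℝ) ^ 3) := by
        rw [← Real.rpow_add two_pos, ← Real.rpow_sub two_pos]
        congr 1
        ring
    _ ≤ _ := by
        have := shearFreq_pos (k - 1)
        gcongr

lemma eventually_one_le_ampRatio {α : ℝ} (hα : α < 1 / 2) : ∀ᶠ k in atTop, 1 ≤ ampRatio α k := by
  -- From k = 34 on, 17k³ ≤ k⁴/2, while 1 - α > 1/2.
  filter_upwards [eventually_ge_atTop 34] with k hk
  refine le_trans ?_ (rpow_le_ampRatio α (by omega))
  refine Real.one_le_rpow one_le_two ?_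
  have hk' : (34 : ℝ) ≤ k := by exact_mod_cast hk
  have h1 : (0 : ℝ) ≤ (k : ℝ) ^ 3 := by positivity
  have h2 : (k : ℝ) ^ 4 = k * (k : ℝ) ^ 3 := by ring
  have h3 : 17 * (k : ℝ) ^ 3 ≤ 1 / 2 * (k : ℝ) ^ 4 := by rw [h2]; nlinarith
  have h4 : 1 / 2 * (k : ℝ) ^ 4 ≤ (1 - α) * (k : ℝ) ^ 4 :=
    mul_le_mul_of_nonneg_right (by linarith) (by positivity)
  linarith

lemma ampRatio_le_shearFreq {α : ℝ} (hα : 0 ≤ α) (k : ℕ) : ampRatio α k ≤ shearFreq k := by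
  have h1 : ampScale α k ≤ 1 := by
    unfold ampScale
    refine div_le_one_of_le₀ ?_ (by positivity)
    have h1 : shearFreq k ^ (-α) ≤ 1 :=
      Real.rpow_le_one_of_one_le_of_nonpos (one_le_shearFreq _) (by linarith)
    have h2 : (1 : ℝ) ≤ (k + 1) ^ 4 := one_le_pow₀ (by linarith [Nat.cast_nonneg (α := ℝ) k])
    linarith
  have h2 : (1 / 2 : ℝ) ^ (k + 1) ≤ 1 := pow_le_one₀ (by norm_num) (by norm_num)
  have h3 := shearFreq_mono (Nat.sub_le k 1)
  have h4 := shearFreq_pos (k - 1)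
  have h5 := ampScale_pos α k
  unfold ampRatio
  refine (div_le_self (by positivity) (one_le_pow₀ (by norm_num))).trans ?_
  calc ampScale α k * (1 / 2) ^ (k + 1) * shearFreq (k - 1) ≤ 1 * 1 * shearFreq k := by gcongr
    _ = shearFreq k := by ring

lemma le_cellCount (α : ℝ) (k : ℕ) : ampRatio α k ^ 2 ≤ cellCount α k := Nat.le_ceil _

lemma cellCount_le (α : ℝ) (k : ℕ) : (cellCount α k : ℝ) ≤ ampRatio α k ^ 2 + 1 :=
  (Nat.ceil_lt_add_one (sq_nonneg _)).le

/-- There are at most λ_k² + 1 cells, and λ_k² = 4^(k^4), while truncating at a level at least 4k^4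
gives exp(-4)^(k^4) ≤ 16^(-k^4). The union bound thus survives the number of cells. -/
lemma cellCount_mul_exp_le {α : ℝ} (hα : 0 ≤ α) (k : ℕ) :
    cellCount α k * (4 * Real.exp (-clampLevel k)) ≤ 8 * (1 / 2) ^ k := by
  have h1 := cellCount_le α k
  have h2 : ampRatio α k ^ 2 ≤ shearFreq k ^ 2 :=
    pow_le_pow_left₀ (ampRatio_pos α k).le (ampRatio_le_shearFreq hα k) 2
  have h3 : 1 ≤ shearFreq k ^ 2 := one_le_pow₀ (one_le_shearFreq k)
  have h4 : Real.exp (-clampLevel k) ≤ (1 / 16) ^ (k ^ 4) := by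
    have h5 : Real.exp (-4) ≤ 1 / 16 := by
      rw [Real.exp_neg, ← one_div]
      refine one_div_le_one_div_of_le (by norm_num) ?_
      have h6 : Real.exp 4 = Real.exp 1 ^ 4 := by rw [← Real.exp_nat_mul]; norm_num
      have h7 : (2 : ℝ) ≤ Real.exp 1 := by linarith [Real.add_one_le_exp 1]
      rw [h6]
      calc (16 : ℝ) = 2 ^ 4 := by norm_num
        _ ≤ _ := pow_le_pow_left₀ (by norm_num) h7 4
    calc Real.exp (-clampLevel k) ≤ Real.exp ((k ^ 4 : ℕ) * (-4)) := by
          refine Real.exp_le_exp.2 ?_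
          unfold clampLevel
          push_cast
          have : (k : ℝ) ^ 4 ≤ (k + 1) ^ 4 := by gcongr; linarith
          linarith
      _ = Real.exp (-4) ^ (k ^ 4) := Real.exp_nat_mul _ _
      _ ≤ _ := pow_le_pow_left₀ (Real.exp_pos _).le h5 _
  have h8 : shearFreq k ^ 2 * (1 / 16 : ℝ) ^ (k ^ 4) ≤ (1 / 2) ^ k := by
    have : shearFreq k ^ 2 * (1 / 16 : ℝ) ^ (k ^ 4) = (1 / 4) ^ (k ^ 4) := by
      rw [shearFreq, ← pow_mul, mul_comm (k ^ 4) 2, pow_mul, ← mul_pow]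
      norm_num
    rw [this]
    calc (1 / 4 : ℝ) ^ (k ^ 4) ≤ (1 / 2) ^ (k ^ 4) := by gcongr; norm_num
      _ ≤ (1 / 2) ^ k := pow_le_pow_of_le_one (by norm_num) (by norm_num)
        (Nat.le_self_pow (by norm_num) k)
  calc cellCount α k * (4 * Real.exp (-clampLevel k))
      ≤ (2 * shearFreq k ^ 2) * (4 * (1 / 16) ^ (k ^ 4)) := by gcongr; linarith
    _ = 8 * (shearFreq k ^ 2 * (1 / 16) ^ (k ^ 4)) := by ring
    _ ≤ _ := by gcongr

/-- Since the number of cells is at least `ampRatio α k ^ 2`, the exponent of 2 is at most -c k⁴ +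
34H k³ with c = 2H(1-α) - 1. Positivity of c is the condition relating α and H. -/
lemma eventually_shearFreq_mul_rpow_le {α H : ℝ} (hH : H ∈ Ioo (1 / 2 : ℝ) 1)
    (hα : α < 1 - 1 / (2 * H)) : ∀ᶠ k in atTop,
      shearFreq k * ((1 / 2) ^ (k + 1) / cellCount α k) ^ H ≤ (1 / 2) ^ k := by
  have hH0 : 0 < H := by linarith [hH.1]
  set c := 2 * H * (1 - α) - 1 with hc
  have hc0 : 0 < c := by
    have h1 : 1 / (2 * H) < 1 - α := by linarith
    rw [div_lt_iff₀ (by positivity)] at h1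
    linarith
  -- So that c k⁴ ≥ 35k³ absorbs both 34H k³ and the target exponent k.
  filter_upwards [eventually_ge_atTop 1, tendsto_natCast_atTop_atTop.eventually_ge_atTop (35 / c)]
    with k hk hkc
  have hk' : (1 : ℝ) ≤ k := by exact_mod_cast hk
  set E := (1 - α) * (k : ℝ) ^ 4 - 17 * (k : ℝ) ^ 3 with hE
  have hR := rpow_le_ampRatio α hk
  rw [← hE] at hR
  have hN := le_cellCount α k
  have hRp := ampRatio_pos α k
  have h1 : (1 / 2 : ℝ) ^ (k + 1) / cellCount α k ≤ (2 : ℝ) ^ (-(2 * E)) := by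
    have h2 : (2 : ℝ) ^ (2 * E) ≤ cellCount α k := by
      refine le_trans ?_ hN
      rw [mul_comm, Real.rpow_mul zero_le_two]
      exact_mod_cast pow_le_pow_left₀ (by positivity) hR 2
    calc (1 / 2 : ℝ) ^ (k + 1) / cellCount α k ≤ 1 / (2 : ℝ) ^ (2 * E) := by
          gcongr
          exact pow_le_one₀ (by norm_num) (by norm_num)
      _ = _ := by rw [Real.rpow_neg zero_le_two, one_div]
  calc shearFreq k * ((1 / 2) ^ (k + 1) / cellCount α k) ^ H
      ≤ (2 : ℝ) ^ ((k : ℝ) ^ 4) * ((2 : ℝ) ^ (-(2 * E))) ^ H := by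
        rw [shearFreq_eq_rpow]
        gcongr
    _ = (2 : ℝ) ^ ((k : ℝ) ^ 4 + -(2 * E) * H) := by
        rw [← Real.rpow_mul zero_le_two, ← Real.rpow_add two_pos]
    _ ≤ (2 : ℝ) ^ (-(k : ℝ)) := by
        refine Real.rpow_le_rpow_of_exponent_le one_le_two ?_
        rw [div_le_iff₀ hc0] at hkc
        have h3 : (k : ℝ) ≤ (k : ℝ) ^ 3 := by
          calc (k : ℝ) = (k : ℝ) ^ 1 := (pow_one _).symm
            _ ≤ _ := pow_le_pow_right₀ hk' (by norm_num)
        have h4 : 35 * (k : ℝ) ^ 3 ≤ c * (k : ℝ) ^ 4 := by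
          have : c * (k : ℝ) ^ 4 = (k * c) * (k : ℝ) ^ 3 := by ring
          rw [this]
          gcongr
        have h5 : (k : ℝ) ^ 4 + -(2 * E) * H = -(c * (k : ℝ) ^ 4) + 34 * H * (k : ℝ) ^ 3 := by
          rw [hE, hc]
          ring
        have h6 : 34 * H * (k : ℝ) ^ 3 ≤ 34 * (k : ℝ) ^ 3 := by
          have := hH.2
          gcongr
          linarith
        rw [h5]
        linarith
    _ = (1 / 2) ^ k := by
        rw [Real.rpow_neg zero_le_two, Real.rpow_natCast, one_div_pow, one_div]

/-! ### The random shears mix almost surely -/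

lemma ae_eventually_notMem_of_le_geometric {α : Type*} [MeasurableSpace α] {μ : Measure α}
    {s : ℕ → Set α} {C : ℝ} (h : ∀ᶠ k in atTop, μ (s k) ≤ ENNReal.ofReal (C * (1 / 2) ^ k)) :
    ∀ᵐ x ∂μ, ∀ᶠ k in atTop, x ∉ s k := by
  obtain ⟨K, hK⟩ := eventually_atTop.1 h
  have hsum : Summable fun k : ℕ => C * (1 / 2 : ℝ) ^ (k + K) :=
    ((summable_nat_add_iff K).2 (summable_geometric_of_lt_one (by norm_num)
      (by norm_num : (1 / 2 : ℝ) < 1))).mul_left C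
  have h1 : ∑' k, μ (s (k + K)) ≠ ∞ := ne_top_of_le_ne_top hsum.tsum_ofReal_ne_top
    (ENNReal.tsum_le_tsum fun k => hK _ (Nat.le_add_left _ _))
  filter_upwards [ae_eventually_notMem h1] with x hx
  obtain ⟨M, hM⟩ := eventually_atTop.1 hx
  filter_upwards [eventually_ge_atTop (M + K)] with k hk
  have := hM (k - K) (by omega)
  rwa [Nat.sub_add_cancel (by omega)] at this

/-- The phase of the `k`-th shear along a path. -/
def stagePhase (w : PathSpace 2 1) (k : ℕ) (s : ℝ) : ℝ :=
  shearFreq k * pathIncr w s (shearDir (k + 1))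

lemma continuous_stagePhase (w : PathSpace 2 1) (k : ℕ) : Continuous (stagePhase w k) := by
  unfold stagePhase
  have h1 := continuous_pathIncr w
  fun_prop

lemma exists_abs_stagePhase_le (w : PathSpace 2 1) (k : ℕ) : ∃ C, ∀ s, |stagePhase w k s| ≤ C := by
  refine ⟨shearFreq k * (‖w‖ + ‖w‖), fun s => ?_⟩
  rw [stagePhase, abs_mul, abs_of_pos (shearFreq_pos k)]
  refine mul_le_mul_of_nonneg_left ((abs_coord_le _ _).trans ?_) (shearFreq_pos k).le
  exact (norm_sub_le _ _).trans (add_le_add (w.norm_coe_le_norm _) (w.norm_coe_le_norm _))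

/-- The amplitude of the `k`-th shear has the size needed for mixing. -/
def AmpInRange (β : ℕ → ℂ) (k : ℕ) : Prop :=
  8 ^ k ≤ ‖β k‖ * shearFreq (k - 1) ∧ ‖β k‖ * shearFreq (k - 1) ≤ 32 ^ k

/-- The Gaussian combination has size about L/√N, hence about L/R, and `ampRatio` is normalized so
that `‖β k‖ * shearFreq (k - 1)` is then about 16^k. The window from 8^k to 32^k leaves a factor 2^k
on each side. Failure means an active truncation, a small ball or a large value, with probabilities
at most 8, 4 and 4 times 2^(-k). -/
lemma gaussField_not_ampInRange_le {α : ℝ} (hα : 0 ≤ α) {w : PathSpace 2 1} {k : ℕ}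
    (hR : 1 ≤ ampRatio α k)
    (hosc : cellOsc ((1 / 2) ^ (k + 1)) (cellCount α k) (stagePhase w k) ≤ (1 / 2) ^ (k + 1) / 4) :
    gaussField {ω | ¬ AmpInRange (shearAmp (randAmp α ω) w) k}
      ≤ ENNReal.ofReal (16 * (1 / 2) ^ k) := by
  set L : ℝ := (1 / 2) ^ (k + 1) with hLdef
  have hL : 0 < L := by positivity
  have hN := cellCount_pos α k
  have hN1 := le_cellCount α k
  have hN2 := cellCount_le α k
  have hamp := fun ω h => shearAmp_randAmp hα (ω := ω) (k := k) h w
  rw [← hLdef] at hamp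
  set N := cellCount α k with hNdef
  have hN' : (0 : ℝ) < N := by positivity
  set R := ampRatio α k with hRdef
  set a := ampScale α k with hadef
  set lam := shearFreq (k - 1) with hlam
  have ha : 0 < a := ampScale_pos α k
  have hlam0 : 0 < lam := shearFreq_pos _
  have haL : a * L * lam = 16 ^ k * R := by
    rw [hRdef, ampRatio]
    field_simp
    rfl
  obtain ⟨C, hC⟩ := exists_abs_stagePhase_le w k
  set c := cellAmp L N (stagePhase w k) with hc
  have hlow := le_sum_sq_norm_cellAmp (continuous_stagePhase w k) hC hL hN hosc
  have hup := sum_sq_norm_cellAmp_le hL hN (stagePhase w k)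
  rw [← hc] at hlow hup
  have hsub : {ω | ¬ AmpInRange (shearAmp (randAmp α ω) w) k}
      ⊆ {ω | ∃ j < N, clampLevel k < |ω (k, j)|} ∪
        ({ω | ‖gaussComb c k N ω‖ ≤ 8 ^ k / (a * lam)} ∪
          {ω | 32 ^ k / (a * lam) ≤ ‖gaussComb c k N ω‖}) := by
    intro ω hω
    by_contra hn
    simp only [mem_union, mem_ofPred_eq, not_or, not_exists, not_and, not_le, not_lt] at hn
    obtain ⟨h1, h2, h3⟩ := hn
    refine hω ?_
    have h4 : ‖shearAmp (randAmp α ω) w k‖ * lam = ‖gaussComb c k N ω‖ * (a * lam) := by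
      rw [hamp ω h1, norm_mul, Complex.norm_real, Real.norm_eq_abs, abs_of_pos ha]
      change a * ‖gaussComb c k N ω‖ * lam = _
      ring
    rw [div_lt_iff₀ (by positivity)] at h2
    rw [lt_div_iff₀ (by positivity)] at h3
    rw [AmpInRange, ← hlam, h4]
    exact ⟨h2.le, h3.le⟩
  have hp1 := (gaussField_exists_lt_abs_le k N (clampLevel k)).trans
    (ENNReal.ofReal_le_ofReal (cellCount_mul_exp_le hα k))
  have hp2 : gaussField {ω | ‖gaussComb c k N ω‖ ≤ 8 ^ k / (a * lam)}
      ≤ ENNReal.ofReal (4 * (1 / 2) ^ k) := by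
    -- With N ≤ R² + 1 ≤ 2R², this s satisfies 2s² ≤ L²/(2N), the lower bound on the square sum.
    have hs : 0 < L / (4 * R) := by positivity
    refine (gaussField_norm_gaussComb_le c k N hs ?_).trans (ENNReal.ofReal_le_ofReal (le_of_eq ?_))
    · refine le_trans ?_ hlow
      have hN3 : (N : ℝ) ≤ 2 * R ^ 2 := by
        have : 1 ≤ R ^ 2 := one_le_pow₀ hR
        linarith
      rw [div_pow, ← mul_div_assoc, div_le_div_iff₀ (by positivity) (by positivity)]
      have : L ^ 2 * (2 * (2 * N)) ≤ L ^ 2 * (4 * R) ^ 2 := by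
        refine mul_le_mul_of_nonneg_left ?_ (by positivity)
        nlinarith [sq_nonneg R]
      linarith
    · have e : 8 ^ k / (a * lam) / (L / (4 * R)) = 4 * 8 ^ k * R / (a * L * lam) := by
        field_simp
      rw [e, haL, show (16 : ℝ) ^ k = 8 ^ k * 2 ^ k by rw [← mul_pow]; norm_num, one_div_pow]
      field_simp
  have hp3 : gaussField {ω | 32 ^ k / (a * lam) ≤ ‖gaussComb c k N ω‖}
      ≤ ENNReal.ofReal (4 * (1 / 2) ^ k) := by
    refine (gaussField_le_norm_gaussComb c k N (by positivity)).trans (ENNReal.ofReal_le_ofReal ?_)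
    calc 4 * (∑ j ∈ Finset.range N, ‖c j‖ ^ 2) / (32 ^ k / (a * lam)) ^ 2
        ≤ 4 * (L ^ 2 / N) / (32 ^ k / (a * lam)) ^ 2 := by gcongr
      _ = 4 * (a * L * lam) ^ 2 / (N * (32 ^ k) ^ 2) := by field_simp
      _ ≤ 4 * (a * L * lam) ^ 2 / (R ^ 2 * (32 ^ k) ^ 2) := by gcongr
      _ = 4 * ((1 / 2) ^ k) ^ 2 := by
        rw [haL, show (32 : ℝ) ^ k = 16 ^ k * 2 ^ k by rw [← mul_pow]; norm_num, one_div_pow]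
        field_simp
      _ ≤ 4 * (1 / 2) ^ k := by
        have h1 : (1 / 2 : ℝ) ^ k ≤ 1 := pow_le_one₀ (by norm_num) (by norm_num)
        have h2 : (0 : ℝ) ≤ (1 / 2) ^ k := by positivity
        nlinarith
  refine (measure_mono hsub).trans ((measure_union_le _ _).trans ?_)
  refine (add_le_add hp1 ((measure_union_le _ _).trans (add_le_add hp2 hp3))).trans (le_of_eq ?_)
  rw [← ENNReal.ofReal_add (by positivity) (by positivity),
    ← ENNReal.ofReal_add (by positivity) (by positivity)]
  congr 1
  ring

lemma ae_eventually_cellOsc_le {α H : ℝ} (hH : H ∈ Ioo (1 / 2 : ℝ) 1)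
    (hα : α < 1 - 1 / (2 * H)) {𝕎 : Measure (PathSpace 2 1)} [IsProbabilityMeasure 𝕎]
    (h : IsFBM H 𝕎) : ∀ᵐ w ∂𝕎, ∀ᶠ k in atTop,
      cellOsc ((1 / 2) ^ (k + 1)) (cellCount α k) (stagePhase w k) ≤ (1 / 2) ^ (k + 1) / 4 := by
  have h1 := ae_eventually_notMem_of_le_geometric (μ := 𝕎) (C := 4)
    (s := fun k => {w | (1 / 2) ^ (k + 1) / 4
      < cellOsc ((1 / 2) ^ (k + 1)) (cellCount α k) (stagePhase w k)}) ?_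
  · filter_upwards [h1] with w hw
    filter_upwards [hw] with k hk
    exact not_lt.1 hk
  · filter_upwards [eventually_shearFreq_mul_rpow_le hH hα] with k hk
    have hL1 : 2 * (1 / 2 : ℝ) ^ (k + 1) ≤ 1 := by
      rw [pow_succ]
      linarith [pow_le_one₀ (n := k) (by norm_num : (0 : ℝ) ≤ 1 / 2) (by norm_num)]
    refine (h.measure_lt_cellOsc_le (by linarith [hH.1]) (by positivity) hL1 (cellCount_pos α k)
      (shearFreq_pos k) (shearDir (k + 1))).trans (ENNReal.ofReal_le_ofReal ?_)
    linarith

lemma measurable_shearAmp_prod {S : Type*} [MeasurableSpace S] {b : S → ℝ → ℝ}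
    (hb : Measurable fun p : S × ℝ => b p.1 p.2) (k : ℕ) :
    Measurable fun p : S × PathSpace 2 1 => shearAmp (b p.1) p.2 k := by
  unfold shearAmp
  simp_rw [intervalIntegral.integral_of_le
    (pow_le_pow_of_le_one (by norm_num : (0 : ℝ) ≤ 1 / 2) (by norm_num) (Nat.le_succ k))]
  have h1 : Measurable fun q : (S × PathSpace 2 1) × ℝ =>
      pathIncr q.1.2 q.2 (shearDir (k + 1)) :=
    (measurable_coord _).comp (measurable_pathIncr.comp
      ((measurable_snd.comp measurable_fst).prodMk measurable_snd))
  have h2 : Measurable fun q : (S × PathSpace 2 1) × ℝ => b q.1.1 q.2 :=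
    hb.comp ((measurable_fst.comp measurable_fst).prodMk measurable_snd)
  have : StronglyMeasurable fun q : (S × PathSpace 2 1) × ℝ => (b q.1.1 q.2 : ℂ) *
      Complex.exp ((shearFreq k * pathIncr q.1.2 q.2 (shearDir (k + 1)) : ℝ) * Complex.I) :=
    ((Complex.measurable_ofReal.comp h2).mul
      (Complex.measurable_exp.comp ((Complex.measurable_ofReal.comp
        (h1.const_mul _)).mul_const _))).stronglyMeasurable
  exact (this.integral_prod_right' (ν := volume.restrict (Ioc _ _))).measurable

/-- Almost surely, the random shears mix along fractional Brownian motion. -/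
theorem ae_shearsMix_randAmp {α H : ℝ} (hα0 : 0 ≤ α) (hα2 : α < 1 / 2)
    (hH : H ∈ Ioo (1 / 2 : ℝ) 1) (hα : α < 1 - 1 / (2 * H)) {𝕎 : Measure (PathSpace 2 1)}
    [IsProbabilityMeasure 𝕎] (h : IsFBM H 𝕎) :
    ∀ᵐ p ∂(gaussField.prod 𝕎), ∃ m, ShearsMixFrom (shearAmp (randAmp α p.1) p.2) m := by
  have hmeas : MeasurableSet {p : (ℕ × ℕ → ℝ) × PathSpace 2 1 |
      ∃ m, ShearsMixFrom (shearAmp (randAmp α p.1) p.2) m} := by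
    have e : {p : (ℕ × ℕ → ℝ) × PathSpace 2 1 |
        ∃ m, ShearsMixFrom (shearAmp (randAmp α p.1) p.2) m}
        = ⋃ m, {p | ShearsMixFrom (shearAmp (randAmp α p.1) p.2) m} := by
      ext p
      simp
    rw [e]
    exact MeasurableSet.iUnion (measurableSet_shearsMixFrom
      (measurable_shearAmp_prod (measurable_randAmp α)))
  rw [Measure.ae_prod_iff_ae_ae hmeas]
  -- The Gaussian estimates hold for a fixed noise path of small oscillation, so the noise is fixed
  -- first and the amplitude is drawn afterwards.
  refine (Measure.ae_ae_comm (p := fun ω w =>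
    ∃ m, ShearsMixFrom (shearAmp (randAmp α ω) w) m) hmeas).2 ?_
  filter_upwards [ae_eventually_cellOsc_le hH hα h] with w hw
  have h1 := ae_eventually_notMem_of_le_geometric (μ := gaussField) (C := 16)
    (s := fun k => {ω | ¬ AmpInRange (shearAmp (randAmp α ω) w) k}) (by
      filter_upwards [hw, eventually_one_le_ampRatio hα2] with k hk hR
      exact gaussField_not_ampInRange_le hα0 hR hk)
  filter_upwards [h1] with ω hω
  obtain ⟨m, hm⟩ := eventually_atTop.1 hω
  refine ⟨m, fun k hk => ?_⟩
  have := not_not.1 (hm (k + 1) (by omega))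
  rwa [AmpInRange, Nat.add_sub_cancel] at this

/-! ### The random velocity field -/

lemma abs_cos_sub_cos_le_rpow {α : ℝ} (h0 : 0 ≤ α) (h1 : α ≤ 1) (x y : ℝ) :
    |Real.cos x - Real.cos y| ≤ 2 * |x - y| ^ α := by
  rcases le_total |x - y| 1 with h | h
  · have h2 : |x - y| ≤ |x - y| ^ α := Real.self_le_rpow_of_le_one (abs_nonneg _) h h1
    linarith [abs_cos_sub_cos_le x y, abs_nonneg (x - y)]
  · have h2 : 1 ≤ |x - y| ^ α := Real.one_le_rpow h h0
    have h3 := abs_sub (Real.cos x) (Real.cos y)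
    linarith [Real.abs_cos_le_one x, Real.abs_cos_le_one y]

lemma norm_sineShear_sub_le {α : ℝ} (h0 : 0 ≤ α) (h1 : α ≤ 1) (k : ℕ) (x y : Eucl 2) :
    ‖sineShear k x - sineShear k y‖ ≤ 2 * shearFreq k ^ α * ‖x - y‖ ^ α := by
  rw [sineShear_apply, sineShear_apply, ← sub_smul, norm_smul, norm_shearVec, mul_one,
    Real.norm_eq_abs]
  refine (abs_cos_sub_cos_le_rpow h0 h1 _ _).trans ?_
  rw [← mul_sub, abs_mul, abs_of_pos (shearFreq_pos k),
    Real.mul_rpow (shearFreq_pos k).le (abs_nonneg _), ← mul_assoc]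
  have h2 := abs_coord_le (x - y) (shearDir (k + 1))
  have h3 := shearFreq_pos k
  rw [PiLp.sub_apply] at h2
  gcongr

/-- The sinusoid has α-Hölder seminorm at most 2λ^α, which the amplitude λ^(-α)/2 compensates
exactly; the supremum norm contributes at most another 1. -/
lemma holderNorm_shearField_le {α : ℝ} (h0 : 0 ≤ α) (h1 : α ≤ 1) {b : ℝ → ℝ} {t : ℝ}
    (hb : |b t| ≤ shearFreq (stage t) ^ (-α) / 2) : holderNorm α (shearField b t) ≤ 2 := by
  set k := stage t with hk
  have hlam := shearFreq_pos k
  have hb1 : |b t| ≤ 1 := by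
    have : shearFreq k ^ (-α) ≤ 1 :=
      Real.rpow_le_one_of_one_le_of_nonpos (one_le_shearFreq _) (by linarith)
    linarith
  have hsup : ⨆ x, ‖shearField b t x‖ₑ ≤ 1 := by
    refine iSup_le fun x => ?_
    rw [← ofReal_norm]
    refine ENNReal.ofReal_le_one.2 ?_
    rw [shearField, BoundedContinuousFunction.smul_apply, norm_smul, Real.norm_eq_abs]
    exact mul_le_one₀ hb1 (norm_nonneg _)
      (((sineShear (stage t)).norm_coe_le_norm x).trans (norm_sineShear_le _))
  unfold holderNorm
  split_ifs with hα
  · exact hsup.trans one_le_two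
  · have hhol : HolderWith 1 α.toNNReal (shearField b t) := by
      intro x y
      rw [Real.coe_toNNReal _ h0, ENNReal.coe_one, one_mul, edist_dist, edist_dist,
        ENNReal.ofReal_rpow_of_nonneg dist_nonneg h0]
      refine ENNReal.ofReal_le_ofReal ?_
      rw [dist_eq_norm, dist_eq_norm, shearField, BoundedContinuousFunction.smul_apply,
        BoundedContinuousFunction.smul_apply, ← smul_sub, norm_smul, Real.norm_eq_abs]
      calc |b t| * ‖sineShear k x - sineShear k y‖
          ≤ shearFreq k ^ (-α) / 2 * (2 * shearFreq k ^ α * ‖x - y‖ ^ α) := by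
            gcongr
            exact norm_sineShear_sub_le h0 h1 k x y
        _ = shearFreq k ^ (-α) * shearFreq k ^ α * ‖x - y‖ ^ α := by ring
        _ = ‖x - y‖ ^ α := by rw [← Real.rpow_add hlam, neg_add_cancel, Real.rpow_zero, one_mul]
    calc (⨆ x, ‖shearField b t x‖ₑ) + eHolderNorm α.toNNReal (shearField b t)
        ≤ 1 + 1 := add_le_add hsup (by exact_mod_cast hhol.eHolderNorm_le)
      _ = 2 := one_add_one_eq_two

lemma measurable_shearField_prod {S : Type*} [MeasurableSpace S] {b : S → ℝ → ℝ}
    (hb : Measurable fun p : S × ℝ => b p.1 p.2) :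
    Measurable fun p : S × ℝ × Eucl 2 => shearField (b p.1) p.2.1 p.2.2 := by
  have h1 : Measurable fun q : ℕ × Eucl 2 => sineShear q.1 q.2 :=
    measurable_from_prod_countable_right fun k =>
      (map_continuous (sineShear k)).measurable
  have h2 : Measurable fun p : S × ℝ × Eucl 2 => b p.1 p.2.1 :=
    hb.comp (measurable_fst.prodMk (measurable_fst.comp measurable_snd))
  have hst : Measurable fun p : S × ℝ × Eucl 2 => (stage p.2.1, p.2.2) :=
    (measurable_stage.comp (measurable_fst.comp measurable_snd)).prodMk
      (measurable_snd.comp measurable_snd)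
  have h3 := h1.comp hst
  simp only [shearField, BoundedContinuousFunction.smul_apply]
  exact Measurable.smul h2 h3

lemma measurable_curry_right {S : Type*} [MeasurableSpace S] {b : S → ℝ → ℝ}
    (hb : Measurable fun p : S × ℝ => b p.1 p.2) (s : S) : Measurable (b s) :=
  hb.comp measurable_prodMk_left

/-! ### The main theorem -/

theorem corollary1p8 (α : ℝ) (hα0 : 0 ≤ α) (hα : α < 1 / 2) :
    ∃ (Ω : Type) (_ : MeasurableSpace Ω) (P : Measure Ω) (_ : IsProbabilityMeasure P)
      (u : Ω → VelocityField 2),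
      -- `u` is a random velocity field in `L¹([0,1], C⁰(ℝ²))`, surely bounded by `2` in `C^α`
      (Measurable fun p : Ω × ℝ × Eucl 2 => u p.1 p.2.1 p.2.2) ∧
      (∀ ω, IntegrableOn (u ω) (Icc 0 1) volume) ∧
      (∀ ω, ∀ t ∈ Icc (0 : ℝ) 1, holderNorm α (u ω t) ≤ 2) ∧
      ∀ H ∈ Ioo (1 / 2 : ℝ) 1, α < 1 - 1 / (2 * H) →
        ∀ (𝕎 : Measure (PathSpace 2 1)) [IsProbabilityMeasure 𝕎], IsFBM H 𝕎 →
          -- pathwise nonuniqueness on every `[0,ε]`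
          (∀ y : Eucl 2, ∀ᵐ ω ∂P, ∀ ε : ℝ, 0 < ε → ∀ hε : ε ≤ 1,
            PathwiseNonuniqueOn zero_le_one (u ω) y 𝕎 hε) ∧
          -- a weak solution whose conditional law given `W` charges more than one path
          (∀ y : Eucl 2, ∀ᵐ ω ∂P,
            ∃ (𝕏 : Measure (PathSpace 2 1 × PathSpace 2 1)) (_ : IsProbabilityMeasure 𝕏),
              IsWeakSolution zero_le_one (u ω) y 𝕎 𝕏 ∧
              ∀ ε : ℝ, 0 < ε → ∀ hε : ε ≤ 1,
                ∀ᵐ w ∂𝕎, (condLawGivenNoise 𝕏 hε w).support.Nontrivial) ∧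
          -- nonuniqueness of Carathéodory solutions for almost every `(u, W)`
          (∀ y : Eucl 2, ∀ᵐ p ∂(P.prod 𝕎), ∀ ε : ℝ, ∀ hε0 : 0 < ε, ∀ hε : ε ≤ 1,
            {X : PathSpace 2 ε |
              IsCaratheodorySolution hε0.le (u p.1) y (restrictPath hε p.2) X}.Nontrivial) := by
  have hbm : ∀ ω, Measurable (randAmp α ω) := measurable_curry_right (measurable_randAmp α)
  have hb : ∀ ω t, |randAmp α ω t| ≤ 1 := abs_randAmp_le_one hα0
  refine ⟨ℕ × ℕ → ℝ, inferInstance, gaussField, inferInstance, fun ω => shearField (randAmp α ω),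
    measurable_shearField_prod (measurable_randAmp α), fun ω => ?_, fun ω t _ =>
      holderNorm_shearField_le hα0 (by linarith) (abs_randAmp_le α ω t), ?_⟩
  · exact Measure.integrableOn_of_bounded (M := 1) (by simp)
      (stronglyMeasurable_shearField (hbm ω)).aestronglyMeasurable
      (Eventually.of_forall (norm_shearField_le (hb ω)))
  intro H hH hαH 𝕎 _ hW
  have hmix := ae_shearsMix_randAmp hα0 hα hH hαH hW
  -- The exceptional set of fields obtained here depends neither on y nor on ε.
  have hmix2 := Measure.ae_ae_of_ae_prod hmix
  refine ⟨fun y => ?_, fun y => ?_, fun y => ?_⟩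
  · filter_upwards [hmix2] with ω hω ε hε0 hε
    obtain ⟨𝕏, _, hweak, hspread⟩ := exists_isWeakSolution_spread (hbm ω) (hb ω) hω y
    exact (condSpread_of_phaseSpread hspread).pathwiseNonuniqueOn hweak hε0 hε
  · filter_upwards [hmix2] with ω hω
    obtain ⟨𝕏, h𝕏, hweak, hspread⟩ := exists_isWeakSolution_spread (hbm ω) (hb ω) hω y
    exact ⟨𝕏, h𝕏, hweak, fun ε hε0 hε =>
      (condSpread_of_phaseSpread hspread).support_nontrivial hweak.noise_marginal hε0 hε⟩
  · filter_upwards [hmix] with p hp ε hε0 hε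
    exact nontrivial_solutions_of_shearsMix (hbm p.1) (hb p.1) hp y hε0 hε

end
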